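/- **Setting.** A 3-SAT instance $\varphi$ on $n$ variables is a list of clauses, each with at most three literals on distinct variables. Let $0<\theta\le\pi/2$, $|+\rangle=(|0\rangle+|1\rangle)/\sqrt2$ and let $R_Y$ denote the rotation about the $Y$-axis. The truth value TRUE (bit 1) is encoded as $R_Y(\theta)|+\rangle$, FALSE (bit 0) as $R_Y(-\theta)|+\rangle$. The projector $P_c(\theta)$ of a clause $c$ is the tensor product of the rank-one projectors onto $R_Y(\pi+\theta)|+\rangle$ on the qubits of its positive literals, onto $R_Y(\pi-\theta)|+\rangle$ on the qubits of its negative literals, and of identities elsewhere. Put $C_c(\theta)=1-P_c(\theta)$, $H(\theta)=\sum_c P_c(\theta)$, and let $\mathcal P_{\rm GS}(\theta)$ be the orthogonal projector onto $\ker H(\theta)$. **Layers.** Let $F$ be a family of functions $[n]\to[3]$ such that every set of at most three points is mapped injectively by some member, of size $|F|\le \frac{3}{\ln(27/21)}\ln n$. Composing the members of $F$ with the eight maps $[3]\to\{0,1\}$ gives $8|F|$ bit strings (layers). Each clause is assigned to the first layer that agrees with the signs of all its literals. The clause checks in a layer commute, and the layer is measured by the two-outcome measurement $\{\Pi,1-\Pi\}$,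 $\Pi=\prod_{c}C_c(\theta)$. A cycle measures all layers once; $T_\varphi$ is the product of all $\Pi$ in this order. A number $\mu\in(0,1)$ is a rate for $\varphi$ if $\|T_\varphi^r-\mathcal P_{\rm GS}(\theta)\|\le\mu^r$ for all $r\ge1$. **State preparation with tolerance $\epsilon$ on $k$ qubits.** Start from $|+\rangle^{\otimes k}$ and perform $r^*=\lceil\ln((\epsilon\cos^k(\theta/2))^{-1})/\ln(\mu^{-1})\rceil$ cycles, restarting whenever a check fails. In the amplitude-amplified version an attempt consists of the coherent implementation $A$ of these checks (failures are recorded in auxiliary qubits), followed by $j$ amplitude amplification rounds $-AS_0A^{-1}S_\chi$, with $j$ uniform in $\{0,\dots,\lceil(2/(1+\cos\theta))^{k/2}\rceil\}$, and by the measurement whether no failure is recorded; it is repeated until this succeeds. **Readout.** *Unique solution:* with $\epsilon=\frac{(1-1/\sqrt2)^2}{8}\sin^2\theta$, prepare $R=\lceil 2\ln(n/\delta)/\ln(2/(1+\cos^2\theta))\rceil$ copies, measure all qubits of each copy in the computational basis, and set each bit by majority vote. *Multiple solutions:* with $\epsilon=\sin^2(\theta)/8$, for the variables one after the other, prepare $\lceil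 8\ln(2n/\delta)/\sin^2\theta\rceil$ copies for the current formula, measure the qubit of the current variable in each copy, let $p$ be the mean outcome (TRUE counts $+1$, FALSE counts $-1$), set the variable to FALSE if $|p+\sin\theta|\le|p-\sin\theta|$ and to TRUE otherwise, and simplify the formula accordingly (satisfied clauses are deleted, falsified literals are removed, the number of qubits decreases by one, and the layers are restricted to the remaining variables). The runtime is the number of measurements. In the amplified version every check in $A$ or $A^{-1}$, every reflection and every final measurement counts as one. **Theorem (Overall time complexity).** Families $F$ as above exist for every $n\ge2$. For every 3-SAT instance, layers as above and angle $\theta\in(0,\pi/2]$ there is a $\mu\in(0,1)$ that is a rate for the instance and for all satisfiable formulas that arise from it by fixing the first, second, … variables one after the other. Moreover, put $$\mathcal T(t)=\ln(n)\left\lceil\frac{\ln\frac{1}{1-\cos^2\theta}+n\ln\frac1{\cos(\theta/2)}}{\ln(\mu^{-1})}\right\rceil\ln(\delta^{-1})\left(\frac{2}{1+\cos\theta}\right)^{n/q}t ,$$ where $q=1$ for the default version and $q=2$ for the amplitude-amplified version. For all $n\ge2$, $0<\delta\le\frac12$, $0<\theta\le\pi/2$, every $F$ as above and both versions, the following holds.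 1. (Unique solution.) There is an absolute constant $C$ such that, for every 3-SAT instance with exactly one solution and every rate $\mu\in(0,1)$ for it, the algorithm with the readout for a unique solution halts within $B$ measurements with a satisfying assignment with probability at least $1-\delta$, for every integer $B\ge C\,\mathcal T(t_{\rm unique})$, $t_{\rm unique}=\ln(n/\delta)/\ln\frac{2}{1+\cos^2\theta}$. 2. (Possibly multiple solutions.) For every $\theta_0>0$ there is a constant $C$ that depends only on $\theta_0$ such that, for $\theta\ge\theta_0$, every satisfiable 3-SAT instance and every $\mu\in(0,1)$ that is a rate for it and for all satisfiable formulas that arise from it by fixing the first, second, … variables one after the other, the algorithm with the readout for multiple solutions halts within $B$ measurements with a satisfying assignment with probability at least $1-\delta$, for every integer $B\ge C\,\mathcal T(t_{\rm multiple})$, $t_{\rm multiple}=\ln(n/\delta)/\sin^2\theta$. 3. The same as 2 holds for all $\theta\in(0,\pi/2]$ with an absolute constant $C$ if $B\ge C\,\min\{n,\tfrac1{1-\cos\theta}\}\,\mathcal T(t_{\rm multiple})$. -/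

import Mathlib

open Real
open scoped NNReal ENNReal

noncomputable section

namespace QSat

/-! ### SAT formulas -/

/-- A disjunctive clause on `k` variables: `c i = some true` if the literal `b_i` occurs,
`c i = some false` if the literal `¬ b_i` occurs, and `c i = none` if variable `i` does not occur. -/
abbrev Clause (k : ℕ) := Fin k → Option Bool

/-- A formula in conjunctive normal form, as its list of clauses. -/
abbrev CNF (k : ℕ) := List (Clause k)

/-- The assignment `x` makes some literal of `c` true. -/
def Clause.Sat {k : ℕ} (c : Clause k) (x : Fin k → Bool) : Prop := ∃ i, c i = some (x i)

/-- The assignment `x` satisfies every clause. -/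
def CNF.Sat {k : ℕ} (φ : CNF k) (x : Fin k → Bool) : Prop := ∀ c ∈ φ, Clause.Sat c x

/-- 3-SAT: every clause has at most three literals. -/
def CNF.IsThreeSAT {k : ℕ} (φ : CNF k) : Prop :=
  ∀ c ∈ φ, (Finset.univ.filter fun i => c i ≠ none).card ≤ 3

/-- Propagation of the assignment `s` of the first variable: clauses that it satisfies are
discarded, and the literal on the first variable is deleted from the other ones. -/
def CNF.propagate {k : ℕ} (s : Bool) (φ : CNF (k + 1)) : CNF k :=
  (φ.filter fun c => decide (c 0 ≠ some s)).map fun c i => c i.succ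

/-! ### Rotated encoding and Hamiltonian -/

/-- State space of `k` qubits, with the computational basis indexed by bit strings. -/
abbrev Reg (k : ℕ) := EuclideanSpace ℂ (Fin k → Bool)

/-- `|+⟩` (`false` is the basis state `0` and `true` is the basis state `1`). -/
def plusKet : Bool → ℂ := fun _ => ((√2)⁻¹ : ℝ)

/-- The rotation `R_Y(α)` about the Y-axis. -/
def rotY (α : ℝ) : Matrix Bool Bool ℂ := fun a b =>
  match a, b with
  | false, false => (Real.cos (α / 2) : ℝ)
  | false, true => (-Real.sin (α / 2) : ℝ)
  | true, false => (Real.sin (α / 2) : ℝ)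
  | true, true => (Real.cos (α / 2) : ℝ)

/-- `+1` for TRUE and `-1` for FALSE. -/
def boolSign (b : Bool) : ℝ := if b then 1 else -1

/-- `R_Y(π ± θ)|+⟩`, the state orthogonal to the encoding `R_Y(± θ)|+⟩` of the truth value `b`. -/
def perpKet (θ : ℝ) (b : Bool) : Bool → ℂ :=
  (rotY (Real.pi + boolSign b * θ)).mulVec plusKet

/-- The clause projector: the tensor product, over the qubits, of the rank-one projectors onto
`perpKet` for the qubits that occur in the clause and of the identity for the other ones. -/
def clauseProj {k : ℕ} (θ : ℝ) (c : Clause k) : Reg k →L[ℂ] Reg k :=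
  Matrix.toEuclideanCLM (𝕜 := ℂ) (n := Fin k → Bool) fun x y =>
    ∏ i, match c i with
      | some b => perpKet θ b (x i) * star (perpKet θ b (y i))
      | none => if x i = y i then 1 else 0

/-- The projector `C = 1 - P` onto the passed outcome of a clause check. -/
def clauseCheck {k : ℕ} (θ : ℝ) (c : Clause k) : Reg k →L[ℂ] Reg k := 1 - clauseProj θ c

/-- The Hamiltonian `H(θ)`, the sum of the clause projectors. -/
def hamiltonian {k : ℕ} (θ : ℝ) (φ : CNF k) : Reg k →L[ℂ] Reg k :=
  (φ.map (clauseProj θ)).sum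

/-- Orthogonal projector onto the zero-energy space (the ground space, if `φ` is satisfiable). -/
def groundProj {k : ℕ} (θ : ℝ) (φ : CNF k) : Reg k →L[ℂ] Reg k :=
  (LinearMap.ker (hamiltonian θ φ).toLinearMap).starProjection

/-- The initial state `|+⟩^{⊗ k}`. -/
def plusState (k : ℕ) : Reg k := WithLp.toLp 2 fun x => ∏ i, plusKet (x i)

/-! ### Layers of commuting clause checks -/

/-- A perfect hash family with three symbols on `n` points: each set of at most three points is
mapped injectively by some member of the family. -/
def IsPerfectHashFamily {n : ℕ} (F : List (Fin n → Fin 3)) : Prop :=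
  ∀ S : Finset (Fin n), S.card ≤ 3 → ∃ f ∈ F, Set.InjOn f S

/-- The layers derived from a hash family: each of its functions is composed with each of the
eight maps from the three symbols to the truth values. -/
def layersOf {n : ℕ} (F : List (Fin n → Fin 3)) : List (Fin n → Bool) :=
  F.flatMap fun f => (Finset.univ : Finset (Fin 3 → Bool)).toList.map fun g => g ∘ f

/-- A clause is compatible with a layer if its signs agree with the layer where they are given. -/
def Compatible {k : ℕ} (b : Fin k → Bool) (c : Clause k) : Prop :=
  ∀ i, c i = none ∨ c i = some (b i)

instance {k : ℕ} (b : Fin k → Bool) (c : Clause k) : Decidable (Compatible b c) := by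
  unfold Compatible; infer_instance

/-- Measurements of one cycle, in the order in which they are made, one for each layer. A clause is
grouped into the first layer it is compatible with. The passed outcome of the measurement of a layer
is the product of the (commuting) clause checks in the layer. -/
def cycleChecks {k : ℕ} (θ : ℝ) : List (Fin k → Bool) → CNF k → List (Reg k →L[ℂ] Reg k)
  | [], _ => []
  | b :: L, φ =>
      ((φ.filter fun c => decide (Compatible b c)).map (clauseCheck θ)).prod ::
        cycleChecks θ L (φ.filter fun c => !decide (Compatible b c))

/-- The product of the checks of one cycle (the first measurement acts first). -/
def cycleOp {k : ℕ} (θ : ℝ) (L : List (Fin k → Bool)) (φ : CNF k) : Reg k →L[ℂ] Reg k :=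
  (cycleChecks θ L φ).reverse.prod

/-- `μ` bounds the speed of convergence of the cycles to the ground space. -/
def IsRate {k : ℕ} (θ μ : ℝ) (L : List (Fin k → Bool)) (φ : CNF k) : Prop :=
  ∀ r : ℕ, 1 ≤ r → ∀ ψ : Reg k,
    ‖(cycleOp θ L φ ^ r) ψ - groundProj θ φ ψ‖ ≤ μ ^ r * ‖ψ‖

/-- `μ` bounds the speed of convergence for `φ` and for each satisfiable formula that arises from
`φ` by fixing the first, the second, ... variable one after the other. -/
def IsUniformRate (θ μ : ℝ) : (k : ℕ) → List (Fin k → Bool) → CNF k → Prop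
  | 0, _, _ => True
  | k + 1, L, φ =>
      IsRate θ μ L φ ∧
        ∀ s : Bool, (∃ x, CNF.Sat (CNF.propagate s φ) x) →
          IsUniformRate θ μ k (L.map fun b i => b i.succ) (CNF.propagate s φ)

/-! ### Randomized computations with a measurement budget -/

/-- A randomized computation that is charged for its measurements. Run with a budget of `B`
measurements, it ends in `none` if it would exceed the budget, and otherwise in `some (a, B')`,
where `a` is its result and `B'` is the unused part of the budget. -/
def Run (α : Type) := ℕ → PMF (Option (α × ℕ))

namespace Run

variable {α β : Type}

/-- Return a result at no cost. -/
def ret (a : α) : Run α := fun B => PMF.pure (some (a, B))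

/-- Sequential composition. -/
def bind (p : Run α) (f : α → Run β) : Run β := fun B =>
  (p B).bind fun o =>
    match o with
    | none => PMF.pure none
    | some (a, B') => f a B'

/-- Draw a sample at no cost. -/
def sample (p : PMF α) : Run α := fun B => p.map fun a => some (a, B)

/-- Spend `c` units of the budget. -/
def spend (c : ℕ) : Run Unit := fun B =>
  if c ≤ B then PMF.pure (some ((), B - c)) else PMF.pure none

/-- Run `p` repeatedly, `r` times, and collect the results. -/
def replicate (p : Run α) : ℕ → Run (List α)
  | 0 => ret []
  | r + 1 => bind p fun a => bind (replicate p r) fun l => ret (a :: l)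

/-- At most `fuel` attempts, until one of them succeeds. -/
def retryFuel (p : Run (Option α)) : ℕ → Run α
  | 0 => fun _ => PMF.pure none
  | fuel + 1 => bind p fun o =>
      match o with
      | some a => ret a
      | none => retryFuel p fuel

/-- Restart until an attempt succeeds. A failed attempt costs at least one measurement, so that a
budget of `B` measurements is exhausted before `B + 1` attempts have failed. -/
def retry (p : Run (Option α)) : Run α := fun B => retryFuel p (B + 1) B

/-- Probability that, with a budget of `B` measurements, the computation ends within the budget and
its result has the property `good`. -/
def successProb (p : Run α) (B : ℕ) (good : α → Prop) : ℝ≥0∞ :=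
  (p B).toOuterMeasure {o | ∃ a B', o = some (a, B') ∧ good a}

end Run

/-! ### Measurements -/

/-- The probability distribution proportional to the weights `w`. -/
def born {ι : Type} [Fintype ι] [Nonempty ι] (w : ι → ℝ≥0) : PMF ι :=
  open Classical in
  if h : ∑ i, w i = 0 then PMF.pure (Classical.arbitrary ι)
  else PMF.normalize (fun i => (w i : ℝ≥0∞))
    (by rw [tsum_fintype]; exact_mod_cast h)
    (by rw [tsum_fintype]; exact_mod_cast ENNReal.coe_ne_top)

/-- The normalized vector. -/
def unit {k : ℕ} (ψ : Reg k) : Reg k := ((‖ψ‖⁻¹ : ℝ) : ℂ) • ψ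

/-- The two-outcome projective measurement `{p, 1 - p}`, by the Born rule: the outcome is `true`
with probability `‖p ψ‖²`, and then the post-measurement state is returned. The outcome of `1 - p`
is reported as `none`. -/
def check {k : ℕ} (p : Reg k →L[ℂ] Reg k) (ψ : Reg k) : Run (Option (Reg k)) :=
  Run.bind (Run.spend 1) fun _ =>
    Run.bind (Run.sample (born fun b : Bool => if b then ‖p ψ‖₊ ^ 2 else ‖ψ - p ψ‖₊ ^ 2)) fun b =>
      Run.ret (if b then some (unit (p ψ)) else none)

/-- Measurement of the whole register in the computational basis. -/
def readRegister {k : ℕ} (ψ : Reg k) : Run (Fin k → Bool) :=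
  Run.bind (Run.spend 1) fun _ => Run.sample (born fun x => ‖ψ x‖₊ ^ 2)

/-- Measurement of qubit `i` in the computational basis. -/
def readQubit {k : ℕ} (i : Fin k) (ψ : Reg k) : Run Bool :=
  Run.bind (Run.spend 1) fun _ =>
    Run.sample (born fun b : Bool => ∑ x, if x i = b then ‖ψ x‖₊ ^ 2 else 0)

/-! ### State preparation -/

/-- One attempt of the measurement-driven state preparation: the checks are made one after the
other, and the attempt ends (with `none`) when one of them fails. -/
def attempt {k : ℕ} : List (Reg k →L[ℂ] Reg k) → Reg k → Run (Option (Reg k))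
  | [], ψ => Run.ret (some ψ)
  | p :: ps, ψ => Run.bind (check p ψ) fun o =>
      match o with
      | some ψ' => attempt ps ψ'
      | none => Run.ret none

/-- A register of `k` qubits with `s` auxiliary qubits. -/
abbrev ExtReg (k s : ℕ) := EuclideanSpace ℂ ((Fin k → Bool) × (Fin s → Bool))

/-- The component of `Φ` for the basis state `a` of the auxiliary qubits. -/
def slice {k s : ℕ} (Φ : ExtReg k s) (a : Fin s → Bool) : Reg k :=
  WithLp.toLp 2 fun x => Φ (x, a)

/-- Deferred measurement: the unitary `p ⊗ 1 + (1 - p) ⊗ X_t`, which records a failed check in the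
auxiliary qubit `t`. For an orthogonal projector `p` it is its own inverse. -/
def deferredCheck {k s : ℕ} (p : Reg k →L[ℂ] Reg k) (t : Fin s) (Φ : ExtReg k s) : ExtReg k s :=
  WithLp.toLp 2 fun z =>
    let a' := Function.update z.2 t (!z.2 t)
    p (slice Φ z.2) z.1 + (slice Φ a' - p (slice Φ a')) z.1

/-- The coherent state preparation: all checks with deferred measurement, the first one first. -/
def coherent {k : ℕ} (ps : List (Reg k →L[ℂ] Reg k)) (Φ : ExtReg k ps.length) :
    ExtReg k ps.length :=
  (List.finRange ps.length).foldl (fun Ψ t => deferredCheck (ps.get t) t Ψ) Φ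

/-- The inverse of `coherent`: the same self-inverse unitaries in the opposite order. -/
def coherentInv {k : ℕ} (ps : List (Reg k →L[ℂ] Reg k)) (Φ : ExtReg k ps.length) :
    ExtReg k ps.length :=
  (List.finRange ps.length).foldr (fun t Ψ => deferredCheck (ps.get t) t Ψ) Φ

/-- The initial state `|+⟩^{⊗ k} ⊗ |0⟩^{⊗ s}`. -/
def extInit (k s : ℕ) : ExtReg k s :=
  WithLp.toLp 2 fun z => if z.2 = (fun _ => false) then plusState k z.1 else 0

/-- Sign flip on the good subspace, where no auxiliary qubit records a failed check. -/
def flipGood {k s : ℕ} (Φ : ExtReg k s) : ExtReg k s :=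
  WithLp.toLp 2 fun z => if z.2 = (fun _ => false) then -Φ z else Φ z

/-- Sign flip on the initial state. -/
def flipInit {k s : ℕ} (Φ : ExtReg k s) : ExtReg k s :=
  Φ - (2 * inner ℂ (extInit k s) Φ) • extInit k s

/-- The amplitude amplification operator `Q = - A S₀ A⁻¹ S_χ`. -/
def groverOp {k : ℕ} (ps : List (Reg k →L[ℂ] Reg k)) (Φ : ExtReg k ps.length) :
    ExtReg k ps.length :=
  -coherent ps (flipInit (coherentInv ps (flipGood Φ)))

/-- One attempt of the amplitude-amplified state preparation: for a uniformly random number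
`j ≤ M` of rounds, prepare `Q^j A |init⟩` and measure whether the auxiliary qubits are all zero.
The cost is `2 j + 1` runs of the checks, `2 j` reflections, and the final measurement. -/
def amplifiedAttempt {k : ℕ} (ps : List (Reg k →L[ℂ] Reg k)) (M : ℕ) : Run (Option (Reg k)) :=
  Run.bind (Run.sample (PMF.uniformOfFintype (Fin (M + 1)))) fun j =>
    let Φ := (groverOp ps)^[(j : ℕ)] (coherent ps (extInit k ps.length))
    let good := slice Φ fun _ => false
    Run.bind (Run.spend ((2 * (j : ℕ) + 1) * ps.length + 2 * (j : ℕ) + 1)) fun _ =>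
      Run.bind (Run.sample (born fun b : Bool =>
        if b then ‖good‖₊ ^ 2 else ∑ z, if z.2 = (fun _ => false) then 0 else ‖Φ z‖₊ ^ 2)) fun b =>
          Run.ret (if b then some (unit good) else none)

/-- The default version of the algorithm and the amplitude-amplified one. -/
inductive Version
  | default
  | amplified

/-- The exponent `q`. -/
def Version.q : Version → ℕ
  | .default => 1
  | .amplified => 2

/-- The number of cycles, `⌈ln (1 / (ε cos^k (θ/2))) / ln (1/μ)⌉`. -/
def numCycles (k : ℕ) (θ μ ε : ℝ) : ℕ :=
  ⌈Real.log (ε * Real.cos (θ / 2) ^ k)⁻¹ / Real.log μ⁻¹⌉₊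

/-- State preparation with tolerance `ε` for the formula `φ`. -/
def prepare (v : Version) {k : ℕ} (θ μ ε : ℝ) (L : List (Fin k → Bool)) (φ : CNF k) :
    Run (Reg k) :=
  let ps := (List.replicate (numCycles k θ μ ε) (cycleChecks θ L φ)).flatten
  match v with
  | .default => Run.retry (attempt ps (plusState k))
  | .amplified =>
      Run.retry (amplifiedAttempt ps ⌈(2 / (1 + Real.cos θ)) ^ ((k : ℝ) / 2)⌉₊)

/-! ### Readout and the solver -/

/-- The solver with the readout for a unique solution: `R` copies are prepared and measured, and
each bit is determined by a majority vote (outcome `0` counts `+1` and outcome `1` counts `-1`). -/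
def solveUnique (v : Version) {n : ℕ} (θ μ δ : ℝ) (L : List (Fin n → Bool)) (φ : CNF n) :
    Run (Fin n → Bool) :=
  let ε := (1 - 1 / √2) ^ 2 / 8 * Real.sin θ ^ 2
  let R := ⌈2 * Real.log (n / δ) / Real.log (2 / (1 + Real.cos θ ^ 2))⌉₊
  Run.bind (Run.replicate (Run.bind (prepare v θ μ ε L φ) readRegister) R) fun outcomes =>
    Run.ret fun i =>
      if 0 < (outcomes.map fun x => -boolSign (x i)).sum then false else true

/-- The bits are fixed one after the other. For each of them, `r` copies of the state for the
current formula are prepared and the qubit of its first variable is measured, the outcome `1` (TRUE)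
counting `+1` and the outcome `0` (FALSE) counting `-1`; the bit is chosen by whether the mean is
closer to `- sin θ` or to `sin θ`, and is propagated through the formula. -/
def multipleLoop (v : Version) (θ μ ε : ℝ) (r : ℕ) :
    (k : ℕ) → List (Fin k → Bool) → CNF k → Run (Fin k → Bool)
  | 0, _, _ => Run.ret fun _ => false
  | k + 1, L, φ =>
      Run.bind (Run.replicate (Run.bind (prepare v θ μ ε L φ) (readQubit 0)) r) fun outcomes =>
        let p := (outcomes.map boolSign).sum / r
        let s := if |p + Real.sin θ| ≤ |p - Real.sin θ| then false else true
        Run.bind (multipleLoop v θ μ ε r k (L.map fun b i => b i.succ) (CNF.propagate s φ))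
          fun x => Run.ret (Fin.cons s x)

/-- The solver with the readout for possibly multiple solutions. -/
def solveMultiple (v : Version) {n : ℕ} (θ μ δ : ℝ) (L : List (Fin n → Bool)) (φ : CNF n) :
    Run (Fin n → Bool) :=
  multipleLoop v θ μ (Real.sin θ ^ 2 / 8) ⌈8 * Real.log (2 * n / δ) / Real.sin θ ^ 2⌉₊ n L φ

/-- The runtime expression, for the readout factor `t`. -/
def timeBound (v : Version) (n : ℕ) (θ μ δ t : ℝ) : ℝ :=
  Real.log n *
    ⌈(Real.log (1 / (1 - Real.cos θ ^ 2)) + n * Real.log (1 / Real.cos (θ / 2))) /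
      Real.log μ⁻¹⌉₊ *
    Real.log δ⁻¹ * (2 / (1 + Real.cos θ)) ^ ((n : ℝ) / (v.q : ℝ)) * t

/-- The readout factor for a unique solution. -/
def tUnique (n : ℕ) (θ δ : ℝ) : ℝ := Real.log (n / δ) / Real.log (2 / (1 + Real.cos θ ^ 2))

/-- The readout factor for possibly multiple solutions. -/
def tMultiple (n : ℕ) (θ δ : ℝ) : ℝ := Real.log (n / δ) / Real.sin θ ^ 2

end QSat

end

/-! The proof combines a description of the ground space, a convergence argument for the cycles, a
bound on the success probability of one attempt, and a concentration argument for errors and costs.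

Ground space. For $\sin\theta\ne0$ the encodings of the two truth values form a basis of a qubit, so
the product encodings form a basis of the register, and `contract` computes the coordinates in it up
to nonzero factors. A clause projector leaves the coordinates at the assignments that falsify the
clause unchanged. Hence a state of zero energy has no coordinate at a non-solution, and it is
annihilated by the projector of every clause that the formula implies
(`clauseProj_eq_zero_of_implied`). If all solutions agree on a bit, this applies to the
corresponding unit clause: that qubit is in the encoding of the bit, and its readout is wrong with
probability $(1-\sin\theta)/2$ (`bitWeight_ground`).

Convergence. The cycle operator $T$ is a product of projectors whose common fixed space is the
ground space. With the ground projector $P$ one has $TP=PT=P$, hence $T^r-P=(T-P)^r$, and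
compactness of the unit ball gives $\|T-P\|<1$. The encoding of a solution has overlap
$\cos^k(\theta/2)$ with $|+\rangle^{\otimes k}$, so $r^*$ cycles bring the state to relative
distance $\epsilon$ from the ground space, and the readout bias drops by at most $4\epsilon$
(`isAccurate_unit`).

Success of an attempt. All checks pass with probability $\|T^r|+\rangle^{\otimes
k}\|^2\ge\cos^{2k}(\theta/2)$. In the amplified version the iterates rotate in a plane, and the
average of $\sin^2((2j+1)\alpha)$ over the random $j$ is at least $1/4$ as soon as the number of
values of $j$ is at least $1/\sin\alpha$ (`quarter_le_average_sin_sq`).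

Concentration. Wrong votes and overspending are handled by one exponential potential. `HasCost`
says, in effect, that $E\,e^{s\cdot{\rm cost}}\le e^\kappa$. Restarting until success has this
property with $\kappa=2sT$, if $T$ bounds the cost of an attempt divided by its success probability
and $sT\le1/2$ (`loss_retryFuel_le`). Under repetition the exponents $\kappa$ add up, while the
exponential weights of the votes multiply. Failure thus has probability at most $n\gamma^R$ for the
votes, with $\gamma=\sqrt{1-t^2}$ for the bias $t=\sin\theta-4\epsilon$, plus $e^{A-sB}$ for the
budget $B$, where $A$ is the sum of the $\kappa$; each part is made at most $\delta/2$.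

With multiple solutions, fixing a variable can destroy satisfiability only if the other value is
forced, and then the bias protects the vote. The costs of the shrinking registers form a geometric
sum, which gives the factor $\min\{n,1/(1-\cos\theta)\}$ (`sum_growth_le`). -/

namespace QSat

/-! ### Failure functionals of randomized computations -/

/-- The exponential as an extended nonnegative real. -/
noncomputable def eexp (x : ℝ) : ℝ≥0∞ := ENNReal.ofReal (Real.exp x)

theorem eexp_add (x y : ℝ) : eexp (x + y) = eexp x * eexp y := by
  rw [eexp, Real.exp_add, ENNReal.ofReal_mul (Real.exp_pos x).le]; rfl

theorem eexp_mono {x y : ℝ} (h : x ≤ y) : eexp x ≤ eexp y :=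
  ENNReal.ofReal_le_ofReal (Real.exp_le_exp.2 h)

theorem one_le_eexp {x : ℝ} (h : 0 ≤ x) : 1 ≤ eexp x :=
  ENNReal.one_le_ofReal.2 (Real.one_le_exp h)

/-- The value of `h` at an outcome, where exceeding the budget has the value `1`. -/
noncomputable def outcomeLoss {α : Type} (h : α → ℕ → ℝ≥0∞) : Option (α × ℕ) → ℝ≥0∞
  | none => 1
  | some (a, B') => h a B'

namespace Run

variable {α β : Type}

/-- The expected loss of a computation, where exceeding the budget is a loss of `1`. -/
noncomputable def loss (p : Run α) (h : α → ℕ → ℝ≥0∞) (B : ℕ) : ℝ≥0∞ :=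
  ∑' o, p B o * outcomeLoss h o

theorem tsum_pure_mul {γ : Type} (a : γ) (f : γ → ℝ≥0∞) :
    ∑' o, PMF.pure a o * f o = f a := by
  rw [tsum_eq_single a]
  · simp
  · intro b hb; simp [PMF.pure_apply, hb]

theorem tsum_bind_mul {γ ε : Type} (p : PMF γ) (k : γ → PMF ε) (f : ε → ℝ≥0∞) :
    ∑' o, p.bind k o * f o = ∑' a, p a * ∑' o, k a o * f o := by
  simp_rw [PMF.bind_apply, ← ENNReal.tsum_mul_right, ← ENNReal.tsum_mul_left]
  rw [ENNReal.tsum_comm]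
  simp_rw [mul_assoc]

theorem loss_le_one (p : Run α) {h : α → ℕ → ℝ≥0∞} (H : ∀ a B', h a B' ≤ 1) (B : ℕ) :
    loss p h B ≤ 1 := by
  calc loss p h B ≤ ∑' o, p B o * 1 := by
        refine ENNReal.tsum_le_tsum fun o => mul_le_mul_right ?_ _
        rcases o with _ | ⟨a, B'⟩
        · exact le_rfl
        · exact H a B'
    _ = 1 := by simp [(p B).tsum_coe]

theorem loss_ret (a : α) (h : α → ℕ → ℝ≥0∞) (B : ℕ) : loss (ret a) h B = h a B :=
  tsum_pure_mul _ _

theorem loss_bind (p : Run α) (f : α → Run β) (h : β → ℕ → ℝ≥0∞) (B : ℕ) :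
    loss (bind p f) h B = loss p (fun a B' => loss (f a) h B') B := by
  unfold loss bind
  rw [tsum_bind_mul]
  refine tsum_congr fun o => ?_
  rcases o with _ | ⟨a, B'⟩
  · simp only [tsum_pure_mul]; rfl
  · rfl

theorem loss_sample (q : PMF α) (h : α → ℕ → ℝ≥0∞) (B : ℕ) :
    loss (sample q) h B = ∑' a, q a * h a B := by
  unfold loss sample
  rw [PMF.map, tsum_bind_mul]
  refine tsum_congr fun o => ?_
  simp only [Function.comp, tsum_pure_mul]; rfl

theorem loss_spend (c : ℕ) (h : Unit → ℕ → ℝ≥0∞) (B : ℕ) :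
    loss (spend c) h B = if c ≤ B then h () (B - c) else 1 := by
  unfold loss spend
  split_ifs
  · simp only [tsum_pure_mul]; rfl
  · simp only [tsum_pure_mul]; rfl

open Classical in
/-- The success probability is complementary to the expected loss of the bad results. -/
theorem ofReal_one_sub_le_successProb (p : Run α) (B : ℕ) (good : α → Prop) {δ : ℝ}
    (hδ : 0 ≤ δ) (h : loss p (fun a _ => if good a then 0 else 1) B ≤ ENNReal.ofReal δ) :
    ENNReal.ofReal (1 - δ) ≤ p.successProb B good := by
  have hsum : p.successProb B good + loss p (fun a _ => if good a then 0 else 1) B = 1 := by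
    rw [successProb, PMF.toOuterMeasure_apply, loss, ← ENNReal.tsum_add, ← (p B).tsum_coe]
    refine tsum_congr fun o => ?_
    rcases o with _ | ⟨a, B'⟩
    · simp [Set.indicator, outcomeLoss]
    · by_cases hg : good a <;> simp [Set.indicator, outcomeLoss, hg]
  have h1 : (1 : ℝ≥0∞) ≤ p.successProb B good + ENNReal.ofReal δ := by
    rw [← hsum]; gcongr
  rw [ENNReal.ofReal_sub _ hδ, ENNReal.ofReal_one]
  exact tsub_le_iff_right.2 h1

/-- With potential `e + K exp (- s B)` on the good results, the expected loss is at most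
`e + K exp (κ - s B)`. -/
def HasCost (p : Run α) (G : α → Prop) (s κ : ℝ) : Prop :=
  ∀ h : α → ℕ → ℝ≥0∞, (∀ a B, h a B ≤ 1) → ∀ e K : ℝ≥0∞, 1 ≤ K →
    (∀ a B, G a → h a B ≤ e + K * eexp (-(s * B))) →
    ∀ B : ℕ, loss p h B ≤ e + K * eexp (κ - s * B)

/-- One attempt takes at most `m` and, if it fails, at least one measurement, and it succeeds with
probability at least `P`. -/
def IsAttempt (p : Run (Option α)) (G : α → Prop) (m : ℕ) (P : ℝ) : Prop :=
  ∀ (h : Option α → ℕ → ℝ≥0∞) (B : ℕ) (X Y : ℝ≥0∞), m ≤ B → X ≤ Y →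
    (∀ a B', G a → B ≤ B' + m → h (some a) B' ≤ X) →
    (∀ B', B ≤ B' + m → B' < B → h none B' ≤ Y) →
    loss p h B ≤ ENNReal.ofReal P * X + ENNReal.ofReal (1 - P) * Y

/-- Shifting probability from the larger to the smaller value lowers the mean. Because of this, a
lower bound for the success probability suffices in `IsAttempt`. -/
theorem mix_le_mix {p q : ℝ} (hp : 0 ≤ p) (hpq : p ≤ q) (hq : q ≤ 1) {X Y : ℝ≥0∞} (h : X ≤ Y) :
    ENNReal.ofReal q * X + ENNReal.ofReal (1 - q) * Y ≤
      ENNReal.ofReal p * X + ENNReal.ofReal (1 - p) * Y := by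
  have h1 : q = p + (q - p) := by ring
  have h2 : 1 - p = (q - p) + (1 - q) := by ring
  rw [h2, ENNReal.ofReal_add (sub_nonneg.2 hpq) (sub_nonneg.2 hq)]
  conv_lhs => rw [h1, ENNReal.ofReal_add hp (sub_nonneg.2 hpq)]
  rw [add_mul, add_mul, add_assoc, ← h1]
  gcongr

/-- The number of attempts is dominated by a geometric variable, so the total cost has mean at most
$m/P\le T$. Its exponential moment at $s$ is bounded by $e^{2sT}$ as long as $sT\le1/2$. The
induction carries exactly this moment. -/
theorem loss_retryFuel_le {p : Run (Option α)} {G : α → Prop} {m : ℕ} {P s T : ℝ}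
    (hp : IsAttempt p G m P) (hP : 0 < P) (hP1 : P ≤ 1) (hm : m ≤ P * T) (hs : 0 ≤ s)
    (hsT : s * T ≤ 1 / 2) {h : α → ℕ → ℝ≥0∞} (h1 : ∀ a B, h a B ≤ 1) {e K : ℝ≥0∞} (hK : 1 ≤ K)
    (hG : ∀ a B, G a → h a B ≤ e + K * eexp (-(s * B))) (fuel B : ℕ) (hB : B < fuel) :
    loss (retryFuel p fuel) h B ≤ e + K * eexp (2 * (s * T) - s * B) := by
  have hT : 0 ≤ T := by
    by_contra hT
    have := mul_neg_of_pos_of_neg hP (not_le.1 hT)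
    have : (0 : ℝ) ≤ m := Nat.cast_nonneg m
    linarith
  have hmT : (m : ℝ) ≤ T := hm.trans (mul_le_of_le_one_left hT hP1)
  induction fuel generalizing B with
  | zero => omega
  | succ fuel ih =>
    by_cases hmB : m ≤ B
    · rw [retryFuel, loss_bind]
      refine (hp _ B (e + K * eexp (s * m - s * B))
        (e + K * eexp (2 * (s * T) + s * m - s * B)) hmB ?_ ?_ ?_).trans ?_
      · gcongr
        refine eexp_mono ?_
        have := mul_nonneg hs hT
        linarith
      · intro a B' ha hB'
        simp only [loss_ret]
        refine (hG a B' ha).trans ?_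
        gcongr
        refine eexp_mono ?_
        have : s * (B : ℝ) ≤ s * (B' + m) := mul_le_mul_of_nonneg_left (by exact_mod_cast hB') hs
        linarith
      · intro B' hB' hlt
        refine (ih B' (by omega)).trans ?_
        gcongr
        refine eexp_mono ?_
        have : s * (B : ℝ) ≤ s * (B' + m) := mul_le_mul_of_nonneg_left (by exact_mod_cast hB') hs
        linarith
      · have hsm : s * m ≤ P * (s * T) := by nlinarith
        set y := s * T with hy
        have hy0 : 0 ≤ y := mul_nonneg hs hT
        -- The recursion for the exponential moment. Multiplied by $e^{-sm}\ge1-sm\ge1-Py$, it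
        -- reduces to $1\le e^{2y}(1-y)$. This follows from $e^{2y}\ge1+2y$ and needs $y\le1/2$.
        have hreal : P * Real.exp (s * m) + (1 - P) * Real.exp (2 * y + s * m) ≤
            Real.exp (2 * y) := by
          have e2 : 1 + 2 * y ≤ Real.exp (2 * y) := by linarith [Real.add_one_le_exp (2 * y)]
          have e3 : 1 - s * m ≤ Real.exp (-(s * m)) := by linarith [Real.add_one_le_exp (-(s * m))]
          have h4 : P + (1 - P) * Real.exp (2 * y) ≤ Real.exp (2 * y) * Real.exp (-(s * m)) := by
            have : Real.exp (2 * y) * (1 - s * m) ≤ Real.exp (2 * y) * Real.exp (-(s * m)) :=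
              mul_le_mul_of_nonneg_left e3 (Real.exp_pos _).le
            have h5 : Real.exp (2 * y) * (1 - P * y) ≤ Real.exp (2 * y) * (1 - s * m) :=
              mul_le_mul_of_nonneg_left (by linarith) (Real.exp_pos _).le
            have h6 : 1 ≤ Real.exp (2 * y) * (1 - y) := by
              have : (1 + 2 * y) * (1 - y) ≤ Real.exp (2 * y) * (1 - y) :=
                mul_le_mul_of_nonneg_right e2 (by linarith)
              nlinarith
            nlinarith
          have h7 := mul_le_mul_of_nonneg_right h4 (Real.exp_pos (s * m)).le
          rw [mul_assoc, ← Real.exp_add, neg_add_cancel, Real.exp_zero, mul_one] at h7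
          rw [Real.exp_add]
          linarith
        have h8 : ENNReal.ofReal P * eexp (s * m) + ENNReal.ofReal (1 - P) * eexp (2 * y + s * m) ≤
            eexp (2 * y) := by
          unfold eexp
          rw [← ENNReal.ofReal_mul hP.le, ← ENNReal.ofReal_mul (by linarith),
            ← ENNReal.ofReal_add (by positivity)
              (mul_nonneg (by linarith) (Real.exp_pos _).le)]
          exact ENNReal.ofReal_le_ofReal hreal
        have h9 : ENNReal.ofReal P + ENNReal.ofReal (1 - P) = 1 := by
          rw [← ENNReal.ofReal_add hP.le (by linarith)]; simp
        calc ENNReal.ofReal P * (e + K * eexp (s * m - s * B)) +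
              ENNReal.ofReal (1 - P) * (e + K * eexp (2 * y + s * m - s * B))
            = (ENNReal.ofReal P + ENNReal.ofReal (1 - P)) * e + K * eexp (-(s * B)) *
              (ENNReal.ofReal P * eexp (s * m) + ENNReal.ofReal (1 - P) * eexp (2 * y + s * m)) := by
              rw [sub_eq_add_neg (s * m : ℝ), sub_eq_add_neg (2 * y + s * m), eexp_add,
                eexp_add (2 * y + s * m)]
              ring
          _ ≤ e + K * eexp (-(s * B)) * eexp (2 * y) := by rw [h9, one_mul]; gcongr
          _ = e + K * eexp (2 * y - s * B) := by
              rw [mul_assoc, ← eexp_add]; congr 3; ring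
    -- The budget may not cover an attempt. Then $sB\le sm\le sT$, so the claimed bound is at least
    -- $K\ge1$ and nothing is to be shown.
    · refine (loss_le_one _ h1 B).trans ?_
      have hBT : s * B ≤ s * T := by
        refine mul_le_mul_of_nonneg_left (le_trans ?_ hmT) hs
        exact_mod_cast (not_le.1 hmB).le
      have h3 : 1 ≤ eexp (2 * (s * T) - s * B) :=
        one_le_eexp (by nlinarith [mul_nonneg hs hT])
      calc (1 : ℝ≥0∞) = 1 * 1 := (one_mul 1).symm
        _ ≤ K * eexp (2 * (s * T) - s * B) := mul_le_mul' hK h3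
        _ ≤ _ := le_add_self

/-- Each failure lowers the budget by at least one, so fuel `B + 1` is never used up before the
budget. -/
theorem IsAttempt.hasCost_retry {p : Run (Option α)} {G : α → Prop} {m : ℕ} {P s T : ℝ}
    (hp : IsAttempt p G m P) (hP : 0 < P) (hP1 : P ≤ 1) (hm : m ≤ P * T) (hs : 0 ≤ s)
    (hsT : s * T ≤ 1 / 2) : HasCost (retry p) G s (2 * (s * T)) :=
  fun _ h1 _ _ hK hG B =>
    loss_retryFuel_le hp hP hP1 hm hs hsT h1 hK hG (B + 1) B (Nat.lt_succ_self B)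

/-- The potentials `g i` of the result have expectation at most `γ i`, and the cost is controlled
as in `HasCost`. -/
def HasPotential {ι : Type} [Fintype ι] (p : Run α) (g : ι → α → ℝ≥0∞) (γ : ι → ℝ≥0∞)
    (s κ : ℝ) : Prop :=
  ∀ h : α → ℕ → ℝ≥0∞, (∀ a B, h a B ≤ 1) → ∀ (c : ι → ℝ≥0∞) (K : ℝ≥0∞), 1 ≤ K →
    (∀ a B, h a B ≤ ∑ i, c i * g i a + K * eexp (-(s * B))) →
    ∀ B : ℕ, loss p h B ≤ ∑ i, c i * γ i + K * eexp (κ - s * B)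

/-- The expectation of each potential is bounded for every single state in `G`, hence conditionally
on whatever was prepared and spent. The measurement itself contributes the summand $s$ to the
exponent. -/
theorem HasCost.bind_spend_sample {ι : Type} [Fintype ι] {p : Run α} {G : α → Prop} {s κ : ℝ}
    (hp : HasCost p G s κ) (hs : 0 ≤ s) {q : α → PMF β} {g : ι → β → ℝ≥0∞} {γ : ι → ℝ≥0∞}
    (hq : ∀ a, G a → ∀ i, ∑' b, q a b * g i b ≤ γ i) :
    HasPotential (bind p fun a => bind (spend 1) fun _ => sample (q a)) g γ s (κ + s) := by
  intro h h1 c K hK hh B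
  rw [loss_bind]
  have hK' : 1 ≤ K * eexp s := by
    simpa using mul_le_mul' hK (one_le_eexp hs)
  refine (hp _ (fun a B' => loss_le_one _ h1 B') (∑ i, c i * γ i) (K * eexp s) hK' ?_ B).trans ?_
  · intro a B' ha
    rw [loss_bind, loss_spend]
    split_ifs with hB
    · rw [loss_sample]
      calc ∑' b, q a b * h b (B' - 1)
          ≤ ∑' b, q a b * (∑ i, c i * g i b + K * eexp (-(s * (B' - 1 : ℕ)))) :=
            ENNReal.tsum_le_tsum fun b => mul_le_mul_right (hh b _) _
        _ = ∑ i, c i * ∑' b, q a b * g i b + K * eexp (-(s * (B' - 1 : ℕ))) := by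
            simp_rw [mul_add, ENNReal.tsum_add, ENNReal.tsum_mul_right, (q a).tsum_coe, one_mul,
              Finset.mul_sum]
            rw [Summable.tsum_finsetSum fun _ _ => ENNReal.summable]
            congr 1
            refine Finset.sum_congr rfl fun i _ => ?_
            rw [← ENNReal.tsum_mul_left]
            exact tsum_congr fun b => by ring
        _ ≤ ∑ i, c i * γ i + K * eexp s * eexp (-(s * B')) := by
            rw [mul_assoc, ← eexp_add]
            gcongr with i
            · exact hq a ha i
            · refine eexp_mono ?_
              push_cast [Nat.cast_sub hB]
              linarith
    -- The readout is no longer affordable. With no budget left the potential $Ke^s$ is at least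
    -- one, which pays for the loss.
    · have : B' = 0 := by omega
      subst this
      calc (1 : ℝ≥0∞) ≤ K * eexp s * eexp (-(s * (0 : ℕ))) := by simpa [eexp] using hK'
        _ ≤ _ := le_add_self
  · rw [mul_assoc, ← eexp_add]
    refine le_of_eq ?_
    congr 3; ring

/-- The runs are independent given the budget, so the potentials multiply and the exponents of the
cost add. The linear form $\sum_i c_ig_i$ in `HasPotential` is what lets the induction absorb the
first outcome into the coefficients. -/
theorem HasPotential.replicate {ι : Type} [Fintype ι] {p : Run α} {g : ι → α → ℝ≥0∞}
    {γ : ι → ℝ≥0∞} {s κ : ℝ} (hp : HasPotential p g γ s κ) (hκ : 0 ≤ κ) (r : ℕ) :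
    HasPotential (replicate p r) (fun i (l : List α) => (l.map (g i)).prod) (fun i => γ i ^ r) s
      (r * κ) := by
  induction r with
  | zero =>
    intro h _ c K _ hh B
    rw [Run.replicate, loss_ret]
    simpa using hh [] B
  | succ r ih =>
    intro h h1 c K hK hh B
    rw [Run.replicate, loss_bind]
    have hK' : 1 ≤ K * eexp (r * κ) := by
      simpa using mul_le_mul' hK (one_le_eexp (by positivity : 0 ≤ r * κ))
    refine (hp _ (fun a B' => loss_le_one _ h1 B') (fun i => c i * γ i ^ r) (K * eexp (r * κ))
      hK' ?_ B).trans ?_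
    · intro a B'
      rw [loss_bind]
      refine (ih _ (fun l B'' => ?_) (fun i => c i * g i a) K hK ?_ B').trans ?_
      · rw [loss_ret]; exact h1 _ _
      · intro l B''
        rw [loss_ret]
        refine (hh (a :: l) B'').trans (le_of_eq ?_)
        congr 1
        refine Finset.sum_congr rfl fun i _ => ?_
        simp [mul_assoc]
      · refine le_of_eq ?_
        congr 1
        · refine Finset.sum_congr rfl fun i _ => ?_
          ring
        · rw [mul_assoc, ← eexp_add]; congr 2
    · refine le_of_eq ?_
      rw [mul_assoc, ← eexp_add]
      congr 1
      · refine Finset.sum_congr rfl fun i _ => ?_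
        ring
      · congr 2; push_cast; ring

end Run

/-! ### Star projections -/

section StarProjection

variable {E : Type*} [NormedAddCommGroup E] [InnerProductSpace ℂ E] [CompleteSpace E]

theorem inner_starProjection_left {p : E →L[ℂ] E} (hp : IsStarProjection p) (x y : E) :
    inner ℂ (p x) y = inner ℂ x (p y) := hp.isSelfAdjoint.isSymmetric x y

theorem starProjection_idem {p : E →L[ℂ] E} (hp : IsStarProjection p) (x : E) :
    p (p x) = p x :=
  congrArg (fun f : E →L[ℂ] E => f x) hp.isIdempotentElem.eq

theorem re_inner_starProjection {p : E →L[ℂ] E} (hp : IsStarProjection p) (x : E) :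
    RCLike.re (inner ℂ x (p x)) = ‖p x‖ ^ 2 := by
  rw [← starProjection_idem hp x, ← inner_starProjection_left hp, inner_self_eq_norm_sq,
    starProjection_idem hp]

theorem norm_sq_add_norm_sq_sub {p : E →L[ℂ] E} (hp : IsStarProjection p) (x : E) :
    ‖p x‖ ^ 2 + ‖x - p x‖ ^ 2 = ‖x‖ ^ 2 := by
  rw [@norm_sub_sq ℂ, re_inner_starProjection hp]; ring

theorem norm_starProjection_le {p : E →L[ℂ] E} (hp : IsStarProjection p) (x : E) :
    ‖p x‖ ≤ ‖x‖ := by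
  have := norm_sq_add_norm_sq_sub hp x
  exact le_of_sq_le_sq (by nlinarith [sq_nonneg ‖x - p x‖]) (norm_nonneg _)

theorem eq_of_norm_starProjection {p : E →L[ℂ] E} (hp : IsStarProjection p) {x : E}
    (h : ‖x‖ ≤ ‖p x‖) : p x = x := by
  have := norm_sq_add_norm_sq_sub hp x
  have h2 : ‖x - p x‖ ^ 2 = 0 := by
    have := pow_le_pow_left₀ (norm_nonneg _) h 2
    nlinarith [sq_nonneg ‖x - p x‖]
  have h3 : x - p x = 0 := by simpa using h2
  exact (sub_eq_zero.1 h3).symm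

/-- The absorption of each factor by the product is what later recovers the individual clauses from
the single measurement of a layer. -/
theorem isStarProjection_prod {l : List (E →L[ℂ] E)} (hl : ∀ p ∈ l, IsStarProjection p)
    (hc : ∀ p ∈ l, ∀ q ∈ l, Commute p q) :
    IsStarProjection l.prod ∧ (∀ p ∈ l, p * l.prod = l.prod) := by
  induction l with
  | nil => exact ⟨IsStarProjection.one _, by simp⟩
  | cons a l ih =>
    obtain ⟨h1, h2⟩ := ih (fun p hp => hl p (by simp [hp]))
      (fun p hp q hq => hc p (by simp [hp]) q (by simp [hq]))
    have ha := hl a (by simp)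
    have hcomm : Commute a l.prod := by
      refine Commute.list_prod_right _ _ fun q hq => hc a (by simp) q (by simp [hq])
    rw [List.prod_cons]
    refine ⟨ha.mul h1 hcomm, ?_⟩
    intro p hp
    rcases List.mem_cons.1 hp with rfl | hp'
    · rw [← mul_assoc, ha.isIdempotentElem.eq]
    · rw [← mul_assoc, (hc p hp a (by simp)).eq, mul_assoc, h2 p hp']

end StarProjection

/-! ### Products of one-qubit matrices -/

/-- The tensor product of one-qubit matrices. -/
noncomputable def tensorMat {k : ℕ} (A : Fin k → Matrix Bool Bool ℂ) :
    Matrix (Fin k → Bool) (Fin k → Bool) ℂ :=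
  fun x y => ∏ i, A i (x i) (y i)

theorem tensorMat_mul {k : ℕ} (A B : Fin k → Matrix Bool Bool ℂ) :
    tensorMat A * tensorMat B = tensorMat fun i => A i * B i := by
  ext x y
  simp only [Matrix.mul_apply, tensorMat, ← Finset.prod_mul_distrib]
  rw [Finset.prod_univ_sum, Fintype.piFinset_univ]

theorem tensorMat_one {k : ℕ} : tensorMat (fun _ : Fin k => 1) = 1 := by
  ext x y
  simp only [tensorMat, Matrix.one_apply]
  split_ifs with h
  · subst h; simp
  · obtain ⟨i, hi⟩ := Function.ne_iff.1 h
    exact Finset.prod_eq_zero (Finset.mem_univ i) (by simp [hi])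

theorem tensorMat_star {k : ℕ} (A : Fin k → Matrix Bool Bool ℂ) :
    star (tensorMat A) = tensorMat fun i => star (A i) := by
  ext x y
  simp [tensorMat, Matrix.star_apply]

/-- The real amplitudes of `perpKet`. -/
noncomputable def perpAmp (θ : ℝ) (b c : Bool) : ℝ :=
  if c then (Real.cos (θ / 2) - boolSign b * Real.sin (θ / 2)) / √2
  else -(Real.cos (θ / 2) + boolSign b * Real.sin (θ / 2)) / √2

/-- The real amplitudes of the encoding of a truth value. -/
noncomputable def encAmp (θ : ℝ) (b c : Bool) : ℝ :=
  if c then (Real.cos (θ / 2) + boolSign b * Real.sin (θ / 2)) / √2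
  else (Real.cos (θ / 2) - boolSign b * Real.sin (θ / 2)) / √2

theorem boolSign_mul_sin (θ : ℝ) (b : Bool) :
    Real.sin (boolSign b * θ / 2) = boolSign b * Real.sin (θ / 2) := by
  cases b <;> simp [boolSign, neg_div]

theorem boolSign_mul_cos (θ : ℝ) (b : Bool) :
    Real.cos (boolSign b * θ / 2) = Real.cos (θ / 2) := by
  cases b <;> simp [boolSign, neg_div]

theorem perpKet_eq (θ : ℝ) (b c : Bool) : perpKet θ b c = (perpAmp θ b c : ℂ) := by
  have h1 : Real.sin ((Real.pi + boolSign b * θ) / 2) = Real.cos (θ / 2) := by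
    rw [add_div, add_comm, Real.sin_add_pi_div_two, boolSign_mul_cos]
  have h2 : Real.cos ((Real.pi + boolSign b * θ) / 2) = -(boolSign b * Real.sin (θ / 2)) := by
    rw [add_div, add_comm, Real.cos_add_pi_div_two, boolSign_mul_sin]
  cases c
  · simp only [perpKet, Matrix.mulVec, dotProduct, Fintype.sum_bool, rotY, plusKet, perpAmp, h1, h2]
    push_cast; simp; ring
  · simp only [perpKet, Matrix.mulVec, dotProduct, Fintype.sum_bool, rotY, plusKet, perpAmp, h1, h2]
    push_cast; simp; ring

theorem half_angle (θ : ℝ) : Real.sin θ = 2 * Real.sin (θ / 2) * Real.cos (θ / 2) := by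
  rw [← Real.sin_two_mul]; ring_nf

theorem perpAmp_sq (θ : ℝ) (b c : Bool) :
    perpAmp θ b c ^ 2 = (1 + (if b = c then -1 else 1) * Real.sin θ) / 2 := by
  have h := Real.sin_sq_add_cos_sq (θ / 2)
  rw [half_angle θ]
  cases b <;> cases c <;> simp [perpAmp, boolSign, div_pow] <;> linarith

theorem perpAmp_norm (θ : ℝ) (b : Bool) :
    perpAmp θ b true * perpAmp θ b true + perpAmp θ b false * perpAmp θ b false = 1 := by
  have h1 := perpAmp_sq θ b true
  have h2 := perpAmp_sq θ b false
  cases b <;> simp at h1 h2 <;> nlinarith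

theorem encAmp_norm (θ : ℝ) (b : Bool) :
    encAmp θ b true ^ 2 + encAmp θ b false ^ 2 = 1 := by
  have h := Real.sin_sq_add_cos_sq (θ / 2)
  cases b <;> simp [encAmp, boolSign, div_pow] <;> linarith

theorem perpAmp_encAmp (θ : ℝ) (b : Bool) :
    perpAmp θ b true * encAmp θ b true + perpAmp θ b false * encAmp θ b false = 0 := by
  simp only [perpAmp, encAmp]; simp; ring

/-- The one-qubit factor of a clause projector. -/
noncomputable def litMat (θ : ℝ) : Option Bool → Matrix Bool Bool ℂ
  | some b => fun x y => (perpAmp θ b x * perpAmp θ b y : ℝ)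
  | none => 1

theorem litMat_none (θ : ℝ) : litMat θ none = 1 := rfl

theorem litMat_some_apply (θ : ℝ) (b x y : Bool) :
    litMat θ (some b) x y = (perpAmp θ b x * perpAmp θ b y : ℝ) := rfl

theorem clauseProj_eq {k : ℕ} (θ : ℝ) (c : Clause k) :
    clauseProj θ c =
      Matrix.toEuclideanCLM (𝕜 := ℂ) (n := Fin k → Bool) (tensorMat fun i => litMat θ (c i)) := by
  unfold clauseProj
  congr 1
  ext x y
  refine Finset.prod_congr rfl fun i _ => ?_
  cases h : c i with
  | none => simp [h, litMat_none, Matrix.one_apply]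
  | some b => simp [h, litMat_some_apply, perpKet_eq]

theorem litMat_mul_self (θ : ℝ) (o : Option Bool) : litMat θ o * litMat θ o = litMat θ o := by
  cases o with
  | none => simp [litMat]
  | some b =>
    ext x y
    simp only [litMat_some_apply, Matrix.mul_apply, Fintype.sum_bool]
    rw [← Complex.ofReal_mul, ← Complex.ofReal_mul, ← Complex.ofReal_add]
    congr 1
    linear_combination perpAmp θ b x * perpAmp θ b y * perpAmp_norm θ b

theorem litMat_star (θ : ℝ) (o : Option Bool) : star (litMat θ o) = litMat θ o := by
  cases o with
  | none => simp [litMat]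
  | some b =>
    ext x y
    simp [litMat_some_apply, Matrix.star_apply, mul_comm]

theorem isStarProjection_clauseProj {k : ℕ} (θ : ℝ) (c : Clause k) :
    IsStarProjection (clauseProj θ c) := by
  rw [clauseProj_eq]
  refine ⟨?_, ?_⟩
  · rw [IsIdempotentElem, ← map_mul, tensorMat_mul]
    simp_rw [litMat_mul_self]
  · rw [IsSelfAdjoint, ← map_star, tensorMat_star]
    simp_rw [litMat_star]

/-- On each qubit the two clauses either carry the same sign, hence the same one-qubit projector, or
one of them acts as the identity. -/
theorem commute_clauseProj {k : ℕ} (θ : ℝ) (b : Fin k → Bool) {c d : Clause k}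
    (hc : Compatible b c) (hd : Compatible b d) :
    Commute (clauseProj θ c) (clauseProj θ d) := by
  rw [clauseProj_eq, clauseProj_eq, commute_iff_eq, ← map_mul, ← map_mul, tensorMat_mul,
    tensorMat_mul]
  congr 2
  funext i
  rcases hc i with h1 | h1 <;> rcases hd i with h2 | h2 <;> rw [h1, h2] <;> simp [litMat_none]

theorem clauseProj_apply {k : ℕ} (θ : ℝ) (c : Clause k) (w : Reg k) (x : Fin k → Bool) :
    clauseProj θ c w x = ((tensorMat fun i => litMat θ (c i)).mulVec (fun y => w y)) x := by
  rw [clauseProj_eq]; rfl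

/-! ### Contraction with products of states orthogonal to the encodings -/

/-- Rows: the states orthogonal to the encoding of the opposite truth value. -/
noncomputable def contractMat (θ : ℝ) : Matrix Bool Bool ℂ := fun y x => (perpAmp θ (!y) x : ℝ)

/-- Row $y$ is the bra of the state orthogonal to the encoding of $\neg y$. A literal projector onto
the same state fixes this row, and the other literal projector turns it into a multiple of the other
row. In both cases the resulting row belongs to the value that falsifies the literal. -/
theorem contractMat_mul_litMat (θ : ℝ) (o : Option Bool) (y x : Bool) :
    (contractMat θ * litMat θ o) y x =
      (if o = some y then
        ((perpAmp θ (!y) true * perpAmp θ y true + perpAmp θ (!y) false * perpAmp θ y false : ℝ) : ℂ)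
        else 1) * contractMat θ (o.elim y fun b => !b) x := by
  cases o with
  | none => simp [litMat_none]
  | some b =>
    simp only [Matrix.mul_apply, litMat_some_apply, contractMat, Fintype.sum_bool, Option.elim]
    by_cases h : b = y
    · subst h
      simp; ring
    · have : b = !y := by cases b <;> cases y <;> simp_all
      subst this
      have h1 := perpAmp_norm θ (!y)
      have h2 : (some (!y) = some y) ↔ False := by simp
      simp only [h2, if_false, Bool.not_not, one_mul]
      rw [← Complex.ofReal_mul, ← Complex.ofReal_mul, ← Complex.ofReal_add]
      congr 1
      linear_combination perpAmp θ (!y) x * h1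

/-- The contraction of a state with products of orthogonal states. -/
noncomputable def contract {k : ℕ} (θ : ℝ) (w : Reg k) (y : Fin k → Bool) : ℂ :=
  (tensorMat fun _ : Fin k => contractMat θ).mulVec (fun x => w x) y

theorem contract_clauseProj {k : ℕ} (θ : ℝ) (c : Clause k) (w : Reg k) (y : Fin k → Bool) :
    contract θ (clauseProj θ c w) y =
      (∏ i, if c i = some (y i) then
        ((perpAmp θ (!y i) true * perpAmp θ (y i) true +
          perpAmp θ (!y i) false * perpAmp θ (y i) false : ℝ) : ℂ) else 1) *
      contract θ w (fun i => (c i).elim (y i) fun b => !b) := by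
  unfold contract
  have h : (fun x => clauseProj θ c w x) =
      (tensorMat fun i => litMat θ (c i)).mulVec (fun y => w y) :=
    funext fun x => clauseProj_apply θ c w x
  rw [h, Matrix.mulVec_mulVec, tensorMat_mul]
  simp only [Matrix.mulVec, dotProduct, Finset.mul_sum, tensorMat, ← mul_assoc,
    ← Finset.prod_mul_distrib, contractMat_mul_litMat]

/-- At a falsifying assignment every literal projector hits its own row, so no overlap factor
appears and no index changes. -/
theorem contract_clauseProj_of_not_sat {k : ℕ} (θ : ℝ) {c : Clause k} (w : Reg k)
    {y : Fin k → Bool} (hy : ¬ c.Sat y) :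
    contract θ (clauseProj θ c w) y = contract θ w y := by
  rw [contract_clauseProj]
  have h : ∀ i, c i ≠ some (y i) := fun i hi => hy ⟨i, hi⟩
  rw [Finset.prod_eq_one fun i _ => by rw [if_neg (h i)], one_mul]
  congr 1
  funext i
  have := h i
  cases hc : c i with
  | none => rfl
  | some b =>
    rw [hc] at this
    show (!b) = y i
    have h' : b ≠ y i := fun hb => this (by rw [hb])
    revert h'; cases b <;> cases y i <;> simp

/-- The inverse of `contractMat`. -/
noncomputable def decodeMat (θ : ℝ) : Matrix Bool Bool ℂ :=
  fun x y => (boolSign y * encAmp θ y x / Real.sin θ : ℝ)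

theorem decodeMat_mul_contractMat {θ : ℝ} (hθ : Real.sin θ ≠ 0) :
    decodeMat θ * contractMat θ = 1 := by
  have h2 : (√2 : ℝ) ^ 2 = 2 := Real.sq_sqrt (by norm_num)
  have h3 : (√2 : ℝ) ≠ 0 := by positivity
  have h4 := half_angle θ
  ext x y
  simp only [Matrix.mul_apply, decodeMat, contractMat, Fintype.sum_bool]
  rw [← Complex.ofReal_mul, ← Complex.ofReal_mul, ← Complex.ofReal_add]
  have : (1 : Matrix Bool Bool ℂ) x y = ((if x = y then 1 else 0 : ℝ) : ℂ) := by
    rw [Matrix.one_apply]; split_ifs <;> simp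
  rw [this]
  congr 1
  cases x <;> cases y <;> simp [boolSign, encAmp, perpAmp] <;> field_simp <;> rw [h2] <;>
    linarith

/-- The two encodings are linearly independent when $\sin\theta\ne0$, so the one-qubit matrix of
contractions is invertible, and so is its tensor power. -/
theorem eq_zero_of_contract {k : ℕ} {θ : ℝ} (hθ : Real.sin θ ≠ 0) {w : Reg k}
    (h : ∀ y, contract θ w y = 0) : w = 0 := by
  have h1 : (tensorMat fun _ : Fin k => decodeMat θ) *
      (tensorMat fun _ : Fin k => contractMat θ) = 1 := by
    rw [tensorMat_mul]
    simp_rw [decodeMat_mul_contractMat hθ, tensorMat_one]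
  ext x
  have h2 : (tensorMat fun _ : Fin k => contractMat θ).mulVec (fun x => w x) = 0 := funext h
  have h3 := congrArg (fun v => (tensorMat fun _ : Fin k => decodeMat θ).mulVec v x) h2
  simpa [Matrix.mulVec_mulVec, h1] using h3

/-! ### The ground space -/

/-- The energy of $w$ is $\sum_c\|P_cw\|^2$, a sum of nonnegative terms. -/
theorem mem_ker_hamiltonian {k : ℕ} (θ : ℝ) (φ : CNF k) (w : Reg k) :
    hamiltonian θ φ w = 0 ↔ ∀ c ∈ φ, clauseProj θ c w = 0 := by
  constructor
  · intro h
    have key : ∀ φ : CNF k, 0 ≤ RCLike.re (inner ℂ w (hamiltonian θ φ w)) ∧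
        (RCLike.re (inner ℂ w (hamiltonian θ φ w)) = 0 → ∀ c ∈ φ, clauseProj θ c w = 0) := by
      intro φ
      induction φ with
      | nil => simp [hamiltonian]
      | cons d φ ih =>
        have h1 : hamiltonian θ (d :: φ) w = clauseProj θ d w + hamiltonian θ φ w := by
          simp [hamiltonian]
        rw [h1, inner_add_right, map_add, re_inner_starProjection (isStarProjection_clauseProj θ d)]
        refine ⟨add_nonneg (sq_nonneg _) ih.1, fun h0 c hc => ?_⟩
        have h2 := sq_nonneg ‖clauseProj θ d w‖
        rcases List.mem_cons.1 hc with rfl | hc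
        · have : ‖clauseProj θ c w‖ ^ 2 = 0 := by linarith [ih.1]
          simpa using this
        · exact ih.2 (by linarith [ih.1]) c hc
    exact (key φ).2 (by rw [h]; simp)
  · intro h
    induction φ with
    | nil => simp [hamiltonian]
    | cons d φ ih =>
      have h1 : hamiltonian θ (d :: φ) w = clauseProj θ d w + hamiltonian θ φ w := by
        simp [hamiltonian]
      rw [h1, h d (by simp), ih fun c hc => h c (by simp [hc]), add_zero]

/-- The ground space satisfies every clause that is implied by the formula. -/
theorem clauseProj_eq_zero_of_implied {k : ℕ} {θ : ℝ} (hθ : Real.sin θ ≠ 0) {φ : CNF k}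
    {c : Clause k} (hc : ∀ x, φ.Sat x → c.Sat x) {w : Reg k} (hw : hamiltonian θ φ w = 0) :
    clauseProj θ c w = 0 := by
  rw [mem_ker_hamiltonian] at hw
  refine eq_zero_of_contract hθ fun y => ?_
  rw [contract_clauseProj]
  -- This assignment agrees with $y$ off the clause and falsifies each of its literals. As the
  -- clause is implied, some clause $d$ of the formula fails at $y'$ as well, and $P_dw=0$ makes the
  -- coordinate of $w$ there vanish.
  set y' : Fin k → Bool := fun i => (c i).elim (y i) fun b => !b with hy'
  have h1 : ¬ c.Sat y' := by
    rintro ⟨i, hi⟩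
    simp only [hy', Option.elim] at hi
    cases h : c i <;> simp [h] at hi
  have h2 : ¬ φ.Sat y' := fun h => h1 (hc y' h)
  simp only [CNF.Sat, not_forall] at h2
  obtain ⟨d, hd, hdy⟩ := h2
  rw [← contract_clauseProj_of_not_sat θ w hdy, hw d hd]
  have : (fun x => (0 : Reg k) x) = 0 := rfl
  rw [contract, this, Matrix.mulVec_zero, Pi.zero_apply, mul_zero]

theorem isStarProjection_groundProj {k : ℕ} (θ : ℝ) (φ : CNF k) :
    IsStarProjection (groundProj θ φ) := isStarProjection_starProjection

theorem hamiltonian_groundProj {k : ℕ} (θ : ℝ) (φ : CNF k) (w : Reg k) :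
    hamiltonian θ φ (groundProj θ φ w) = 0 :=
  LinearMap.mem_ker.1 (Submodule.starProjection_apply_mem _ w)

theorem groundProj_eq_self {k : ℕ} {θ : ℝ} {φ : CNF k} {w : Reg k}
    (hw : hamiltonian θ φ w = 0) : groundProj θ φ w = w :=
  Submodule.starProjection_eq_self_iff.2 (LinearMap.mem_ker.2 hw)

/-! ### Readout of a qubit in the ground space -/

/-- The weight of the outcome `b` for qubit `i`. -/
noncomputable def bitWeight {k : ℕ} (i : Fin k) (b : Bool) (w : Reg k) : ℝ :=
  ∑ x, if x i = b then ‖w x‖ ^ 2 else 0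

theorem bitWeight_add {k : ℕ} (i : Fin k) (b : Bool) (w : Reg k) :
    bitWeight i b w + bitWeight i (!b) w = ‖w‖ ^ 2 := by
  rw [EuclideanSpace.norm_sq_eq, bitWeight, bitWeight, ← Finset.sum_add_distrib]
  refine Finset.sum_congr rfl fun x _ => ?_
  cases b <;> cases x i <;> simp

/-- Flip of one bit. -/
def flipBit {k : ℕ} (i : Fin k) (x : Fin k → Bool) : Fin k → Bool := Function.update x i (!x i)

theorem flipBit_involutive {k : ℕ} (i : Fin k) : Function.Involutive (flipBit i) := by
  intro x; simp [flipBit]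

theorem clauseProj_single {k : ℕ} (θ : ℝ) (i : Fin k) (b : Bool) (w : Reg k) (x : Fin k → Bool) :
    clauseProj θ (Function.update (fun _ => none) i (some b)) w x =
      perpAmp θ b (x i) * (perpAmp θ b (x i) * w x + perpAmp θ b (!x i) * w (flipBit i x)) := by
  rw [clauseProj_apply, Matrix.mulVec, dotProduct]
  have hne : x ≠ flipBit i x := by
    intro h
    have := congrFun h i
    simp [flipBit] at this
  rw [Fintype.sum_eq_add x (flipBit i x) hne]
  · simp only [tensorMat]
    rw [Finset.prod_eq_single i, Finset.prod_eq_single i]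
    · simp [litMat_some_apply, flipBit]; ring
    · intro j _ hj
      simp [litMat_none, flipBit, hj]
    · simp
    · intro j _ hj
      simp [litMat_none, hj]
    · simp
  · intro y hy
    rw [tensorMat]
    have : ∃ j, j ≠ i ∧ x j ≠ y j := by
      by_contra hcon
      push Not at hcon
      rcases Bool.eq_or_eq_not (y i) (x i) with h | h
      · apply hy.1
        funext j
        by_cases hj : j = i
        · rw [hj, h]
        · exact (hcon j hj).symm
      · apply hy.2
        funext j
        by_cases hj : j = i
        · subst hj; simp [flipBit, h]
        · simp [flipBit, hj, (hcon j hj)]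
    obtain ⟨j, hj, hxy⟩ := this
    rw [Finset.prod_eq_zero (Finset.mem_univ j), zero_mul]
    simp [litMat_none, hj, hxy]

/-- If all solutions agree on a bit, the weight of the wrong outcome in the ground space. -/
theorem bitWeight_ground {k : ℕ} {θ : ℝ} (hθ : Real.sin θ ≠ 0) {φ : CNF k} {i : Fin k} {b : Bool}
    (hb : ∀ x, φ.Sat x → x i = b) {w : Reg k} (hw : hamiltonian θ φ w = 0) :
    bitWeight i (!b) w = (1 - Real.sin θ) / 2 * ‖w‖ ^ 2 := by
  have h0 : clauseProj θ (Function.update (fun _ => none) i (some b)) w = 0 := by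
    refine clauseProj_eq_zero_of_implied hθ (fun x hx => ⟨i, ?_⟩) hw
    simp [hb x hx]
  have h1 : ∀ x, perpAmp θ b (x i) * (perpAmp θ b (x i) * w x +
      perpAmp θ b (!x i) * w (flipBit i x)) = 0 := by
    intro x
    rw [← clauseProj_single, h0]; rfl
  -- The outer factor in `h1` vanishes for one value of the bit at $\theta=\pi/2$ and cannot be
  -- cancelled. Instead the equations at $x$ and at its flip are combined with the amplitudes as
  -- weights, whose squares add up to one.
  have h2 : ∀ x, (perpAmp θ b (x i) : ℂ) * w x + perpAmp θ b (!x i) * w (flipBit i x) = 0 := by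
    intro x
    have ha := h1 x
    have hb := h1 (flipBit i x)
    rw [flipBit_involutive i x] at hb
    simp only [flipBit, Function.update_self, Bool.not_not] at hb
    have h3 : (perpAmp θ b (x i) : ℂ) * perpAmp θ b (x i) +
        perpAmp θ b (!x i) * perpAmp θ b (!x i) = 1 := by
      have h := perpAmp_norm θ b
      have : perpAmp θ b (x i) * perpAmp θ b (x i) +
        perpAmp θ b (!x i) * perpAmp θ b (!x i) = 1 := by
        cases x i <;> simp <;> linarith
      exact_mod_cast this
    have hb' : (perpAmp θ b (!x i) : ℂ) * (perpAmp θ b (!x i) * w (flipBit i x) +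
        perpAmp θ b (x i) * w x) = 0 := hb
    linear_combination (-(perpAmp θ b (x i) : ℂ) * w x - perpAmp θ b (!x i) * w (flipBit i x)) * h3
      + (perpAmp θ b (x i) : ℂ) * ha + (perpAmp θ b (!x i) : ℂ) * hb'
  -- Pairing each string with its flip turns the orthogonality relation into a fixed ratio of the
  -- two weights. Their sum $\|w\|^2$ then determines both.
  have h3 : (1 + Real.sin θ) / 2 * bitWeight i (!b) w =
      (1 - Real.sin θ) / 2 * bitWeight i b w := by
    unfold bitWeight
    rw [← Equiv.sum_comp (flipBit_involutive i).toPerm (fun x => if x i = b then ‖w x‖ ^ 2 else 0),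
      Finset.mul_sum, Finset.mul_sum]
    refine Finset.sum_congr rfl fun x _ => ?_
    have hf : (flipBit_involutive i).toPerm (flipBit i) x i = !x i := by simp [flipBit]
    simp only [hf]
    rw [Function.Involutive.coe_toPerm]
    by_cases hx : x i = !b
    · have hx' : (!x i) = b := by rw [hx]; simp
      rw [if_pos hx, if_pos hx']
      have h4 := h2 x
      rw [hx', hx] at h4
      have h5 : (perpAmp θ b (!b) : ℂ) * w x = -(perpAmp θ b b * w (flipBit i x)) :=
        eq_neg_of_add_eq_zero_left h4
      have h6 := congrArg (fun z : ℂ => ‖z‖ ^ 2) h5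
      simp only [norm_neg, norm_mul, mul_pow, Complex.norm_real, Real.norm_eq_abs, sq_abs,
        perpAmp_sq] at h6
      have h7 : b ≠ !b := by cases b <;> simp
      simp only [h7, if_false, if_true] at h6
      linear_combination h6
    · have hx' : (!x i) ≠ b := by
        intro h; apply hx; rw [← h]; simp
      rw [if_neg hx, if_neg hx']; simp
  have h4 := bitWeight_add i b w
  linear_combination h3 + (1 - Real.sin θ) / 2 * h4

/-! ### Overlap with the initial state -/

/-- The encoding of an assignment. -/
noncomputable def encState {k : ℕ} (θ : ℝ) (x : Fin k → Bool) : Reg k :=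
  WithLp.toLp 2 fun y => ∏ i, (encAmp θ (x i) (y i) : ℂ)

/-- A literal made true by the assignment contributes a one-qubit factor in which the projector
meets a state orthogonal to it. -/
theorem hamiltonian_encState {k : ℕ} (θ : ℝ) {φ : CNF k} {x : Fin k → Bool} (hx : φ.Sat x) :
    hamiltonian θ φ (encState θ x) = 0 := by
  rw [mem_ker_hamiltonian]
  intro c hc
  obtain ⟨i, hi⟩ := hx c hc
  ext y
  rw [clauseProj_apply, Matrix.mulVec, dotProduct]
  simp only [tensorMat, encState, ← Finset.prod_mul_distrib]
  have := Finset.prod_univ_sum (fun _ : Fin k => (Finset.univ : Finset Bool))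
    (fun j z => litMat θ (c j) (y j) z * (encAmp θ (x j) z : ℂ))
  rw [Fintype.piFinset_univ] at this
  rw [← this, Finset.prod_eq_zero (Finset.mem_univ i)]
  · rfl
  · rw [hi, Fintype.sum_bool]
    simp only [litMat]
    rw [← Complex.ofReal_mul, ← Complex.ofReal_mul, ← Complex.ofReal_add]
    rw [show perpAmp θ (x i) (y i) * perpAmp θ (x i) true * encAmp θ (x i) true +
      perpAmp θ (x i) (y i) * perpAmp θ (x i) false * encAmp θ (x i) false = 0 by
        linear_combination perpAmp θ (x i) (y i) * perpAmp_encAmp θ (x i)]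
    rfl

theorem norm_encState {k : ℕ} (θ : ℝ) (x : Fin k → Bool) : ‖encState θ x‖ = 1 := by
  have h : ‖encState θ x‖ ^ 2 = 1 := by
    rw [EuclideanSpace.norm_sq_eq]
    simp only [encState, norm_prod, ← Finset.prod_pow, Complex.norm_real, Real.norm_eq_abs, sq_abs]
    have := Finset.prod_univ_sum (fun _ : Fin k => (Finset.univ : Finset Bool))
      (fun j z => encAmp θ (x j) z ^ 2)
    rw [Fintype.piFinset_univ] at this
    rw [← this]
    refine Finset.prod_eq_one fun i _ => ?_
    rw [Fintype.sum_bool, encAmp_norm]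
  nlinarith [norm_nonneg (encState θ x)]

theorem norm_plusState (k : ℕ) : ‖plusState k‖ = 1 := by
  have h : ‖plusState k‖ ^ 2 = 1 := by
    rw [EuclideanSpace.norm_sq_eq]
    simp only [plusState, plusKet, norm_prod, ← Finset.prod_pow, Complex.norm_real,
      Real.norm_eq_abs, sq_abs]
    simp [inv_pow, Real.sq_sqrt, Fintype.card_pi]
  nlinarith [norm_nonneg (plusState k)]

theorem inner_encState_plusState {k : ℕ} (θ : ℝ) (x : Fin k → Bool) :
    inner ℂ (encState θ x) (plusState k) = ((Real.cos (θ / 2) ^ k : ℝ) : ℂ) := by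
  rw [PiLp.inner_apply]
  have h : ∀ y : Fin k → Bool, inner ℂ (encState θ x y) (plusState k y) =
      ∏ i, ((encAmp θ (x i) (y i) * (√2)⁻¹ : ℝ) : ℂ) := by
    intro y
    simp [encState, plusState, plusKet, Finset.prod_mul_distrib, mul_comm]
  simp_rw [h]
  have := Finset.prod_univ_sum (fun _ : Fin k => (Finset.univ : Finset Bool))
    (fun j z => ((encAmp θ (x j) z * (√2)⁻¹ : ℝ) : ℂ))
  rw [Fintype.piFinset_univ] at this
  rw [← this]
  have h2 : ∀ b, ∑ z, ((encAmp θ b z * (√2)⁻¹ : ℝ) : ℂ) = (Real.cos (θ / 2) : ℝ) := by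
    intro b
    rw [← Complex.ofReal_sum, Fintype.sum_bool]
    congr 1
    have h2 : (√2 : ℝ) ^ 2 = 2 := Real.sq_sqrt (by norm_num)
    have h3 : (√2 : ℝ) ≠ 0 := by positivity
    simp [encAmp]
    field_simp
    rw [h2]; ring
  simp_rw [h2]
  simp

/-- The ground projector is self-adjoint and fixes the encoding of a solution. Cauchy–Schwarz
against this unit vector therefore transfers its overlap with the initial state to the projected
state. -/
theorem le_norm_groundProj_plusState {k : ℕ} {θ : ℝ} (hθ : 0 ≤ Real.cos (θ / 2)) {φ : CNF k}
    (hφ : ∃ x, φ.Sat x) :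
    Real.cos (θ / 2) ^ k ≤ ‖groundProj θ φ (plusState k)‖ := by
  obtain ⟨x, hx⟩ := hφ
  have h1 : inner ℂ (encState θ x) (groundProj θ φ (plusState k)) =
      inner ℂ (encState θ x) (plusState k) := by
    rw [← inner_starProjection_left (isStarProjection_groundProj θ φ),
      groundProj_eq_self (hamiltonian_encState θ hx)]
  have h2 := norm_inner_le_norm (𝕜 := ℂ) (encState θ x) (groundProj θ φ (plusState k))
  rw [h1, inner_encState_plusState, norm_encState, one_mul, Complex.norm_real, Real.norm_eq_abs,
    abs_of_nonneg (pow_nonneg hθ k)] at h2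
  exact h2

/-! ### The measurements of a cycle -/

theorem isStarProjection_of_mem_cycleChecks {k : ℕ} (θ : ℝ) (L : List (Fin k → Bool))
    (φ : CNF k) : ∀ p ∈ cycleChecks θ L φ, IsStarProjection p := by
  induction L generalizing φ with
  | nil => simp [cycleChecks]
  | cons b L ih =>
    intro p hp
    rcases List.mem_cons.1 hp with rfl | hp
    · refine (isStarProjection_prod ?_ ?_).1
      · intro p hp
        obtain ⟨c, _, rfl⟩ := List.mem_map.1 hp
        exact (isStarProjection_clauseProj θ c).one_sub
      · intro p hp q hq
        obtain ⟨c, hc, rfl⟩ := List.mem_map.1 hp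
        obtain ⟨d, hd, rfl⟩ := List.mem_map.1 hq
        simp only [List.mem_filter, decide_eq_true_eq] at hc hd
        exact (Commute.one_left _).sub_left
          ((Commute.one_right _).sub_right (commute_clauseProj θ b hc.2 hd.2))
    · exact ih _ p hp

theorem length_cycleChecks {k : ℕ} (θ : ℝ) (L : List (Fin k → Bool)) (φ : CNF k) :
    (cycleChecks θ L φ).length = L.length := by
  induction L generalizing φ with
  | nil => rfl
  | cons b L ih => simp [cycleChecks, ih]

theorem cycleChecks_apply_eq_self {k : ℕ} {θ : ℝ} {φ : CNF k} {w : Reg k}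
    (hw : ∀ c ∈ φ, clauseProj θ c w = 0) (L : List (Fin k → Bool)) :
    ∀ p ∈ cycleChecks θ L φ, p w = w := by
  induction L generalizing φ with
  | nil => simp [cycleChecks]
  | cons b L ih =>
    intro p hp
    rcases List.mem_cons.1 hp with rfl | hp
    · have : ∀ l : List (Clause k), (∀ c ∈ l, clauseProj θ c w = 0) →
          (l.map (clauseCheck θ)).prod w = w := by
        intro l hl
        induction l with
        | nil => simp
        | cons c l ih' =>
          have h1 := ih' fun c hc => hl c (by simp [hc])
          have h2 := hl c (by simp)
          simp [clauseCheck, h1, h2]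
      exact this _ fun c hc => hw c (List.mem_of_mem_filter hc)
    · exact ih (fun c hc => hw c (List.mem_of_mem_filter hc)) p hp

/-- Every clause is compatible with some layer. -/
def Covers {k : ℕ} (L : List (Fin k → Bool)) (φ : CNF k) : Prop :=
  ∀ c ∈ φ, ∃ b ∈ L, Compatible b c

/-- The check of a layer absorbs the check of each of its clauses, so a vector fixed by the former
is fixed by the latter. A clause not caught by the first layer is passed on, and so is its covering
layer. -/
theorem clauseProj_eq_zero_of_cycleChecks {k : ℕ} {θ : ℝ} {L : List (Fin k → Bool)} {φ : CNF k}
    (hL : Covers L φ) {w : Reg k} (hw : ∀ p ∈ cycleChecks θ L φ, p w = w) :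
    ∀ c ∈ φ, clauseProj θ c w = 0 := by
  induction L generalizing φ with
  | nil =>
    intro c hc
    obtain ⟨b, hb, _⟩ := hL c hc
    simp at hb
  | cons b L ih =>
    intro c hc
    by_cases hbc : Compatible b c
    · have h1 := hw _ (List.mem_cons_self)
      have h2 := (isStarProjection_prod (l := (φ.filter fun c => decide (Compatible b c)).map
        (clauseCheck θ)) ?_ ?_).2 (clauseCheck θ c)
        (List.mem_map.2 ⟨c, by simp [hc, hbc], rfl⟩)
      · have h3 := congrArg (fun f : Reg k →L[ℂ] Reg k => f w) h2
        simp only [mul_apply_eq_comp, h1] at h3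
        simp only [clauseCheck, sub_apply, one_apply_eq_self,
          sub_eq_self] at h3
        exact h3
      · intro p hp
        obtain ⟨c, _, rfl⟩ := List.mem_map.1 hp
        exact (isStarProjection_clauseProj θ c).one_sub
      · intro p hp q hq
        obtain ⟨c, hc, rfl⟩ := List.mem_map.1 hp
        obtain ⟨d, hd, rfl⟩ := List.mem_map.1 hq
        simp only [List.mem_filter, decide_eq_true_eq] at hc hd
        exact (Commute.one_left _).sub_left
          ((Commute.one_right _).sub_right (commute_clauseProj θ b hc.2 hd.2))
    · refine ih ?_ (fun p hp => hw p (List.mem_cons_of_mem _ hp)) c (by simp [hc, hbc])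
      intro d hd
      simp only [List.mem_filter, Bool.not_eq_true', decide_eq_false_iff_not] at hd
      obtain ⟨b', hb', h'⟩ := hL d hd.1
      rcases List.mem_cons.1 hb' with rfl | hb'
      · exact absurd h' hd.2
      · exact ⟨b', hb', h'⟩

/-! ### Existence of rates -/

section Sequence

variable {E : Type*} [NormedAddCommGroup E] [InnerProductSpace ℂ E]

theorem reverse_prod_cons_apply (p : E →L[ℂ] E) (l : List (E →L[ℂ] E)) (w : E) :
    (p :: l).reverse.prod w = l.reverse.prod (p w) := by
  simp

theorem reverse_prod_apply_eq_self {l : List (E →L[ℂ] E)} {w : E} (h : ∀ p ∈ l, p w = w) :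
    l.reverse.prod w = w := by
  induction l with
  | nil => simp
  | cons p l ih =>
    rw [reverse_prod_cons_apply, h p (by simp), ih fun q hq => h q (by simp [hq])]

variable [CompleteSpace E]

theorem norm_reverse_prod_le {l : List (E →L[ℂ] E)} (hl : ∀ p ∈ l, IsStarProjection p) (w : E) :
    ‖l.reverse.prod w‖ ≤ ‖w‖ := by
  induction l generalizing w with
  | nil => simp
  | cons p l ih =>
    rw [reverse_prod_cons_apply]
    exact (ih (fun q hq => hl q (by simp [hq])) _).trans (norm_starProjection_le (hl p (by simp)) w)

/-- No projector increases the norm, so equality at the end forces equality at each stage, and a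
projector that preserves the norm of a vector fixes it. -/
theorem eq_of_norm_reverse_prod {l : List (E →L[ℂ] E)} (hl : ∀ p ∈ l, IsStarProjection p) {w : E}
    (h : ‖w‖ ≤ ‖l.reverse.prod w‖) : ∀ p ∈ l, p w = w := by
  induction l generalizing w with
  | nil => simp
  | cons p l ih =>
    have hl' : ∀ q ∈ l, IsStarProjection q := fun q hq => hl q (by simp [hq])
    rw [reverse_prod_cons_apply] at h
    have h1 : p w = w :=
      eq_of_norm_starProjection (hl p (by simp)) (h.trans (norm_reverse_prod_le hl' _))
    rw [h1] at h
    intro q hq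
    rcases List.mem_cons.1 hq with rfl | hq
    · exact h1
    · exact ih hl' h q hq

/-- The adjoint of $pP=P$ is $Pp=P$. -/
theorem mul_reverse_prod_eq {P : E →L[ℂ] E} (hP : IsStarProjection P) {l : List (E →L[ℂ] E)}
    (hl : ∀ p ∈ l, IsStarProjection p) (h : ∀ p ∈ l, p * P = P) : P * l.reverse.prod = P := by
  induction l with
  | nil => simp
  | cons p l ih =>
    have h1 : P * p = P := by
      have := congrArg star (h p (by simp))
      rwa [star_mul, hP.isSelfAdjoint.star_eq, (hl p (by simp)).isSelfAdjoint.star_eq] at this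
    rw [List.reverse_cons, List.prod_append, List.prod_singleton, ← mul_assoc,
      ih (fun q hq => hl q (by simp [hq])) (fun q hq => h q (by simp [hq])), h1]

end Sequence

theorem cycleOp_mul_groundProj {k : ℕ} (θ : ℝ) (L : List (Fin k → Bool)) (φ : CNF k) :
    cycleOp θ L φ * groundProj θ φ = groundProj θ φ := by
  ext1 w
  rw [mul_apply_eq_comp, cycleOp]
  exact reverse_prod_apply_eq_self
    (cycleChecks_apply_eq_self ((mem_ker_hamiltonian θ φ _).1 (hamiltonian_groundProj θ φ w)) L)

theorem groundProj_mul_cycleOp {k : ℕ} (θ : ℝ) (L : List (Fin k → Bool)) (φ : CNF k) :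
    groundProj θ φ * cycleOp θ L φ = groundProj θ φ := by
  refine mul_reverse_prod_eq (isStarProjection_groundProj θ φ)
    (isStarProjection_of_mem_cycleChecks θ L φ) fun p hp => ?_
  ext1 w
  exact cycleChecks_apply_eq_self
    ((mem_ker_hamiltonian θ φ _).1 (hamiltonian_groundProj θ φ w)) L p hp

/-- Since $T-P=T(1-P)$, a vector of the unit ball whose image has norm at least one would have
$w-Pw$ fixed by all checks. Then $w-Pw$ would be a ground state, on which $P$ vanishes, hence zero.
-/
theorem norm_cycleOp_sub_groundProj_lt_one {k : ℕ} {θ : ℝ} {L : List (Fin k → Bool)} {φ : CNF k}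
    (hL : Covers L φ) : ‖cycleOp θ L φ - groundProj θ φ‖ < 1 := by
  set P := groundProj θ φ with hPdef
  set T := cycleOp θ L φ with hT
  have hP : IsStarProjection P := isStarProjection_groundProj θ φ
  have hlt : ∀ w : Reg k, ‖w‖ ≤ 1 → ‖(T - P) w‖ < 1 := by
    intro w hw
    have h1 : (T - P) w = T (w - P w) := by
      have := congrArg (fun f : Reg k →L[ℂ] Reg k => f w) (cycleOp_mul_groundProj θ L φ)
      simp only [mul_apply_eq_comp] at this
      rw [map_sub, this, sub_apply]
    have h2 : ‖w - P w‖ ≤ 1 := by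
      have := norm_starProjection_le hP.one_sub w
      simp only [sub_apply, one_apply_eq_self] at this
      exact this.trans hw
    by_contra hge
    rw [h1, not_lt] at hge
    have h3 : ∀ p ∈ cycleChecks θ L φ, p (w - P w) = w - P w :=
      eq_of_norm_reverse_prod (isStarProjection_of_mem_cycleChecks θ L φ) (h2.trans hge)
    have h4 := groundProj_eq_self
      ((mem_ker_hamiltonian θ φ _).2 (clauseProj_eq_zero_of_cycleChecks hL h3))
    rw [← hPdef, map_sub, starProjection_idem hP, sub_self] at h4
    rw [← h4, map_zero, norm_zero] at hge
    linarith
  -- The pointwise strict bound becomes one for the operator norm because the norm is attained on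
  -- the compact unit ball.
  obtain ⟨w₀, hw₀, hmax⟩ := (isCompact_closedBall (0 : Reg k) 1).exists_isMaxOn
    ⟨0, by simp⟩ ((T - P).continuous.norm.continuousOn)
  refine lt_of_le_of_lt (ContinuousLinearMap.opNorm_le_bound _ (norm_nonneg ((T - P) w₀)) ?_)
    (hlt w₀ (by simpa using hw₀))
  intro w
  by_cases hw : w = 0
  · simp [hw]
  · have hw' : ‖w‖ ≠ 0 := norm_ne_zero_iff.2 hw
    have h1 : ((‖w‖⁻¹ : ℝ) : ℂ) • w ∈ Metric.closedBall (0 : Reg k) 1 := by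
      rw [mem_closedBall_zero_iff, norm_smul, Complex.norm_real, norm_inv, norm_norm,
        inv_mul_cancel₀ hw']
    have h2 := hmax h1
    simp only [map_smul, Set.mem_ofPred_eq, norm_smul, Complex.norm_real, norm_inv,
      norm_norm] at h2
    rw [inv_mul_le_iff₀ (norm_pos_iff.2 hw)] at h2
    linarith

/-- From $TP=PT=P$ follows $T^r-P=(T-P)^r$ for $r\ge1$. All numbers above a threshold are obtained,
so that one rate can serve several formulas. -/
theorem exists_isRate {k : ℕ} {θ : ℝ} {L : List (Fin k → Bool)} {φ : CNF k} (hL : Covers L φ) :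
    ∃ μ₀ < 1, ∀ μ, μ₀ ≤ μ → IsRate θ μ L φ := by
  refine ⟨_, norm_cycleOp_sub_groundProj_lt_one (θ := θ) hL, fun μ hμ r hr ψ => ?_⟩
  have hTP := cycleOp_mul_groundProj θ L φ
  have hPT := groundProj_mul_cycleOp θ L φ
  have hP := (isStarProjection_groundProj θ φ).isIdempotentElem.eq
  have hpow : ∀ r : ℕ, cycleOp θ L φ ^ r * groundProj θ φ = groundProj θ φ := by
    intro r
    induction r with
    | zero => simp
    | succ r ih => rw [pow_succ, mul_assoc, hTP, ih]
  have key : (cycleOp θ L φ - groundProj θ φ) ^ r = cycleOp θ L φ ^ r - groundProj θ φ := by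
    induction r, hr using Nat.le_induction with
    | base => simp
    | succ r hr ih =>
      rw [pow_succ, ih, sub_mul, mul_sub, mul_sub, ← pow_succ, hpow, hPT, hP, sub_self, sub_zero]
  rw [← sub_apply, ← key]
  refine (ContinuousLinearMap.le_opNorm _ _).trans ?_
  gcongr
  exact (norm_pow_le' _ hr).trans (pow_le_pow_left₀ (norm_nonneg _) hμ r)

theorem Covers.propagate {k : ℕ} {L : List (Fin (k + 1) → Bool)} {φ : CNF (k + 1)}
    (hL : Covers L φ) (s : Bool) :
    Covers (L.map fun b i => b i.succ) (CNF.propagate s φ) := by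
  intro c hc
  obtain ⟨d, hd, rfl⟩ := List.mem_map.1 hc
  obtain ⟨b, hb, hbd⟩ := hL d (List.mem_of_mem_filter hd)
  exact ⟨fun i => b i.succ, List.mem_map.2 ⟨b, hb, rfl⟩, fun i => hbd i.succ⟩

theorem exists_isUniformRate (θ : ℝ) (k : ℕ) (L : List (Fin k → Bool)) (φ : CNF k)
    (hL : Covers L φ) : ∃ μ₀ < 1, ∀ μ, μ₀ ≤ μ → IsUniformRate θ μ k L φ := by
  induction k with
  | zero => exact ⟨0, one_pos, fun _ _ => trivial⟩
  | succ k ih =>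
    obtain ⟨μ₀, h₀, H₀⟩ := exists_isRate (θ := θ) hL
    obtain ⟨μ₁, h₁, H₁⟩ := ih _ _ (hL.propagate false)
    obtain ⟨μ₂, h₂, H₂⟩ := ih _ _ (hL.propagate true)
    refine ⟨max μ₀ (max μ₁ μ₂), by simp [h₀, h₁, h₂], fun μ hμ => ?_⟩
    simp only [max_le_iff] at hμ
    refine ⟨H₀ μ hμ.1, fun s _ => ?_⟩
    cases s
    · exact H₁ μ hμ.2.1
    · exact H₂ μ hμ.2.2

/-- A function that is injective on the variables of the clause gives them different symbols, so
each symbol can be sent to the sign of its only variable in the clause. -/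
theorem covers_layersOf {n : ℕ} {F : List (Fin n → Fin 3)} (hF : IsPerfectHashFamily F)
    {φ : CNF n} (hφ : φ.IsThreeSAT) : Covers (layersOf F) φ := by
  intro c hc
  obtain ⟨f, hf, hinj⟩ := hF _ (hφ c hc)
  classical
  refine ⟨(fun t => if h : ∃ i, c i ≠ none ∧ f i = t then (c h.choose).getD false else false) ∘ f,
    ?_, ?_⟩
  · simp only [layersOf, List.mem_flatMap, List.mem_map, Finset.mem_toList]
    exact ⟨f, hf, _, Finset.mem_univ _, rfl⟩
  · intro i
    by_cases hi : c i = none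
    · exact Or.inl hi
    · right
      have hex : ∃ j, c j ≠ none ∧ f j = f i := ⟨i, hi, rfl⟩
      have heq : hex.choose = i :=
        hinj (by simpa using hex.choose_spec.1) (by simpa using hi) hex.choose_spec.2
      simp only [Function.comp, dif_pos hex, heq]
      cases h : c i with
      | none => exact absurd h hi
      | some b => rfl

theorem length_layersOf {n : ℕ} (F : List (Fin n → Fin 3)) :
    (layersOf F).length = F.length * 8 := by
  simp [layersOf, List.length_flatMap]

theorem IsPerfectHashFamily.length_pos {n : ℕ} {F : List (Fin n → Fin 3)}
    (hF : IsPerfectHashFamily F) : 0 < F.length := by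
  obtain ⟨f, hf, _⟩ := hF ∅ (by simp)
  exact List.length_pos_of_mem hf

/-! ### Existence of hash families -/

open Classical in
-- Of the $27$ maps from three points to three symbols, $6$ are injective, so a random function
-- fails on a given triple with probability $21/27=7/9$.
theorem card_not_injOn {n : ℕ} {S : Finset (Fin n)} (hS : S.card = 3) :
    9 * (Finset.univ.filter fun f : Fin n → Fin 3 => ¬ Set.InjOn f S).card = 7 * 3 ^ n := by
  have h1 : (Finset.univ.filter fun f : Fin n → Fin 3 => Set.InjOn f S).card =
      6 * 3 ^ (n - 3) := by
    let e := Equiv.piEquivPiSubtypeProd (fun i => i ∈ S) (fun _ : Fin n => Fin 3)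
    have hiff : ∀ f : Fin n → Fin 3, Set.InjOn f S ↔ Function.Injective (e f).1 := by
      intro f
      exact Set.injOn_iff_injective
    rw [← Fintype.card_subtype]
    rw [Fintype.card_congr (e.subtypeEquiv (q := fun g => Function.Injective g.1) hiff)]
    rw [Fintype.card_congr (Equiv.prodSubtypeFstEquivSubtypeProd
      (p := fun g : {i // i ∈ S} → Fin 3 => Function.Injective g)), Fintype.card_prod,
      Fintype.card_congr (Equiv.subtypeInjectiveEquivEmbedding _ _), Fintype.card_embedding_eq]
    simp [hS, Fintype.card_subtype_compl, Nat.descFactorial]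
  have h2 := Finset.card_filter_add_card_filter_not (s := (Finset.univ : Finset (Fin n → Fin 3)))
    (fun f : Fin n → Fin 3 => Set.InjOn f S)
  rw [h1, Finset.card_univ, Fintype.card_fun, Fintype.card_fin, Fintype.card_fin] at h2
  have h3 : 3 ≤ n := by
    have := Finset.card_le_univ S
    rwa [hS, Fintype.card_fin] at this
  have h4 : 3 ^ n = 27 * 3 ^ (n - 3) := by
    rw [show n = (n - 3) + 3 by omega, pow_add]; simp [mul_comm]
  omega

open Classical in
-- Union bound over the triples for $m$ independent random functions. Smaller sets are enlarged to
-- triples, which needs $n\ge3$.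
theorem exists_hashFamily_of_choose_lt {n m : ℕ} (hn : 3 ≤ n)
    (h : n.choose 3 * 7 ^ m < 9 ^ m) :
    ∃ F : List (Fin n → Fin 3), IsPerfectHashFamily F ∧ F.length = m := by
  set bad : Finset (Fin n) → Finset (Fin n → Fin 3) := fun S =>
    Finset.univ.filter fun f : Fin n → Fin 3 => ¬ Set.InjOn f S with hbad
  set U := (Finset.powersetCard 3 (Finset.univ : Finset (Fin n))).biUnion
    fun S => Fintype.piFinset fun _ : Fin m => bad S with hU
  have hcard : 9 ^ m * U.card < 9 ^ m * (3 ^ n) ^ m := by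
    calc 9 ^ m * U.card
        ≤ 9 ^ m * ∑ S ∈ Finset.powersetCard 3 (Finset.univ : Finset (Fin n)),
          (Fintype.piFinset fun _ : Fin m => bad S).card :=
          Nat.mul_le_mul_left _ Finset.card_biUnion_le
      _ = ∑ S ∈ Finset.powersetCard 3 (Finset.univ : Finset (Fin n)), (7 * 3 ^ n) ^ m := by
          rw [Finset.mul_sum]
          refine Finset.sum_congr rfl fun S hS => ?_
          rw [Fintype.card_piFinset_const, ← mul_pow,
            ← card_not_injOn (Finset.mem_powersetCard.1 hS).2]
      _ = n.choose 3 * 7 ^ m * (3 ^ n) ^ m := by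
          simp [Finset.card_powersetCard, mul_pow, mul_assoc]
      _ < 9 ^ m * (3 ^ n) ^ m := Nat.mul_lt_mul_of_pos_right h (by positivity)
  have hlt : U.card < (Finset.univ : Finset (Fin m → Fin n → Fin 3)).card := by
    rw [Finset.card_univ, Fintype.card_fun, Fintype.card_fun, Fintype.card_fin, Fintype.card_fin,
      Fintype.card_fin]
    exact Nat.lt_of_mul_lt_mul_left hcard
  obtain ⟨G, _, hG⟩ := Finset.exists_mem_notMem_of_card_lt_card hlt
  refine ⟨List.ofFn G, fun S hS => ?_, by simp⟩
  obtain ⟨S', hSS', hS'⟩ := Finset.exists_superset_card_eq hS (by simpa using hn)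
  have h1 : G ∉ Fintype.piFinset fun _ : Fin m => bad S' := fun hmem =>
    hG (Finset.mem_biUnion.2 ⟨S', Finset.mem_powersetCard.2 ⟨Finset.subset_univ _, hS'⟩, hmem⟩)
  simp only [Fintype.mem_piFinset, hbad, Finset.mem_filter, Finset.mem_univ, true_and, not_forall,
    not_not] at h1
  obtain ⟨j, hj⟩ := h1
  exact ⟨G j, by simp, hj.mono (by exact_mod_cast hSS')⟩

theorem exists_hashFamily (n : ℕ) (hn : 2 ≤ n) : ∃ F : List (Fin n → Fin 3),
    IsPerfectHashFamily F ∧ (F.length : ℝ) ≤ 3 / Real.log (27 / 21) * Real.log n := by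
  have hlog : 0 < Real.log (27 / 21) := Real.log_pos (by norm_num)
  rcases Nat.lt_or_ge n 3 with h3 | h3
  · obtain rfl : n = 2 := by omega
    refine ⟨[fun i => Fin.castSucc i], fun S _ => ⟨_, List.mem_singleton_self _,
      (Fin.castSucc_injective 2).injOn⟩, ?_⟩
    have h1 : Real.log (27 / 21) ≤ Real.log 2 := Real.log_le_log (by norm_num) (by norm_num)
    rw [div_mul_eq_mul_div, le_div_iff₀ hlog]
    simp
    have := Real.log_pos (by norm_num : (1 : ℝ) < 2)
    linarith
  · set x := 3 / Real.log (27 / 21) * Real.log n with hx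
    have hn0 : (0 : ℝ) < n := by positivity
    have hlogn : 0 ≤ Real.log n := Real.log_natCast_nonneg n
    have hx0 : 0 ≤ x := by positivity
    obtain ⟨F, hF, hlen⟩ := exists_hashFamily_of_choose_lt (n := n) (m := ⌊x⌋₊) h3 (by
      have h1 : x < ⌊x⌋₊ + 1 := Nat.lt_floor_add_one x
      -- The loss of a factor $9/7$ from rounding down is covered by the factor $6$ in $\binom n3\le
      -- n^3/6$.
      have h2 : (n : ℝ) ^ 3 < (9 / 7) ^ (⌊x⌋₊ + 1) := by
        rw [← Real.log_lt_log_iff (by positivity) (by positivity), Real.log_pow, Real.log_pow]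
        have h4 : x * Real.log (27 / 21) = 3 * Real.log n := by
          rw [hx]; field_simp
        have h5 : (9 / 7 : ℝ) = 27 / 21 := by norm_num
        rw [h5]
        push_cast
        nlinarith
      have h6 : (n.choose 3 : ℝ) ≤ (n : ℝ) ^ 3 / 6 := by
        have := Nat.choose_le_pow_div (α := ℝ) 3 n
        simpa [Nat.factorial] using this
      have h7 : (n.choose 3 : ℝ) * 7 ^ ⌊x⌋₊ < 9 ^ ⌊x⌋₊ := by
        rw [← lt_div_iff₀ (by positivity), ← div_pow]
        rw [pow_succ (9 / 7 : ℝ)] at h2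
        have : (0 : ℝ) < (9 / 7) ^ ⌊x⌋₊ := by positivity
        linarith
      exact_mod_cast h7)
    exact ⟨F, hF, by rw [hlen]; exact Nat.floor_le hx0⟩

/-! ### Measurement-driven state preparation -/

theorem born_apply {ι : Type} [Fintype ι] [Nonempty ι] {w : ι → ℝ≥0} (h : ∑ i, w i = 1) (i : ι) :
    born w i = w i := by
  have h0 : ¬ ∑ i, w i = 0 := by rw [h]; exact one_ne_zero
  rw [born, dif_neg h0, PMF.normalize_apply, tsum_fintype, ← ENNReal.ofNNReal_finsetSum, h]
  simp

theorem norm_unit {k : ℕ} {ψ : Reg k} (h : ψ ≠ 0) : ‖unit ψ‖ = 1 := by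
  rw [unit, norm_smul, Complex.norm_real, norm_inv, norm_norm,
    inv_mul_cancel₀ (norm_ne_zero_iff.2 h)]

theorem unit_of_norm_eq_one {k : ℕ} {ψ : Reg k} (h : ‖ψ‖ = 1) : unit ψ = ψ := by
  simp [unit, h]

theorem unit_apply_unit {k : ℕ} (q : Reg k →L[ℂ] Reg k) {ψ : Reg k} (h : ψ ≠ 0) :
    unit (q (unit ψ)) = unit (q ψ) := by
  have h0 : ‖ψ‖ ≠ 0 := norm_ne_zero_iff.2 h
  have h1 : (‖ψ‖ : ℂ) ≠ 0 := by exact_mod_cast h0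
  simp only [unit, map_smul, norm_smul, smul_smul, Complex.norm_real, norm_inv, norm_norm,
    mul_inv, inv_inv]
  congr 1
  push_cast
  field_simp

namespace Run

theorem loss_check {k : ℕ} {p : Reg k →L[ℂ] Reg k} (hp : IsStarProjection p) {ψ : Reg k}
    (hψ : ‖ψ‖ = 1) (h : Option (Reg k) → ℕ → ℝ≥0∞) {B : ℕ} (hB : 1 ≤ B) :
    loss (check p ψ) h B = ENNReal.ofReal (‖p ψ‖ ^ 2) * h (some (unit (p ψ))) (B - 1) +
      ENNReal.ofReal (1 - ‖p ψ‖ ^ 2) * h none (B - 1) := by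
  have hsum := norm_sq_add_norm_sq_sub hp ψ
  rw [hψ, one_pow] at hsum
  have hw : ∑ b : Bool, (if b then ‖p ψ‖₊ ^ 2 else ‖ψ - p ψ‖₊ ^ 2) = 1 := by
    rw [Fintype.sum_bool]
    simp only [if_true, Bool.false_eq_true, if_false]
    apply NNReal.eq
    push_cast
    exact hsum
  rw [check, loss_bind, loss_spend, if_pos hB, loss_bind, loss_sample, tsum_fintype,
    Fintype.sum_bool, born_apply hw, born_apply hw]
  simp only [loss_ret, if_true, Bool.false_eq_true, if_false]
  congr 2
  · rw [ENNReal.ofReal_pow (norm_nonneg _), ofReal_norm]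
    rfl
  · rw [show 1 - ‖p ψ‖ ^ 2 = ‖ψ - p ψ‖ ^ 2 by linarith, ENNReal.ofReal_pow (norm_nonneg _),
      ofReal_norm]
    rfl

/-- The conditional probabilities of the successive checks telescope to the squared norm of the
unnormalized product, and normalizing after each check yields the same state as normalizing once at
the end. -/
theorem loss_attempt_le {k : ℕ} {ps : List (Reg k →L[ℂ] Reg k)}
    (hps : ∀ p ∈ ps, IsStarProjection p) {ψ : Reg k} (hψ : ‖ψ‖ = 1)
    (h : Option (Reg k) → ℕ → ℝ≥0∞) {B : ℕ} (hB : ps.length ≤ B) {X Y : ℝ≥0∞}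
    (hX : ps.reverse.prod ψ ≠ 0 → ∀ B', B ≤ B' + ps.length →
      h (some (unit (ps.reverse.prod ψ))) B' ≤ X)
    (hY : ∀ B', B ≤ B' + ps.length → B' < B → h none B' ≤ Y) :
    loss (attempt ps ψ) h B ≤ ENNReal.ofReal (‖ps.reverse.prod ψ‖ ^ 2) * X +
      ENNReal.ofReal (1 - ‖ps.reverse.prod ψ‖ ^ 2) * Y := by
  induction ps generalizing ψ B with
  | nil =>
    have h0 : ψ ≠ 0 := by rintro rfl; simp at hψ
    simp only [List.reverse_nil, List.prod_nil, one_apply_eq_self] at hX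
    have := hX h0 B (by simp)
    rw [unit_of_norm_eq_one hψ] at this
    simpa [attempt, loss_ret, hψ] using this
  | cons p ps ih =>
    have hp := hps p (by simp)
    have hps' : ∀ q ∈ ps, IsStarProjection q := fun q hq => hps q (by simp [hq])
    rw [List.length_cons] at hB hX hY
    have hle : ‖p ψ‖ ≤ 1 := hψ ▸ norm_starProjection_le hp ψ
    have hnone : h none (B - 1) ≤ Y := hY _ (by omega) (by omega)
    rw [attempt, loss_bind, loss_check hp hψ _ (by omega : 1 ≤ B)]
    simp only [loss_ret]
    rw [reverse_prod_cons_apply] at hX ⊢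
    -- If the check cannot pass, the normalized state is meaningless, but it occurs with weight
    -- zero.
    by_cases h0 : p ψ = 0
    · simp only [h0, map_zero, norm_zero]
      simpa using hnone
    · have hrest : ps.reverse.prod (unit (p ψ)) =
          ((‖p ψ‖⁻¹ : ℝ) : ℂ) • ps.reverse.prod (p ψ) := by
        rw [unit, map_smul]
      have ih' := ih (B := B - 1) hps' (norm_unit h0) (by omega) ?_ ?_
      · have hn : ‖ps.reverse.prod (p ψ)‖ ^ 2 =
            ‖p ψ‖ ^ 2 * ‖ps.reverse.prod (unit (p ψ))‖ ^ 2 := by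
          rw [hrest, norm_smul, Complex.norm_real, norm_inv, norm_norm]
          have : ‖p ψ‖ ≠ 0 := norm_ne_zero_iff.2 h0
          field_simp
        have hle2 : ‖ps.reverse.prod (unit (p ψ))‖ ≤ 1 :=
          norm_unit h0 ▸ norm_reverse_prod_le hps' _
        set q := ‖ps.reverse.prod (unit (p ψ))‖ ^ 2 with hq
        set a := ‖p ψ‖ ^ 2 with ha
        have hq1 : q ≤ 1 := pow_le_one₀ (norm_nonneg _) hle2
        have ha1 : a ≤ 1 := pow_le_one₀ (norm_nonneg _) hle
        have hq0 : 0 ≤ q := sq_nonneg _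
        have ha0 : 0 ≤ a := sq_nonneg _
        rw [hn]
        calc _ ≤ ENNReal.ofReal a * (ENNReal.ofReal q * X + ENNReal.ofReal (1 - q) * Y) +
              ENNReal.ofReal (1 - a) * Y := by gcongr
          _ = ENNReal.ofReal (a * q) * X + ENNReal.ofReal (1 - a * q) * Y := by
            rw [show 1 - a * q = a * (1 - q) + (1 - a) by ring,
              ENNReal.ofReal_add (mul_nonneg ha0 (by linarith)) (by linarith),
              ENNReal.ofReal_mul ha0, ENNReal.ofReal_mul ha0]
            ring
      · intro hne B' hB'
        rw [unit_apply_unit _ h0]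
        refine hX (fun h1 => hne ?_) B' (by omega)
        rw [hrest, h1, smul_zero]
      · intro B' hB' hlt
        exact hY B' (by omega) (by omega)

theorem isAttempt_attempt {k : ℕ} {ps : List (Reg k →L[ℂ] Reg k)}
    (hps : ∀ p ∈ ps, IsStarProjection p) {ψ : Reg k} (hψ : ‖ψ‖ = 1) {G : Reg k → Prop}
    (hG : ∀ c : ℂ, c ≠ 0 → G (unit (c • ps.reverse.prod ψ))) {P : ℝ} (hP : 0 ≤ P)
    (hP' : P ≤ ‖ps.reverse.prod ψ‖ ^ 2) : IsAttempt (attempt ps ψ) G ps.length P := by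
  intro h B X Y hB hXY hX hY
  refine (loss_attempt_le hps hψ h hB (fun _ B' hB' => hX _ B' ?_ hB') hY).trans
    (mix_le_mix hP hP' ?_ hXY)
  · simpa using hG 1 one_ne_zero
  · exact pow_le_one₀ (norm_nonneg _) (hψ ▸ norm_reverse_prod_le hps ψ)

end Run

/-! ### Coherent state preparation -/

theorem ext_slice {k s : ℕ} {Φ Ψ : ExtReg k s} (h : ∀ a, slice Φ a = slice Ψ a) : Φ = Ψ := by
  ext z
  exact congrArg (fun ψ : Reg k => ψ z.1) (h z.2)

theorem inner_eq_sum_slice {k s : ℕ} (Φ Ψ : ExtReg k s) :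
    inner ℂ Φ Ψ = ∑ a, inner ℂ (slice Φ a) (slice Ψ a) := by
  simp only [PiLp.inner_apply]
  rw [Fintype.sum_prod_type_right]
  rfl

/-- Flip of an auxiliary qubit. -/
theorem slice_deferredCheck {k s : ℕ} (p : Reg k →L[ℂ] Reg k) (t : Fin s) (Φ : ExtReg k s)
    (a : Fin s → Bool) : slice (deferredCheck p t Φ) a =
      p (slice Φ a) + (slice Φ (flipBit t a) - p (slice Φ (flipBit t a))) := rfl

theorem deferredCheck_sub_smul {k s : ℕ} (p : Reg k →L[ℂ] Reg k) (t : Fin s) (Φ Ψ : ExtReg k s)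
    (c : ℂ) : deferredCheck p t (Φ - c • Ψ) = deferredCheck p t Φ - c • deferredCheck p t Ψ := by
  refine ext_slice fun a => ?_
  have h : ∀ (Φ Ψ : ExtReg k s) a, slice (Φ - c • Ψ) a = slice Φ a - c • slice Ψ a :=
    fun _ _ _ => rfl
  simp only [h, slice_deferredCheck, map_sub, map_smul]
  module

theorem deferredCheck_involutive {k s : ℕ} {p : Reg k →L[ℂ] Reg k} (hp : IsStarProjection p)
    (t : Fin s) (Φ : ExtReg k s) : deferredCheck p t (deferredCheck p t Φ) = Φ := by
  refine ext_slice fun a => ?_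
  simp only [slice_deferredCheck, flipBit_involutive t a, map_add, map_sub,
    starProjection_idem hp]
  abel

theorem inner_deferredCheck {k s : ℕ} {p : Reg k →L[ℂ] Reg k} (hp : IsStarProjection p)
    (t : Fin s) (Φ Ψ : ExtReg k s) :
    inner ℂ (deferredCheck p t Φ) Ψ = inner ℂ Φ (deferredCheck p t Ψ) := by
  simp only [inner_eq_sum_slice, slice_deferredCheck, inner_add_left, inner_sub_left,
    inner_add_right, inner_sub_right, Finset.sum_add_distrib, Finset.sum_sub_distrib,
    inner_starProjection_left hp]
  congr 2
  · rw [← Equiv.sum_comp (flipBit_involutive t).toPerm]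
    refine Finset.sum_congr rfl fun a _ => ?_
    simp only [Function.Involutive.coe_toPerm, flipBit_involutive t a]
  · rw [← Equiv.sum_comp (flipBit_involutive t).toPerm]
    refine Finset.sum_congr rfl fun a _ => ?_
    simp only [Function.Involutive.coe_toPerm, flipBit_involutive t a]

section Coherent

variable {k : ℕ} {ps : List (Reg k →L[ℂ] Reg k)}

theorem coherent_sub_smul (Φ Ψ : ExtReg k ps.length) (c : ℂ) :
    coherent ps (Φ - c • Ψ) = coherent ps Φ - c • coherent ps Ψ := by
  unfold coherent
  generalize List.finRange ps.length = l
  induction l generalizing Φ Ψ with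
  | nil => rfl
  | cons t l ih => rw [List.foldl_cons, deferredCheck_sub_smul, ih]; rfl

theorem coherent_coherentInv (hps : ∀ p ∈ ps, IsStarProjection p) (Φ : ExtReg k ps.length) :
    coherent ps (coherentInv ps Φ) = Φ := by
  unfold coherent coherentInv
  generalize List.finRange ps.length = l
  induction l with
  | nil => rfl
  | cons t l ih =>
    rw [List.foldl_cons, List.foldr_cons, deferredCheck_involutive (hps _ (List.get_mem ps t)), ih]

theorem coherentInv_coherent (hps : ∀ p ∈ ps, IsStarProjection p) (Φ : ExtReg k ps.length) :
    coherentInv ps (coherent ps Φ) = Φ := by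
  unfold coherent coherentInv
  generalize List.finRange ps.length = l
  induction l generalizing Φ with
  | nil => rfl
  | cons t l ih =>
    rw [List.foldl_cons, List.foldr_cons, ih, deferredCheck_involutive (hps _ (List.get_mem ps t))]

theorem inner_coherent (hps : ∀ p ∈ ps, IsStarProjection p) (Φ Ψ : ExtReg k ps.length) :
    inner ℂ (coherent ps Φ) Ψ = inner ℂ Φ (coherentInv ps Ψ) := by
  unfold coherent coherentInv
  generalize List.finRange ps.length = l
  induction l generalizing Φ with
  | nil => rfl
  | cons t l ih =>
    rw [List.foldl_cons, List.foldr_cons, ih, inner_deferredCheck (hps _ (List.get_mem ps t))]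

theorem slice_extInit (k s : ℕ) (a : Fin s → Bool) :
    slice (extInit k s) a = if a = (fun _ => false) then plusState k else 0 := by
  ext x
  simp only [slice, extInit]
  split_ifs <;> rfl

theorem inner_extInit_self (k s : ℕ) : inner ℂ (extInit k s) (extInit k s) = (1 : ℂ) := by
  rw [inner_eq_sum_slice, Finset.sum_eq_single (fun _ => false)]
  · rw [slice_extInit, if_pos rfl, inner_self_eq_norm_sq_to_K, norm_plusState]; simp
  · intro a _ ha
    rw [slice_extInit, if_neg ha, inner_zero_left]
  · simp

theorem norm_coherent_extInit (hps : ∀ p ∈ ps, IsStarProjection p) :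
    ‖coherent ps (extInit k ps.length)‖ = 1 := by
  have h : inner ℂ (coherent ps (extInit k ps.length)) (coherent ps (extInit k ps.length)) =
      (1 : ℂ) := by
    rw [inner_coherent hps, coherentInv_coherent hps, inner_extInit_self]
  have h2 := congrArg RCLike.re h
  rw [inner_self_eq_norm_sq, RCLike.one_re] at h2
  nlinarith [norm_nonneg (coherent ps (extInit k ps.length))]

/-- Each auxiliary qubit is used once, and those still to be used are all zero. Hence the all-zero
component receives only the passed branch, and the flipped branch never returns to it. -/
theorem slice_foldl_deferredCheck {s : ℕ} (q : Fin s → (Reg k →L[ℂ] Reg k)) {l : List (Fin s)}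
    (hl : l.Nodup) {Φ : ExtReg k s} (hΦ : ∀ a, (∃ t ∈ l, a t = true) → slice Φ a = 0) :
    slice (l.foldl (fun Ψ t => deferredCheck (q t) t Ψ) Φ) (fun _ => false) =
      (l.map q).reverse.prod (slice Φ fun _ => false) := by
  induction l generalizing Φ with
  | nil => simp
  | cons t l ih =>
    rw [List.nodup_cons] at hl
    rw [List.foldl_cons, ih hl.2, List.map_cons, reverse_prod_cons_apply]
    · congr 1
      rw [slice_deferredCheck, hΦ (flipBit t _) ⟨t, by simp, by simp [flipBit]⟩]
      simp
    · rintro a ⟨t', ht', ha⟩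
      have hne : t' ≠ t := fun h => hl.1 (h ▸ ht')
      rw [slice_deferredCheck, hΦ a ⟨t', by simp [ht'], ha⟩,
        hΦ (flipBit t a) ⟨t', by simp [ht'], by simp [flipBit, hne, ha]⟩]
      simp

theorem slice_coherent_extInit :
    slice (coherent ps (extInit k ps.length)) (fun _ => false) =
      ps.reverse.prod (plusState k) := by
  rw [coherent, slice_foldl_deferredCheck _ (List.nodup_finRange _), slice_extInit, if_pos rfl]
  · congr 3
    exact List.map_get_finRange ps
  · rintro a ⟨t, _, ha⟩
    rw [slice_extInit, if_neg]
    rintro rfl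
    simp at ha

/-- The component in which no failed check is recorded. -/
noncomputable def goodPart {k s : ℕ} (Φ : ExtReg k s) : ExtReg k s :=
  WithLp.toLp 2 fun z => if z.2 = (fun _ => false) then Φ z else 0

theorem norm_sq_eq_sum_slice {k s : ℕ} (Φ : ExtReg k s) : ‖Φ‖ ^ 2 = ∑ a, ‖slice Φ a‖ ^ 2 := by
  simp only [EuclideanSpace.norm_sq_eq]
  rw [Fintype.sum_prod_type_right]
  rfl

theorem slice_goodPart {k s : ℕ} (Φ : ExtReg k s) (a : Fin s → Bool) :
    slice (goodPart Φ) a = if a = (fun _ => false) then slice Φ a else 0 := by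
  ext x
  simp only [slice, goodPart]
  split_ifs <;> rfl

theorem norm_goodPart {k s : ℕ} (Φ : ExtReg k s) :
    ‖goodPart Φ‖ = ‖slice Φ fun _ => false‖ := by
  have h : ‖goodPart Φ‖ ^ 2 = ‖slice Φ fun _ => false‖ ^ 2 := by
    rw [norm_sq_eq_sum_slice, Finset.sum_eq_single (fun _ => false)]
    · rw [slice_goodPart, if_pos rfl]
    · intro a _ ha
      rw [slice_goodPart, if_neg ha]; simp
    · simp
  exact (pow_left_inj₀ (norm_nonneg _) (norm_nonneg _) two_ne_zero).1 h

theorem inner_goodPart_left {k s : ℕ} (Φ Ψ : ExtReg k s) :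
    inner ℂ (goodPart Φ) Ψ = inner ℂ Φ (goodPart Ψ) := by
  rw [inner_eq_sum_slice, inner_eq_sum_slice]
  refine Finset.sum_congr rfl fun a _ => ?_
  rw [slice_goodPart, slice_goodPart]
  split_ifs <;> simp

theorem goodPart_goodPart {k s : ℕ} (Φ : ExtReg k s) : goodPart (goodPart Φ) = goodPart Φ := by
  refine ext_slice fun a => ?_
  simp only [slice_goodPart]
  split_ifs <;> rfl

theorem flipGood_eq {k s : ℕ} (Φ : ExtReg k s) : flipGood Φ = Φ - (2 : ℂ) • goodPart Φ := by
  ext z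
  show (if z.2 = (fun _ => false) then -Φ z else Φ z) =
    Φ z - (2 : ℂ) • (if z.2 = (fun _ => false) then Φ z else 0)
  split_ifs
  · rw [smul_eq_mul]; ring
  · simp

/-- Conjugating the reflection about the initial state by the preparation gives the reflection about
the prepared state. -/
theorem groverOp_eq (hps : ∀ p ∈ ps, IsStarProjection p) (Φ : ExtReg k ps.length) :
    groverOp ps Φ = (2 * inner ℂ (coherent ps (extInit k ps.length)) (flipGood Φ)) •
      coherent ps (extInit k ps.length) - flipGood Φ := by
  rw [groverOp, flipInit, coherent_sub_smul, coherent_coherentInv hps, inner_coherent hps, neg_sub]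

/-- Amplitude amplification is a rotation in the plane of the good and the bad component. -/
theorem groverOp_iterate (hps : ∀ p ∈ ps, IsStarProjection p) {α : ℝ}
    (hα : Real.sin α = ‖ps.reverse.prod (plusState k)‖) (j : ℕ) :
    ∃ x y : ℝ, (groverOp ps)^[j] (coherent ps (extInit k ps.length)) =
        (x : ℂ) • goodPart (coherent ps (extInit k ps.length)) +
        (y : ℂ) • (coherent ps (extInit k ps.length) -
          goodPart (coherent ps (extInit k ps.length))) ∧
      x * Real.sin α = Real.sin ((2 * j + 1) * α) ∧
      y * Real.cos α = Real.cos ((2 * j + 1) * α) := by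
  set Φ₀ := coherent ps (extInit k ps.length) with hΦ₀
  have hg : inner ℂ Φ₀ (goodPart Φ₀) = ((Real.sin α ^ 2 : ℝ) : ℂ) := by
    rw [← goodPart_goodPart, ← inner_goodPart_left, inner_self_eq_norm_sq_to_K, norm_goodPart,
      slice_coherent_extInit, ← hα]
    norm_cast
  have h1 : inner ℂ Φ₀ Φ₀ = (1 : ℂ) := by
    rw [inner_self_eq_norm_sq_to_K, norm_coherent_extInit hps]; simp
  have hgsub : ∀ a b : ℂ, goodPart (a • goodPart Φ₀ + b • (Φ₀ - goodPart Φ₀)) =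
      a • goodPart Φ₀ := by
    intro a b
    refine ext_slice fun c => ?_
    have h2 : slice (a • goodPart Φ₀ + b • (Φ₀ - goodPart Φ₀)) c =
      a • slice (goodPart Φ₀) c + b • (slice Φ₀ c - slice (goodPart Φ₀) c) := rfl
    have h3 : slice (a • goodPart Φ₀) c = a • slice (goodPart Φ₀) c := rfl
    rw [slice_goodPart, h2, h3, slice_goodPart]
    split_ifs <;> simp
  induction j with
  | zero =>
    refine ⟨1, 1, ?_, by simp, by simp⟩
    simp
  | succ j ih =>
    obtain ⟨x, y, hxy, hx, hy⟩ := ih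
    refine ⟨x * (1 - 2 * Real.sin α ^ 2) + 2 * y * (1 - Real.sin α ^ 2),
      -2 * Real.sin α ^ 2 * x + y * (1 - 2 * Real.sin α ^ 2), ?_, ?_, ?_⟩
    · rw [Function.iterate_succ_apply', hxy, groverOp_eq hps, ← hΦ₀, flipGood_eq, hgsub]
      simp only [inner_add_right, inner_sub_right, inner_smul_right, hg, h1]
      push_cast
      module
    · have e1 : (2 * ((j + 1 : ℕ) : ℝ) + 1) * α = (2 * j + 1) * α + 2 * α := by push_cast; ring
      rw [e1, Real.sin_add, ← hx, ← hy, Real.cos_two_mul, Real.sin_two_mul]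
      have := Real.sin_sq_add_cos_sq α
      linear_combination (-2 * y * Real.sin α - 2 * x * Real.sin α) * this
    · have e1 : (2 * ((j + 1 : ℕ) : ℝ) + 1) * α = (2 * j + 1) * α + 2 * α := by push_cast; ring
      rw [e1, Real.cos_add, ← hx, ← hy, Real.cos_two_mul, Real.sin_two_mul]
      have := Real.sin_sq_add_cos_sq α
      linear_combination (-2 * y * Real.cos α) * this

end Coherent

/-! ### Average success probability of amplitude amplification -/

/-- Telescoping: $\sin^2\beta=(1-\cos2\beta)/2$, and $2\sin2\alpha\cos2\beta$ is a difference of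
consecutive sines for $\beta=(2j+1)\alpha$. -/
theorem sum_sin_sq_odd (α : ℝ) (N : ℕ) :
    4 * Real.sin (2 * α) * ∑ j ∈ Finset.range N, Real.sin ((2 * j + 1) * α) ^ 2 =
      2 * N * Real.sin (2 * α) - Real.sin (4 * N * α) := by
  induction N with
  | zero => simp
  | succ N ih =>
    rw [Finset.sum_range_succ, mul_add, ih]
    have e1 : 4 * ((N + 1 : ℕ) : ℝ) * α = 2 * ((2 * N + 1) * α) + 2 * α := by push_cast; ring
    have e2 : 4 * (N : ℝ) * α = 2 * ((2 * N + 1) * α) - 2 * α := by ring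
    rw [e1, e2, Real.sin_add, Real.sin_sub, Real.cos_two_mul ((2 * (N : ℝ) + 1) * α)]
    have := Real.sin_sq_add_cos_sq ((2 * (N : ℝ) + 1) * α)
    push_cast
    linear_combination 4 * Real.sin (2 * α) * this

/-- For $\alpha<\pi/2$ the closed form reduces the claim to $\sin(4N\alpha)\le N\sin2\alpha$. Up to
$\pi/4$ the right side is at least one, as $N\sin\alpha\ge1$ and $\cos\alpha\ge1/2$. Beyond $\pi/4$
the distance $\beta$ to $\pi/2$ is used: either $4N\beta\le\pi$ and the left side is not positive,
or Jordan's inequality makes the right side at least one. -/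
theorem quarter_le_average_sin_sq {α : ℝ} (h0 : 0 < α) (h1 : α ≤ Real.pi / 2) {N : ℕ}
    (hN : 1 ≤ N * Real.sin α) :
    (N : ℝ) / 4 ≤ ∑ j ∈ Finset.range N, Real.sin ((2 * j + 1) * α) ^ 2 := by
  have hpi := Real.pi_pos
  rcases eq_or_lt_of_le h1 with rfl | h1
  · have : ∀ j : ℕ, Real.sin ((2 * j + 1) * (Real.pi / 2)) ^ 2 = 1 := by
      intro j
      rw [show (2 * (j : ℝ) + 1) * (Real.pi / 2) = j * Real.pi + Real.pi / 2 by ring,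
        Real.sin_add_pi_div_two, Real.cos_nat_mul_pi, ← pow_mul, mul_comm, pow_mul]
      simp
    simp_rw [this]
    simp
    have : (0 : ℝ) ≤ N := Nat.cast_nonneg N
    linarith
  · have hs : 0 < Real.sin (2 * α) := Real.sin_pos_of_pos_of_lt_pi (by linarith) (by linarith)
    have key : Real.sin (4 * N * α) ≤ N * Real.sin (2 * α) := by
      rcases le_or_gt α (Real.pi / 4) with h | h
      · have hc : 1 / 2 ≤ Real.cos α := by
          rw [← Real.cos_pi_div_three]
          exact Real.cos_le_cos_of_nonneg_of_le_pi h0.le (by linarith) (by linarith)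
        have hsin : 0 < Real.sin α := Real.sin_pos_of_pos_of_lt_pi h0 (by linarith)
        refine (Real.sin_le_one _).trans (hN.trans ?_)
        rw [Real.sin_two_mul]
        refine mul_le_mul_of_nonneg_left ?_ (Nat.cast_nonneg N)
        nlinarith
      · set β := Real.pi / 2 - α with hβ
        have hβ0 : 0 < β := by linarith
        have e1 : Real.sin (2 * α) = Real.sin (2 * β) := by
          rw [show 2 * α = Real.pi - 2 * β by rw [hβ]; ring, Real.sin_pi_sub]
        have e2 : Real.sin (4 * N * α) = -Real.sin (4 * N * β) := by
          rw [show 4 * (N : ℝ) * α = -(4 * N * β) + N * (2 * Real.pi) by rw [hβ]; ring,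
            Real.sin_add_nat_mul_two_pi, Real.sin_neg]
        have h2 : 2 / Real.pi * (2 * β) ≤ Real.sin (2 * β) :=
          Real.mul_le_sin (by linarith) (by linarith)
        rw [e2, e1]
        rcases le_or_gt (4 * N * β) Real.pi with h3 | h3
        · have h4 : 0 ≤ Real.sin (4 * N * β) := Real.sin_nonneg_of_nonneg_of_le_pi (by positivity) h3
          have : 0 ≤ (N : ℝ) * Real.sin (2 * β) := mul_nonneg (Nat.cast_nonneg N) (e1 ▸ hs.le)
          linarith
        · have h4 : (N : ℝ) * (2 / Real.pi * (2 * β)) ≤ N * Real.sin (2 * β) :=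
            mul_le_mul_of_nonneg_left h2 (Nat.cast_nonneg N)
          have h5 : 1 ≤ (N : ℝ) * (2 / Real.pi * (2 * β)) := by
            rw [show (N : ℝ) * (2 / Real.pi * (2 * β)) = 4 * N * β / Real.pi by ring,
              le_div_iff₀ hpi]
            linarith
          linarith [Real.neg_one_le_sin (4 * N * β)]
    have h2 := sum_sin_sq_odd α N
    by_contra hlt
    rw [not_le] at hlt
    have := mul_lt_mul_of_pos_left hlt (by positivity : 0 < 4 * Real.sin (2 * α))
    linarith

/-! ### Amplitude-amplified state preparation -/

namespace Run

/-- If $\sin\alpha$ is the norm of the good component, $j$ rounds succeed with probability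
$\sin^2((2j+1)\alpha)$. The averaging bound applies to the $M+1$ values of $j$, and the cost is
bounded by that of $j=M$. -/
theorem isAttempt_amplifiedAttempt {k : ℕ} {ps : List (Reg k →L[ℂ] Reg k)}
    (hps : ∀ p ∈ ps, IsStarProjection p) {G : Reg k → Prop}
    (hG : ∀ c : ℂ, c ≠ 0 → G (unit (c • ps.reverse.prod (plusState k)))) {M : ℕ}
    (hM : 1 ≤ M * ‖ps.reverse.prod (plusState k)‖) :
    IsAttempt (amplifiedAttempt ps M) G ((2 * M + 1) * ps.length + 2 * M + 1) (1 / 4) := by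
  intro h B X Y hB hXY hX hY
  set v := ps.reverse.prod (plusState k) with hv
  have hv1 : ‖v‖ ≤ 1 := norm_plusState k ▸ norm_reverse_prod_le hps _
  have hv0 : 0 < ‖v‖ := by
    rcases eq_or_lt_of_le (norm_nonneg v) with h0 | h0
    · rw [← h0] at hM; simp at hM; linarith
    · exact h0
  set α := Real.arcsin ‖v‖ with hα
  have hsin : Real.sin α = ‖v‖ := Real.sin_arcsin (by linarith) hv1
  have hα0 : 0 < α := Real.arcsin_pos.2 hv0
  have hα1 : α ≤ Real.pi / 2 := Real.arcsin_le_pi_div_two _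
  set W : ℕ → ℝ := fun j => Real.sin ((2 * j + 1) * α) ^ 2 with hW
  have hround : ∀ j : Fin (M + 1), (loss
      (let Φ := (groverOp ps)^[(j : ℕ)] (coherent ps (extInit k ps.length))
      let good := slice Φ fun _ => false
      Run.bind (Run.spend ((2 * (j : ℕ) + 1) * ps.length + 2 * (j : ℕ) + 1)) fun _ =>
        Run.bind (Run.sample (born fun b : Bool =>
          if b then ‖good‖₊ ^ 2 else ∑ z, if z.2 = (fun _ => false) then 0 else ‖Φ z‖₊ ^ 2))
          fun b => Run.ret (if b then some (unit good) else none)) h B) ≤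
      ENNReal.ofReal (W j) * X + ENNReal.ofReal (1 - W j) * Y := by
    intro j
    obtain ⟨x, y, hxy, hx, hy⟩ := groverOp_iterate hps hsin (j : ℕ)
    set Φ₀ := coherent ps (extInit k ps.length) with hΦ₀
    set Φ := (groverOp ps)^[(j : ℕ)] Φ₀ with hΦ
    have hslice : slice Φ (fun _ => false) = (x : ℂ) • v := by
      have h2 : ∀ a, slice Φ a = (x : ℂ) • slice (goodPart Φ₀) a +
          (y : ℂ) • (slice Φ₀ a - slice (goodPart Φ₀) a) := by
        rw [hxy]; intro a; rfl
      rw [h2, slice_goodPart, if_pos rfl, sub_self, smul_zero, add_zero, slice_coherent_extInit]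
    have hgood : ‖slice Φ (fun _ => false)‖ ^ 2 = W j := by
      rw [hslice, norm_smul, Complex.norm_real, Real.norm_eq_abs, mul_pow, sq_abs, hW]
      simp only
      rw [← hx, hsin, mul_pow]
    have hgn : ‖Φ₀ - goodPart Φ₀‖ ^ 2 = Real.cos α ^ 2 := by
      have hg : RCLike.re (inner ℂ Φ₀ (goodPart Φ₀)) = ‖goodPart Φ₀‖ ^ 2 := by
        rw [← goodPart_goodPart, ← inner_goodPart_left, inner_self_eq_norm_sq, goodPart_goodPart]
      rw [@norm_sub_sq ℂ, hg, norm_coherent_extInit hps, norm_goodPart, slice_coherent_extInit,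
        ← hv, ← hsin]
      linarith [Real.sin_sq_add_cos_sq α]
    have hbad : (∑ z : (Fin k → Bool) × (Fin ps.length → Bool),
        if z.2 = (fun _ => false) then (0 : ℝ) else ‖Φ z‖ ^ 2) = 1 - W j := by
      have h2 : ∀ z : (Fin k → Bool) × (Fin ps.length → Bool),
          (if z.2 = (fun _ => false) then (0 : ℝ) else ‖Φ z‖ ^ 2) =
          y ^ 2 * ‖(Φ₀ - goodPart Φ₀) z‖ ^ 2 := by
        intro z
        have h3 : Φ z = (x : ℂ) • goodPart Φ₀ z + (y : ℂ) • (Φ₀ z - goodPart Φ₀ z) := by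
          rw [hxy]; rfl
        have h4 : (Φ₀ - goodPart Φ₀) z = Φ₀ z - goodPart Φ₀ z := rfl
        have h5 : goodPart Φ₀ z = if z.2 = (fun _ => false) then Φ₀ z else 0 := rfl
        rw [h4, h3, h5]
        split_ifs
        · simp
        · simp [mul_pow]
      simp_rw [h2]
      rw [← Finset.mul_sum, ← EuclideanSpace.norm_sq_eq, hgn, ← mul_pow, hy, hW]
      simp only
      linarith [Real.sin_sq_add_cos_sq ((2 * (j : ℝ) + 1) * α)]
    have hw : ∑ b : Bool, (if b then ‖slice Φ (fun _ => false)‖₊ ^ 2 else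
        ∑ z, if z.2 = (fun _ => false) then 0 else ‖Φ z‖₊ ^ 2) = 1 := by
      rw [Fintype.sum_bool]
      simp only [if_true, Bool.false_eq_true, if_false]
      apply NNReal.eq
      push_cast [apply_ite NNReal.toReal]
      rw [hgood, hbad]
      ring
    have hcost : (2 * (j : ℕ) + 1) * ps.length + 2 * (j : ℕ) + 1 ≤
        (2 * M + 1) * ps.length + 2 * M + 1 := by
      have := Nat.lt_succ_iff.1 j.2
      gcongr
    simp only
    rw [loss_bind, loss_spend, if_pos (hcost.trans hB), loss_bind, loss_sample, tsum_fintype,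
      Fintype.sum_bool, born_apply hw, born_apply hw]
    simp only [loss_ret, if_true, Bool.false_eq_true, if_false]
    refine add_le_add ?_ ?_
    · rw [← hgood, ENNReal.ofReal_pow (norm_nonneg _), ofReal_norm]
      -- A vanishing good component has no normalized state, but then success has probability zero.
      -- A negative amplitude is the reason why `hG` is needed for scalar multiples.
      by_cases hx0 : x = 0
      · simp [hslice, hx0]
      · rw [enorm, ENNReal.coe_pow]
        refine mul_le_mul_right (hX _ _ ?_ (by omega)) _
        rw [hslice]
        exact hG _ (by exact_mod_cast hx0)
    · rw [← hbad]
      refine mul_le_mul' (le_of_eq ?_) (hY _ (by omega) (by omega))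
      rw [ENNReal.ofReal_sum_of_nonneg]
      · push_cast
        refine Finset.sum_congr rfl fun z _ => ?_
        split_ifs
        · simp
        · rw [ENNReal.ofReal_pow (norm_nonneg _), ofReal_norm]; rfl
      · intro z _
        split_ifs <;> positivity
  rw [amplifiedAttempt, loss_bind, loss_sample, tsum_fintype]
  have hW0 : ∀ j, 0 ≤ W j := fun j => sq_nonneg _
  have hW1 : ∀ j, 0 ≤ 1 - W j := fun j => by
    have := Real.sin_sq_le_one ((2 * (j : ℝ) + 1) * α)
    simp only [hW]; linarith
  set A := ((M + 1 : ℕ) : ℝ)⁻¹ * ∑ j : Fin (M + 1), W j with hA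
  have hM1 : (0 : ℝ) < ((M + 1 : ℕ) : ℝ) := by positivity
  have hA4 : 1 / 4 ≤ A := by
    have := quarter_le_average_sin_sq hα0 hα1 (N := M + 1)
      (by rw [hsin]; push_cast; nlinarith)
    rw [hA, Fin.sum_univ_eq_sum_range W (M + 1), le_inv_mul_iff₀ hM1]
    linarith
  have hA1 : 1 - A = ((M + 1 : ℕ) : ℝ)⁻¹ * ∑ j : Fin (M + 1), (1 - W j) := by
    rw [Finset.sum_sub_distrib, hA]
    simp
    field_simp
  have hA1' : A ≤ 1 := by
    have : 0 ≤ ((M + 1 : ℕ) : ℝ)⁻¹ * ∑ j : Fin (M + 1), (1 - W j) :=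
      mul_nonneg (by positivity) (Finset.sum_nonneg fun j _ => hW1 j)
    linarith
  refine le_trans ?_ (mix_le_mix (by norm_num) hA4 hA1' hXY)
  have hinv : ENNReal.ofReal (((M + 1 : ℕ) : ℝ)⁻¹) = ((M + 1 : ℕ) : ℝ≥0∞)⁻¹ := by
    rw [ENNReal.ofReal_inv_of_pos hM1, ENNReal.ofReal_natCast]
  have hs0 : ENNReal.ofReal (∑ j : Fin (M + 1), W j) = ∑ j : Fin (M + 1), ENNReal.ofReal (W j) :=
    ENNReal.ofReal_sum_of_nonneg fun j _ => hW0 j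
  have hs1 : ENNReal.ofReal (∑ j : Fin (M + 1), (1 - W j)) =
      ∑ j : Fin (M + 1), ENNReal.ofReal (1 - W j) :=
    ENNReal.ofReal_sum_of_nonneg fun j _ => hW1 j
  rw [hA1, hA, ENNReal.ofReal_mul (by positivity), ENNReal.ofReal_mul (by positivity), hs0, hs1, hinv, mul_assoc, mul_assoc, ← mul_add, Finset.sum_mul, Finset.sum_mul,
    ← Finset.sum_add_distrib, Finset.mul_sum]
  refine Finset.sum_le_sum fun j _ => ?_
  rw [PMF.uniformOfFintype_apply, Fintype.card_fin]
  exact mul_le_mul_right (hround j) _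

end Run

/-! ### Accuracy of the prepared state -/

theorem bitWeight_smul {k : ℕ} (i : Fin k) (b : Bool) (c : ℂ) (w : Reg k) :
    bitWeight i b (c • w) = ‖c‖ ^ 2 * bitWeight i b w := by
  simp only [bitWeight, Finset.mul_sum]
  refine Finset.sum_congr rfl fun x _ => ?_
  split_ifs
  · simp [mul_pow]
  · simp

theorem bitWeight_nonneg {k : ℕ} (i : Fin k) (b : Bool) (w : Reg k) : 0 ≤ bitWeight i b w :=
  Finset.sum_nonneg fun x _ => by split_ifs <;> positivity

theorem sqrt_bitWeight_add_le {k : ℕ} (i : Fin k) (b : Bool) (v w : Reg k) :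
    √(bitWeight i b (v + w)) ≤ √(bitWeight i b v) + √(bitWeight i b w) := by
  let N : Reg k → Reg k := fun w => WithLp.toLp 2 fun x => if x i = b then w x else 0
  have hN : ∀ w, √(bitWeight i b w) = ‖N w‖ := by
    intro w
    rw [EuclideanSpace.norm_eq, bitWeight]
    congr 1
    refine Finset.sum_congr rfl fun x _ => ?_
    simp only [N]
    split_ifs <;> simp
  have hadd : N (v + w) = N v + N w := by
    ext x
    simp only [N, PiLp.add_apply]
    split_ifs <;> simp
  rw [hN, hN, hN, hadd]
  exact norm_add_le _ _

theorem bitWeight_le_norm_sq {k : ℕ} (i : Fin k) (b : Bool) (w : Reg k) :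
    bitWeight i b w ≤ ‖w‖ ^ 2 := by
  rw [← bitWeight_add i b w]
  linarith [bitWeight_nonneg i (!b) w]

/-- A unit vector for which each bit on which all solutions agree has a wrong readout with at most
the probability for the ground space, up to `2 ε`. -/
def IsAccurate {k : ℕ} (θ ε : ℝ) (φ : CNF k) (ψ : Reg k) : Prop :=
  ‖ψ‖ = 1 ∧ ∀ i b, (∀ x, φ.Sat x → x i = b) →
    bitWeight i (!b) ψ ≤ (1 - Real.sin θ) / 2 + 2 * ε

/-- The square root of the weight of an outcome is a seminorm bounded by the norm, so the triangle
inequality compares $v$ with its ground state approximation $w$. Normalizing only helps, as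
$\|w\|\le\|v\|$. -/
theorem isAccurate_unit {k : ℕ} {θ ε : ℝ} (hθ : 0 < Real.sin θ) (hε : 0 ≤ ε) (hε1 : ε ≤ 1 / 2)
    {φ : CNF k} {v w : Reg k} (hw : hamiltonian θ φ w = 0) (hv : v ≠ 0) (hwv : ‖w‖ ≤ ‖v‖)
    (hvw : ‖v - w‖ ≤ ε * ‖w‖) {c : ℂ} (hc : c ≠ 0) : IsAccurate θ ε φ (unit (c • v)) := by
  refine ⟨norm_unit (smul_ne_zero hc hv), fun i b hb => ?_⟩
  have hvn : 0 < ‖v‖ := norm_pos_iff.2 hv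
  have hcn : 0 < ‖c‖ := norm_pos_iff.2 hc
  have h1 : bitWeight i (!b) (unit (c • v)) = bitWeight i (!b) v / ‖v‖ ^ 2 := by
    rw [unit, bitWeight_smul, bitWeight_smul, norm_smul, Complex.norm_real, norm_inv, norm_mul,
      norm_norm, norm_norm]
    field_simp
  rw [h1, div_le_iff₀ (by positivity)]
  have h2 := sqrt_bitWeight_add_le i (!b) w (v - w)
  rw [add_sub_cancel] at h2
  have h3 : √(bitWeight i (!b) (v - w)) ≤ ε * ‖w‖ := by
    refine le_trans ?_ hvw
    rw [Real.sqrt_le_left (norm_nonneg _)]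
    exact bitWeight_le_norm_sq _ _ _
  have h4 := bitWeight_ground hθ.ne' hb hw
  set a := √(bitWeight i (!b) w) with ha
  have ha0 : 0 ≤ a := Real.sqrt_nonneg _
  have ha2 : a ^ 2 = (1 - Real.sin θ) / 2 * ‖w‖ ^ 2 := by
    rw [ha, Real.sq_sqrt (bitWeight_nonneg _ _ _), h4]
  have hW := norm_nonneg w
  have h5 : a ≤ 3 / 4 * ‖w‖ := by
    refine le_of_sq_le_sq ?_ (by positivity)
    rw [ha2]
    nlinarith [sq_nonneg ‖w‖]
  have h6 : bitWeight i (!b) v ≤ (a + ε * ‖w‖) ^ 2 := by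
    rw [← Real.sq_sqrt (bitWeight_nonneg i (!b) v)]
    exact pow_le_pow_left₀ (Real.sqrt_nonneg _) (by linarith) 2
  have h7 : (a + ε * ‖w‖) ^ 2 ≤ ((1 - Real.sin θ) / 2 + 2 * ε) * ‖w‖ ^ 2 := by
    have e1 : (a + ε * ‖w‖) ^ 2 = a ^ 2 + (ε * ‖w‖) * (2 * a + ε * ‖w‖) := by ring
    -- The constant $2$ in the tolerance: $a\le\frac34\|w\|$ and $\epsilon\le\frac12$ give
    -- $2a+\epsilon\|w\|\le2\|w\|$.
    have e2 : (ε * ‖w‖) * (2 * a + ε * ‖w‖) ≤ (ε * ‖w‖) * (2 * ‖w‖) := by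
      refine mul_le_mul_of_nonneg_left ?_ (by positivity)
      nlinarith
    rw [e1, ha2]
    nlinarith
  have h8 : ‖w‖ ^ 2 ≤ ‖v‖ ^ 2 := pow_le_pow_left₀ hW hwv 2
  have h9 : 0 ≤ (1 - Real.sin θ) / 2 + 2 * ε := by linarith [Real.sin_le_one θ]
  exact h6.trans (h7.trans (mul_le_mul_of_nonneg_left h8 h9))

theorem reverse_prod_flatten_replicate {M : Type*} [Monoid M] (l : List M) (r : ℕ) :
    (List.replicate r l).flatten.reverse.prod = l.reverse.prod ^ r := by
  induction r with
  | zero => simp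
  | succ r ih =>
    rw [List.replicate_succ, List.flatten_cons, List.reverse_append, List.prod_append, ih, pow_succ]

theorem groundProj_cycleOp_pow {k : ℕ} (θ : ℝ) (L : List (Fin k → Bool)) (φ : CNF k) (r : ℕ)
    (w : Reg k) : groundProj θ φ ((cycleOp θ L φ ^ r) w) = groundProj θ φ w := by
  have h : groundProj θ φ * cycleOp θ L φ ^ r = groundProj θ φ := by
    induction r with
    | zero => simp
    | succ r ih => rw [pow_succ', ← mul_assoc, groundProj_mul_cycleOp, ih]
  exact congrArg (fun f : Reg k →L[ℂ] Reg k => f w) h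

/-! ### Number of cycles, growth factors and the cost of a state preparation. -/

section NumCycles

variable {k : ℕ} {θ μ ε : ℝ}

theorem one_le_numCycles (hc : 0 < Real.cos (θ / 2)) (hμ : 0 < μ) (hμ1 : μ < 1) (hε : 0 < ε)
    (hε1 : ε < 1) : 1 ≤ numCycles k θ μ ε := by
  have hck : Real.cos (θ / 2) ^ k ≤ 1 := pow_le_one₀ hc.le (Real.cos_le_one _)
  have hck0 : 0 < Real.cos (θ / 2) ^ k := pow_pos hc k
  refine Nat.ceil_pos.2 (div_pos (Real.log_pos ?_) (Real.log_pos (one_lt_inv₀ hμ |>.2 hμ1)))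
  exact (one_lt_inv₀ (by positivity)).2 (by nlinarith)

theorem pow_numCycles_le (hc : 0 < Real.cos (θ / 2)) (hμ : 0 < μ) (hμ1 : μ < 1) (hε : 0 < ε) :
    μ ^ numCycles k θ μ ε ≤ ε * Real.cos (θ / 2) ^ k := by
  have hck0 : 0 < Real.cos (θ / 2) ^ k := pow_pos hc k
  have h1 := Nat.le_ceil (Real.log (ε * Real.cos (θ / 2) ^ k)⁻¹ / Real.log μ⁻¹)
  rw [div_le_iff₀ (Real.log_pos ((one_lt_inv₀ hμ).2 hμ1)), Real.log_inv, Real.log_inv] at h1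
  rw [← Real.log_le_log_iff (by positivity) (by positivity), Real.log_pow]
  unfold numCycles
  rw [Real.log_inv, Real.log_inv] at *
  linarith

end NumCycles

/-- The growth factor, per qubit, of the expected number of attempts or rounds. -/
noncomputable def growth (v : Version) (θ : ℝ) : ℝ :=
  match v with
  | .default => (Real.cos (θ / 2))⁻¹ ^ 2
  | .amplified => (Real.cos (θ / 2))⁻¹

theorem cos_half_sq (θ : ℝ) : Real.cos (θ / 2) ^ 2 = (1 + Real.cos θ) / 2 := by
  have := Real.cos_two_mul (θ / 2)
  rw [mul_div_cancel₀ θ two_ne_zero] at this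
  linarith

theorem inv_cos_half_sq (θ : ℝ) : 2 / (1 + Real.cos θ) = (Real.cos (θ / 2))⁻¹ ^ 2 := by
  rw [inv_pow, cos_half_sq, inv_div]

theorem rpow_half_eq {θ : ℝ} (hc : 0 < Real.cos (θ / 2)) (k : ℕ) :
    (2 / (1 + Real.cos θ)) ^ ((k : ℝ) / 2) = (Real.cos (θ / 2))⁻¹ ^ k := by
  have h0 : 0 ≤ (Real.cos (θ / 2))⁻¹ := (inv_pos.2 hc).le
  rw [inv_cos_half_sq, ← Real.rpow_natCast, ← Real.rpow_mul h0, ← Real.rpow_natCast]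
  congr 1
  push_cast
  ring

theorem rpow_eq_growth_pow {θ : ℝ} (hc : 0 < Real.cos (θ / 2)) (v : Version) (k : ℕ) :
    (2 / (1 + Real.cos θ)) ^ ((k : ℝ) / (v.q : ℝ)) = growth v θ ^ k := by
  cases v
  · simp only [Version.q, Nat.cast_one, div_one, growth, Real.rpow_natCast, inv_cos_half_sq]
  · simp only [Version.q, growth, Nat.cast_ofNat, rpow_half_eq hc]

theorem one_le_growth {θ : ℝ} (hc : 0 < Real.cos (θ / 2)) (v : Version) : 1 ≤ growth v θ := by
  have h : 1 ≤ (Real.cos (θ / 2))⁻¹ := (one_le_inv₀ hc).2 (Real.cos_le_one _)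
  cases v
  · exact one_le_pow₀ h
  · exact h

theorem inv_growth_le {θ : ℝ} (hc : 0 < Real.cos (θ / 2)) (v : Version) :
    (growth v θ)⁻¹ ≤ Real.cos (θ / 2) := by
  cases v
  · simp only [growth, inv_pow, inv_inv]
    nlinarith [Real.cos_le_one (θ / 2)]
  · simp [growth]

/-- The state preparation yields accurate states, and its cost is controlled. -/
theorem hasCost_prepare (v : Version) {k : ℕ} {θ μ ε s T : ℝ} {L : List (Fin k → Bool)} {φ : CNF k}
    (hL : L ≠ []) (hφ : ∃ x, φ.Sat x) (hsin : 0 < Real.sin θ) (hc : 0 < Real.cos (θ / 2))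
    (hμ : 0 < μ) (hμ1 : μ < 1) (hε : 0 < ε) (hε1 : ε ≤ 1 / 2) (hrate : IsRate θ μ L φ)
    (hT : 40 * (numCycles k θ μ ε * L.length) * growth v θ ^ k ≤ T) (hs : 0 ≤ s)
    (hsT : s * T ≤ 1 / 2) :
    Run.HasCost (prepare v θ μ ε L φ) (IsAccurate θ ε φ) s (2 * (s * T)) := by
  set r := numCycles k θ μ ε with hr
  set ps := (List.replicate r (cycleChecks θ L φ)).flatten with hps
  set u := (cycleOp θ L φ ^ r) (plusState k) with hu
  set w := groundProj θ φ (plusState k) with hw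
  have hr1 : 1 ≤ r := one_le_numCycles hc hμ hμ1 hε (by linarith)
  have hprod : ps.reverse.prod (plusState k) = u := by
    rw [hps, reverse_prod_flatten_replicate]; rfl
  have hstar : ∀ p ∈ ps, IsStarProjection p := by
    intro p hp
    simp only [hps, List.mem_flatten, List.mem_replicate] at hp
    obtain ⟨l, ⟨_, rfl⟩, hp⟩ := hp
    exact isStarProjection_of_mem_cycleChecks θ L φ p hp
  have hlen : ps.length = r * L.length := by
    simp [hps, length_cycleChecks]
  have hck : Real.cos (θ / 2) ^ k ≤ ‖w‖ := le_norm_groundProj_plusState hc.le hφ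
  have hck0 : 0 < Real.cos (θ / 2) ^ k := pow_pos hc k
  -- The checks leave the ground component of the initial state unchanged, so $w$ is also the
  -- projection of the final vector $u$.
  have hwu : ‖w‖ ≤ ‖u‖ := by
    rw [hw, ← groundProj_cycleOp_pow θ L φ r]
    exact norm_starProjection_le (isStarProjection_groundProj θ φ) _
  -- The factor $\cos^k(\theta/2)$ in the number of cycles turns the absolute error into one
  -- relative to $\|w\|$.
  have hdist : ‖u - w‖ ≤ ε * ‖w‖ := by
    have h1 := hrate r hr1 (plusState k)
    rw [norm_plusState, mul_one] at h1
    have h2 := pow_numCycles_le (k := k) hc hμ hμ1 hε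
    have h3 : ε * Real.cos (θ / 2) ^ k ≤ ε * ‖w‖ := mul_le_mul_of_nonneg_left hck hε.le
    exact h1.trans (h2.trans h3)
  have hu0 : u ≠ 0 := norm_pos_iff.1 (hck0.trans_le (hck.trans hwu))
  have hG : ∀ c : ℂ, c ≠ 0 → IsAccurate θ ε φ (unit (c • ps.reverse.prod (plusState k))) := by
    intro c hc0
    rw [hprod]
    exact isAccurate_unit hsin hε.le hε1 (hamiltonian_groundProj θ φ _) hu0 hwu hdist hc0
  have hL1 : 1 ≤ L.length := List.length_pos_iff.2 hL
  have hlen1 : (1 : ℝ) ≤ ps.length := by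
    rw [hlen]
    exact_mod_cast Nat.mul_pos hr1 hL1
  have hlenT : 40 * (ps.length : ℝ) * growth v θ ^ k ≤ T := by
    rw [hlen]; push_cast; exact hT
  have hinv : Real.cos (θ / 2) ^ k * (Real.cos (θ / 2))⁻¹ ^ k = 1 := by
    rw [← mul_pow, mul_inv_cancel₀ hc.ne', one_pow]
  cases v with
  | default =>
    have hP : (Real.cos (θ / 2) ^ k) ^ 2 ≤ ‖ps.reverse.prod (plusState k)‖ ^ 2 := by
      rw [hprod]
      exact pow_le_pow_left₀ hck0.le (hck.trans hwu) 2
    refine (Run.isAttempt_attempt hstar (norm_plusState k) hG (by positivity) hP).hasCost_retry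
      (by positivity) (pow_le_one₀ hck0.le (pow_le_one₀ hc.le (Real.cos_le_one _))) ?_ hs hsT
    refine le_trans ?_ (mul_le_mul_of_nonneg_left hlenT (by positivity))
    have h1 : growth .default θ ^ k = ((Real.cos (θ / 2))⁻¹ ^ k) ^ 2 := by
      rw [growth, ← pow_mul, ← pow_mul, mul_comm]
    rw [h1, show (Real.cos (θ / 2) ^ k) ^ 2 * (40 * (ps.length : ℝ) *
      ((Real.cos (θ / 2))⁻¹ ^ k) ^ 2) = 40 * ps.length *
      (Real.cos (θ / 2) ^ k * (Real.cos (θ / 2))⁻¹ ^ k) ^ 2 by ring, hinv]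
    linarith
  | amplified =>
    set M := ⌈(2 / (1 + Real.cos θ)) ^ ((k : ℝ) / 2)⌉₊ with hM
    set x := (Real.cos (θ / 2))⁻¹ ^ k with hx
    have hx1 : 1 ≤ x := one_le_pow₀ ((one_le_inv₀ hc).2 (Real.cos_le_one _))
    have hMx : x ≤ M := by
      rw [hM, rpow_half_eq hc]; exact Nat.le_ceil _
    have hMx' : (M : ℝ) ≤ x + 1 := by
      rw [hM, rpow_half_eq hc]; exact (Nat.ceil_lt_add_one (by linarith)).le
    have hM1 : 1 ≤ M * ‖ps.reverse.prod (plusState k)‖ := by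
      rw [hprod]
      calc (1 : ℝ) = x * Real.cos (θ / 2) ^ k := by rw [mul_comm, hinv]
        _ ≤ M * ‖u‖ := mul_le_mul hMx (hck.trans hwu) hck0.le (Nat.cast_nonneg M)
    refine (Run.isAttempt_amplifiedAttempt hstar hG hM1).hasCost_retry
      (by norm_num) (by norm_num) ?_ hs hsT
    -- The constant $40$: with $M\le x+1$, $x\ge1$ and at least one check, an attempt costs at most
    -- $10x$ times the number of checks, and it succeeds with probability at least $1/4$.
    have h1 : 10 * (ps.length : ℝ) * x ≤ 1 / 4 * T := by
      have : 40 * (ps.length : ℝ) * x ≤ T := hlenT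
      linarith
    refine le_trans ?_ h1
    push_cast
    nlinarith

/-! ### Majority votes -/

/-- The exponential weight of an outcome `c`, if `b` is expected. -/
noncomputable def voteWeight (l : ℝ) (b c : Bool) : ℝ≥0∞ := eexp (-(l * (boolSign b * boolSign c)))

theorem prod_voteWeight {α : Type} (l : ℝ) (b : Bool) (f : α → Bool) (xs : List α) :
    (xs.map fun x => voteWeight l b (f x)).prod =
      eexp (-(l * (boolSign b * (xs.map fun x => boolSign (f x)).sum))) := by
  induction xs with
  | nil => simp [eexp]
  | cons x xs ih =>
    rw [List.map_cons, List.prod_cons, ih, voteWeight, ← eexp_add, List.map_cons, List.sum_cons]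
    congr 1
    ring

/-- The exponential Markov inequality: a lost or tied vote has weight at least one, so its
probability is bounded by the expected weight. -/
theorem one_le_prod_voteWeight {α : Type} {l : ℝ} (hl : 0 ≤ l) {b : Bool} {f : α → Bool}
    {xs : List α} (h : boolSign b * (xs.map fun x => boolSign (f x)).sum ≤ 0) :
    1 ≤ (xs.map fun x => voteWeight l b (f x)).prod := by
  rw [prod_voteWeight]
  exact one_le_eexp (by nlinarith)

/-- The optimal exponent for outcomes with bias `t`. -/
noncomputable def voteExponent (t : ℝ) : ℝ := Real.log (√(1 + t) / √(1 - t))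

theorem voteExponent_nonneg {t : ℝ} (h0 : 0 ≤ t) (h1 : t < 1) : 0 ≤ voteExponent t := by
  refine Real.log_nonneg ?_
  rw [one_le_div (Real.sqrt_pos.2 (by linarith))]
  exact Real.sqrt_le_sqrt (by linarith)

/-- The expected weight increases with the error probability, and at $(1-t)/2$ the chosen exponent
balances both terms to $\frac12\sqrt{(1+t)(1-t)}$. -/
theorem vote_expectation_le {t a : ℝ} (h0 : 0 ≤ t) (h1 : t < 1) (ha : a ≤ (1 - t) / 2) :
    (1 - a) * Real.exp (-voteExponent t) + a * Real.exp (voteExponent t) ≤ √(1 - t ^ 2) := by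
  have hu : 0 < √(1 + t) := Real.sqrt_pos.2 (by linarith)
  have hl : 0 < √(1 - t) := Real.sqrt_pos.2 (by linarith)
  have hexp := voteExponent_nonneg h0 h1
  have h2 : (1 - a) * Real.exp (-voteExponent t) + a * Real.exp (voteExponent t) ≤
      (1 - (1 - t) / 2) * Real.exp (-voteExponent t) + (1 - t) / 2 * Real.exp (voteExponent t) := by
    have : Real.exp (-voteExponent t) ≤ Real.exp (voteExponent t) :=
      Real.exp_le_exp.2 (by linarith)
    nlinarith
  refine h2.trans (le_of_eq ?_)
  rw [Real.exp_neg, voteExponent, Real.exp_log (by positivity),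
    show 1 - t ^ 2 = (1 + t) * (1 - t) by ring, Real.sqrt_mul (by linarith), inv_div]
  have e1 : √(1 + t) ^ 2 = 1 + t := Real.sq_sqrt (by linarith)
  have e2 : √(1 - t) ^ 2 = 1 - t := Real.sq_sqrt (by linarith)
  field_simp
  rw [e1, e2]
  ring

theorem ofReal_add_voteWeight_le {t a a' : ℝ} (h0 : 0 ≤ t) (h1 : t < 1) (ha0 : 0 ≤ a)
    (haa' : a + a' = 1) (ha'0 : 0 ≤ a') (ha : a ≤ (1 - t) / 2) (b : Bool) :
    ENNReal.ofReal a' * voteWeight (voteExponent t) b b +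
      ENNReal.ofReal a * voteWeight (voteExponent t) b (!b) ≤ ENNReal.ofReal √(1 - t ^ 2) := by
  have hb : boolSign b * boolSign b = 1 := by cases b <;> simp [boolSign]
  have hb' : boolSign b * boolSign (!b) = -1 := by cases b <;> simp [boolSign]
  rw [voteWeight, voteWeight, hb, hb', mul_one, mul_neg_one, neg_neg, eexp, eexp,
    ← ENNReal.ofReal_mul ha'0, ← ENNReal.ofReal_mul ha0,
    ← ENNReal.ofReal_add (mul_nonneg ha'0 (Real.exp_pos _).le)
      (mul_nonneg ha0 (Real.exp_pos _).le)]
  refine ENNReal.ofReal_le_ofReal ?_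
  have := vote_expectation_le h0 h1 ha
  rwa [show 1 - a = a' by linarith] at this

theorem sum_ofReal_voteWeight {k : ℕ} (i : Fin k) (b : Bool) (l : ℝ) (ψ : Reg k) :
    ∑ x, ENNReal.ofReal (‖ψ x‖ ^ 2) * voteWeight l b (x i) =
      ENNReal.ofReal (bitWeight i b ψ) * voteWeight l b b +
      ENNReal.ofReal (bitWeight i (!b) ψ) * voteWeight l b (!b) := by
  unfold bitWeight
  rw [ENNReal.ofReal_sum_of_nonneg fun x _ => by split_ifs <;> positivity,
    ENNReal.ofReal_sum_of_nonneg fun x _ => by split_ifs <;> positivity, Finset.sum_mul,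
    Finset.sum_mul, ← Finset.sum_add_distrib]
  refine Finset.sum_congr rfl fun x _ => ?_
  cases b <;> cases h : x i <;> simp

/-- The bias $t=\sin\theta-4\epsilon$ is the one for which $(1-t)/2$ equals the accuracy bound
$(1-\sin\theta)/2+2\epsilon$. -/
theorem readRegister_vote_le {k : ℕ} {θ ε : ℝ} {φ : CNF k} {ψ : Reg k}
    (hψ : IsAccurate θ ε φ ψ) {i : Fin k} {b : Bool} (hb : ∀ x, φ.Sat x → x i = b)
    (h0 : 0 ≤ Real.sin θ - 4 * ε) (h1 : Real.sin θ - 4 * ε < 1) :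
    ∑' x, born (fun x => ‖ψ x‖₊ ^ 2) x * voteWeight (voteExponent (Real.sin θ - 4 * ε)) b (x i) ≤
      ENNReal.ofReal √(1 - (Real.sin θ - 4 * ε) ^ 2) := by
  have hw : ∑ x, ‖ψ x‖₊ ^ 2 = 1 := by
    apply NNReal.eq
    push_cast
    rw [← EuclideanSpace.norm_sq_eq, hψ.1, one_pow]
  have h2 : ∀ x, born (fun x => ‖ψ x‖₊ ^ 2) x = ENNReal.ofReal (‖ψ x‖ ^ 2) := by
    intro x
    rw [born_apply hw, ENNReal.ofReal_pow (norm_nonneg _), ofReal_norm]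
    rfl
  rw [tsum_fintype]
  simp_rw [h2]
  rw [sum_ofReal_voteWeight]
  refine ofReal_add_voteWeight_le h0 h1 (bitWeight_nonneg _ _ _) ?_ (bitWeight_nonneg _ _ _) ?_ b
  · rw [add_comm, bitWeight_add, hψ.1, one_pow]
  · linarith [hψ.2 i b hb]

theorem readQubit_vote_le {k : ℕ} {θ ε : ℝ} {φ : CNF k} {ψ : Reg k}
    (hψ : IsAccurate θ ε φ ψ) {i : Fin k} {b : Bool} (hb : ∀ x, φ.Sat x → x i = b)
    (h0 : 0 ≤ Real.sin θ - 4 * ε) (h1 : Real.sin θ - 4 * ε < 1) :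
    ∑' c, born (fun c : Bool => ∑ x, if x i = c then ‖ψ x‖₊ ^ 2 else 0) c *
      voteWeight (voteExponent (Real.sin θ - 4 * ε)) b c ≤
      ENNReal.ofReal √(1 - (Real.sin θ - 4 * ε) ^ 2) := by
  have hc : ∀ c : Bool, ((∑ x, if x i = c then ‖ψ x‖₊ ^ 2 else 0 : ℝ≥0) : ℝ) =
      bitWeight i c ψ := by
    intro c
    rw [bitWeight]
    push_cast [apply_ite NNReal.toReal]
    rfl
  have hw : ∑ c : Bool, (∑ x, if x i = c then ‖ψ x‖₊ ^ 2 else 0) = 1 := by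
    apply NNReal.eq
    rw [Fintype.sum_bool, NNReal.coe_add, hc, hc]
    have := bitWeight_add i true ψ
    rw [hψ.1] at this
    simpa using this
  have h2 : ∀ c, born (fun c : Bool => ∑ x, if x i = c then ‖ψ x‖₊ ^ 2 else 0) c =
      ENNReal.ofReal (bitWeight i c ψ) := by
    intro c
    rw [born_apply hw, ← hc, ENNReal.ofReal_coe_nnreal]
  rw [tsum_fintype]
  simp_rw [h2]
  rw [Fintype.sum_bool]
  have h3 := ofReal_add_voteWeight_le h0 h1 (bitWeight_nonneg i (!b) ψ) (a' := bitWeight i b ψ)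
    (by rw [add_comm, bitWeight_add, hψ.1, one_pow]) (bitWeight_nonneg _ _ _)
    (by linarith [hψ.2 i b hb]) b
  cases b
  · rw [add_comm]; exact h3
  · exact h3

/-! ### Failure probability of the solvers -/

open Classical in
-- Union bound: a wrong result has a wrong bit $i$, whose vote potential is then at least one. All
-- bits of a copy come from the same measurement, but only the expectation of each potential enters.
theorem loss_solveUnique_le (v : Version) {n : ℕ} {θ μ δ s T : ℝ} {L : List (Fin n → Bool)}
    {φ : CNF n} (hL : L ≠ []) {y : Fin n → Bool} (hy : φ.Sat y) (hu : ∀ x, φ.Sat x → x = y)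
    (hsin : 0 < Real.sin θ) (hc : 0 < Real.cos (θ / 2)) (hμ : 0 < μ) (hμ1 : μ < 1)
    (hrate : IsRate θ μ L φ) {ε : ℝ} (hε : ε = (1 - 1 / √2) ^ 2 / 8 * Real.sin θ ^ 2)
    (hε0 : 0 < ε) (hε1 : ε ≤ 1 / 2) (hb : 0 ≤ Real.sin θ - 4 * ε) (hb1 : Real.sin θ - 4 * ε < 1)
    (hT : 40 * (numCycles n θ μ ε * L.length) * growth v θ ^ n ≤ T) (hs : 0 ≤ s)
    (hT0 : 0 ≤ T) (hsT : s * T ≤ 1 / 2) {R : ℕ}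
    (hR : R = ⌈2 * Real.log (n / δ) / Real.log (2 / (1 + Real.cos θ ^ 2))⌉₊) (B : ℕ) :
    Run.loss (solveUnique v θ μ δ L φ) (fun x _ => if φ.Sat x then 0 else 1) B ≤
      n * ENNReal.ofReal √(1 - (Real.sin θ - 4 * ε) ^ 2) ^ R +
        eexp (R * (2 * (s * T) + s) - s * B) := by
  have hsT0 : 0 ≤ s * T := mul_nonneg hs hT0
  have hpot := ((hasCost_prepare v hL ⟨y, hy⟩ hsin hc hμ hμ1 hε0 hε1 hrate hT hs
    hsT).bind_spend_sample hs (q := fun ψ => born fun x => ‖ψ x‖₊ ^ 2)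
    (g := fun (i : Fin n) x => voteWeight (voteExponent (Real.sin θ - 4 * ε)) (y i) (x i))
    (γ := fun _ => ENNReal.ofReal √(1 - (Real.sin θ - 4 * ε) ^ 2))
    (fun ψ hψ i => readRegister_vote_le hψ (fun x hx => by rw [hu x hx]) hb hb1)).replicate
    (by positivity) R
  have h01 : ∀ (x : Fin n → Bool), (if φ.Sat x then (0 : ℝ≥0∞) else 1) ≤ 1 := fun x => by
    split_ifs <;> simp
  rw [solveUnique, ← hε, ← hR, Run.loss_bind]
  have hneg : ∀ (i : Fin n) (l : List (Fin n → Bool)),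
      (l.map fun x => -boolSign (x i)).sum = -(l.map fun x => boolSign (x i)).sum := by
    intro i l
    induction l with
    | nil => simp
    | cons a l ih => simp only [List.map_cons, List.sum_cons, ih]; ring
  refine (hpot (fun l B' => Run.loss (Run.ret fun i =>
      if 0 < (l.map fun x => -boolSign (x i)).sum then false else true)
      (fun x _ => if φ.Sat x then 0 else 1) B')
    (fun l B' => by rw [Run.loss_ret]; exact h01 _) (fun _ => 1) 1 le_rfl ?_ B).trans
    (le_of_eq (by simp))
  · intro l B'
    rw [Run.loss_ret]
    split_ifs with hsat
    · exact zero_le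
    · refine le_trans ?_ le_self_add
      have hex : ∃ i, (if 0 < (l.map fun x => -boolSign (x i)).sum then false else true) ≠ y i := by
        by_contra hcon
        push Not at hcon
        exact hsat (by rw [funext hcon]; exact hy)
      obtain ⟨i, hi⟩ := hex
      refine le_trans ?_ (Finset.single_le_sum (f := fun i => (1 : ℝ≥0∞) *
        (l.map fun x => voteWeight (voteExponent (Real.sin θ - 4 * ε)) (y i) (x i)).prod)
        (fun _ _ => zero_le) (Finset.mem_univ i))
      rw [one_mul]
      refine one_le_prod_voteWeight (f := fun x : Fin n → Bool => x i)
        (voteExponent_nonneg hb hb1) ?_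
      rw [hneg] at hi
      cases hyi : y i
      · rw [hyi] at hi
        have : ¬ 0 < -(l.map fun x => boolSign (x i)).sum := by
          intro h; rw [if_pos h] at hi; exact hi rfl
        simp only [boolSign, Bool.false_eq_true, if_false] at this ⊢
        linarith
      · rw [hyi] at hi
        have : 0 < -(l.map fun x => boolSign (x i)).sum := by
          by_contra h; rw [if_neg h] at hi; exact hi rfl
        have h1 : boolSign true = 1 := rfl
        rw [h1]
        linarith

theorem sat_cons_iff {k : ℕ} (s : Bool) (φ : CNF (k + 1)) (x : Fin k → Bool) :
    φ.Sat (Fin.cons s x) ↔ (CNF.propagate s φ).Sat x := by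
  constructor
  · intro h c hc
    obtain ⟨d, hd, rfl⟩ := List.mem_map.1 hc
    simp only [List.mem_filter, decide_eq_true_eq] at hd
    obtain ⟨i, hi⟩ := h d hd.1
    induction i using Fin.cases with
    | zero => exact absurd hi hd.2
    | succ i => exact ⟨i, hi⟩
  · intro h c hc
    by_cases h0 : c 0 = some s
    · exact ⟨0, h0⟩
    · obtain ⟨i, hi⟩ := h (fun i => c i.succ) (List.mem_map.2 ⟨c, by simp [hc, h0], rfl⟩)
      exact ⟨i.succ, hi⟩

open Classical in
-- Each stage either keeps the formula satisfiable, and the induction applies, or has lost a vote on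
-- a forced bit, which costs at most $\gamma^r$. The register has $j+1$ qubits when $j$ bits remain
-- afterwards, whence the arguments of `T`.
theorem loss_multipleLoop_le (v : Version) {θ μ s ε : ℝ} (hsin : 0 < Real.sin θ)
    (hc : 0 < Real.cos (θ / 2)) (hμ : 0 < μ) (hμ1 : μ < 1) (hε0 : 0 < ε) (hε1 : ε ≤ 1 / 2)
    (hb : 0 ≤ Real.sin θ - 4 * ε) (hb1 : Real.sin θ - 4 * ε < 1) (hs : 0 ≤ s) {r : ℕ} (hr : 0 < r)
    {T : ℕ → ℝ} (hT0 : ∀ k, 0 ≤ T k) {n ℓ : ℕ} (hℓ : 0 < ℓ)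
    (hT : ∀ k ≤ n, 40 * (numCycles k θ μ ε * ℓ) * growth v θ ^ k ≤ T k)
    (hsT : ∀ k ≤ n, s * T k ≤ 1 / 2) (k : ℕ) (hk : k ≤ n) (L : List (Fin k → Bool)) (φ : CNF k)
    (hL : L.length = ℓ) (hφ : ∃ x, φ.Sat x) (hrate : IsUniformRate θ μ k L φ) (B : ℕ) :
    Run.loss (multipleLoop v θ μ ε r k L φ) (fun x _ => if φ.Sat x then 0 else 1) B ≤
      k * ENNReal.ofReal √(1 - (Real.sin θ - 4 * ε) ^ 2) ^ r +
        eexp (∑ j ∈ Finset.range k, r * (2 * (s * T (j + 1)) + s) - s * B) := by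
  induction k generalizing B with
  | zero =>
    obtain ⟨x, hx⟩ := hφ
    rw [multipleLoop, Run.loss_ret, if_pos]
    · exact zero_le
    · convert hx
  | succ k ih =>
    set γ := ENNReal.ofReal √(1 - (Real.sin θ - 4 * ε) ^ 2) with hγ
    set S := ∑ j ∈ Finset.range k, r * (2 * (s * T (j + 1)) + s) with hS
    have hS0 : 0 ≤ S := Finset.sum_nonneg fun j _ => by
      have := mul_nonneg hs (hT0 (j + 1)); positivity
    have hsat : ∀ (t : Bool) (x : Fin k → Bool),
        φ.Sat (Fin.cons t x) ↔ (CNF.propagate t φ).Sat x := fun t x => sat_cons_iff t φ x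
    obtain ⟨b, hbsat⟩ : ∃ b, ∃ x, (CNF.propagate b φ).Sat x := by
      obtain ⟨x, hx⟩ := hφ
      refine ⟨x 0, Fin.tail x, ?_⟩
      rw [← hsat, Fin.cons_self_tail]
      exact hx
    have hL0 : L ≠ [] := by rintro rfl; simp at hL; omega
    have hsT0 := mul_nonneg hs (hT0 (k + 1))
    -- Two potentials are tracked: the constant one, whose coefficient carries the error of the
    -- later stages, and the vote weight, which is set to zero if the bit is not forced.
    have hpot := ((hasCost_prepare v hL0 hφ hsin hc hμ hμ1 hε0 hε1 hrate.1
      (by rw [hL]; exact hT (k + 1) hk) hs (hsT (k + 1) hk)).bind_spend_sample hs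
      (q := fun ψ => born fun c : Bool => ∑ x, if x 0 = c then ‖ψ x‖₊ ^ 2 else 0)
      (g := fun i : Bool => if i then fun c => if ∀ x, φ.Sat x → x 0 = b then
        voteWeight (voteExponent (Real.sin θ - 4 * ε)) b c else 0 else fun _ => 1)
      (γ := fun i : Bool => if i then γ else 1) (fun ψ hψ i => by
        cases i
        · simp only [Bool.false_eq_true, if_false, mul_one, PMF.tsum_coe, le_refl]
        · simp only [if_true]
          by_cases hforced : ∀ x, φ.Sat x → x 0 = b
          · simp only [if_pos hforced]
            exact readQubit_vote_le hψ hforced hb hb1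
          · simp [if_neg hforced])).replicate (by positivity) r
    have h01 : ∀ (x : Fin (k + 1) → Bool), (if φ.Sat x then (0 : ℝ≥0∞) else 1) ≤ 1 := fun x => by
      split_ifs <;> simp
    rw [multipleLoop, Run.loss_bind]
    refine (hpot _ (fun l B' => Run.loss_le_one _ (fun x _ => h01 x) B')
      (fun i : Bool => if i then 1 else k * γ ^ r) (eexp S) (one_le_eexp hS0) ?_ B).trans ?_
    · intro l B'
      dsimp only
      set t : Bool := if |(l.map boolSign).sum / r + Real.sin θ| ≤
        |(l.map boolSign).sum / r - Real.sin θ| then false else true with ht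
      rw [Run.loss_bind]
      simp only [Run.loss_ret, Fintype.sum_bool, if_true, Bool.false_eq_true, if_false, hsat]
      by_cases hts : ∃ x, (CNF.propagate t φ).Sat x
      · refine (ih (by omega) _ _ (by simpa using hL) hts (hrate.2 t hts) B').trans ?_
        rw [sub_eq_add_neg, eexp_add]
        simp only [List.map_const', List.prod_replicate, one_pow, mul_one]
        gcongr
        exact le_add_self
      · have htb : t = !b := by
          rcases Bool.eq_or_eq_not t b with h | h
          · rw [h] at hts; exact absurd hbsat hts
          · exact h
        have hforced : ∀ x, φ.Sat x → x 0 = b := by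
          intro x hx
          rcases Bool.eq_or_eq_not (x 0) b with h | h
          · exact h
          · refine absurd ⟨Fin.tail x, ?_⟩ hts
            rw [← hsat, htb, ← h, Fin.cons_self_tail]
            exact hx
        refine (Run.loss_le_one _ (fun x _ => by split_ifs <;> simp) B').trans ?_
        rw [add_assoc]
        refine le_trans ?_ le_self_add
        simp only [if_pos hforced, one_mul]
        refine one_le_prod_voteWeight (f := fun c : Bool => c) (voteExponent_nonneg hb hb1) ?_
        have hr' : (0 : ℝ) < r := by exact_mod_cast hr
        set total := (l.map fun c => boolSign c).sum with htotal
        -- As $\sin\theta>0$, comparing the distances to $\pm\sin\theta$ is a comparison of the mean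
        -- with zero, with ties going to FALSE.
        have hiff : |total / r + Real.sin θ| ≤ |total / r - Real.sin θ| ↔ total ≤ 0 := by
          rw [← sq_le_sq]
          constructor
          · intro h
            have h1 : total / r * Real.sin θ ≤ 0 := by nlinarith
            have h2 : total / r ≤ 0 := by
              by_contra hcon
              have := mul_pos (not_le.1 hcon) hsin
              linarith
            by_contra hcon
            have := div_pos (not_le.1 hcon) hr'
            linarith
          · intro h
            have h1 : total / r ≤ 0 := div_nonpos_of_nonpos_of_nonneg h hr'.le
            nlinarith [mul_nonneg (neg_nonneg.2 h1) hsin.le]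
        rw [htb] at ht
        simp only [hiff] at ht
        cases b
        · have : ¬ total ≤ 0 := by intro h; rw [if_pos h] at ht; simp at ht
          simp only [boolSign, Bool.false_eq_true, if_false]
          linarith
        · have : total ≤ 0 := by by_contra h; rw [if_neg h] at ht; simp at ht
          have h1 : boolSign true = 1 := rfl
          rw [h1]
          linarith
    · rw [← eexp_add, Finset.sum_range_succ, ← hS]
      simp only [Fintype.sum_bool, if_true, Bool.false_eq_true, if_false, one_pow, mul_one, one_mul]
      refine le_of_eq ?_
      push_cast
      congr 1
      · ring
      · congr 1; ring

/-! ### Numerical estimates -/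

theorem log_two_gt : (69 / 100 : ℝ) < Real.log 2 := by
  have := Real.log_two_gt_d9; linarith

theorem cos_half_pos {θ : ℝ} (h0 : 0 < θ) (h1 : θ ≤ Real.pi / 2) : 0 < Real.cos (θ / 2) :=
  Real.cos_pos_of_mem_Ioo ⟨by linarith [Real.pi_pos], by linarith [Real.pi_pos]⟩

/-- The number of cycles is bounded in terms of the one in `timeBound`. -/
theorem numCycles_le {n k : ℕ} (hn : 2 ≤ n) (hk : k ≤ n) {θ μ ε : ℝ} (h0 : 0 < θ)
    (h1 : θ ≤ Real.pi / 2) (hμ : 0 < μ) (hμ1 : μ < 1) (hε : Real.sin θ ^ 2 / 100 ≤ ε) :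
    numCycles k θ μ ε ≤ 14 * ⌈(Real.log (1 / (1 - Real.cos θ ^ 2)) +
      n * Real.log (1 / Real.cos (θ / 2))) / Real.log μ⁻¹⌉₊ := by
  have hc := cos_half_pos h0 h1
  have hc1 := Real.cos_le_one (θ / 2)
  have hsin : 0 < Real.sin θ := Real.sin_pos_of_pos_of_lt_pi h0 (by linarith [Real.pi_pos])
  have hlm : 0 < Real.log μ⁻¹ := Real.log_pos ((one_lt_inv₀ hμ).2 hμ1)
  have hcn : 0 < Real.cos (θ / 2) ^ n := pow_pos hc n
  have hck : Real.cos (θ / 2) ^ n ≤ Real.cos (θ / 2) ^ k := pow_le_pow_of_le_one hc.le hc1 hk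
  set f := Real.log (1 / (1 - Real.cos θ ^ 2)) + n * Real.log (1 / Real.cos (θ / 2)) with hf
  have hf' : f = -Real.log (Real.sin θ ^ 2 * Real.cos (θ / 2) ^ n) := by
    rw [hf, Real.log_mul (by positivity) (by positivity), Real.log_pow (n := n), one_div, one_div,
      Real.log_inv, Real.log_inv, ← Real.sin_sq]
    ring
  -- With $u=\cos\theta$, the product $\sin^2\theta\cos^2(\theta/2)=(1-u^2)(1+u)/2$ is maximal at
  -- $u=1/3$ with value $16/27<3/5$. Then $-\ln z\ge1-z$ is used.
  have hf0 : 2 / 5 ≤ f := by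
    have h2 : Real.cos (θ / 2) ^ n ≤ Real.cos (θ / 2) ^ 2 := pow_le_pow_of_le_one hc.le hc1 hn
    have h3 : Real.sin θ ^ 2 * Real.cos (θ / 2) ^ n ≤ 3 / 5 := by
      refine (mul_le_mul_of_nonneg_left h2 (sq_nonneg _)).trans ?_
      rw [cos_half_sq, Real.sin_sq]
      have hu : 0 ≤ Real.cos θ := Real.cos_nonneg_of_mem_Icc ⟨by linarith, h1⟩
      nlinarith [mul_nonneg hu (sq_nonneg (Real.cos θ - 1 / 3)), sq_nonneg (Real.cos θ - 1 / 3)]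
    have h4 := Real.log_le_sub_one_of_pos
      (by positivity : 0 < Real.sin θ ^ 2 * Real.cos (θ / 2) ^ n)
    rw [hf']
    linarith
  have hlog100 : Real.log 100 ≤ 5 := by
    have h2 : Real.log 100 ≤ Real.log (2 ^ 7) := Real.log_le_log (by norm_num) (by norm_num)
    rw [Real.log_pow] at h2
    have := Real.log_two_lt_d9
    norm_num at h2
    linarith
  -- The factor $14$ comes from $\ln100+f\le5+f$ and $5\le13\cdot\frac25\le13f$.
  have h5 : Real.log (ε * Real.cos (θ / 2) ^ k)⁻¹ ≤ 14 * f := by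
    have h6 : Real.sin θ ^ 2 * Real.cos (θ / 2) ^ n / 100 ≤ ε * Real.cos (θ / 2) ^ k := by
      calc Real.sin θ ^ 2 * Real.cos (θ / 2) ^ n / 100
          = Real.sin θ ^ 2 / 100 * Real.cos (θ / 2) ^ n := by ring
        _ ≤ _ := mul_le_mul hε hck hcn.le (le_trans (by positivity) hε)
    have h7 := Real.log_le_log (by positivity) h6
    rw [Real.log_div (by positivity) (by norm_num)] at h7
    rw [Real.log_inv]
    linarith
  refine Nat.ceil_le.2 ?_
  push_cast
  calc Real.log (ε * Real.cos (θ / 2) ^ k)⁻¹ / Real.log μ⁻¹ ≤ 14 * f / Real.log μ⁻¹ := by gcongr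
    _ = 14 * (f / Real.log μ⁻¹) := by ring
    _ ≤ _ := by gcongr; exact Nat.le_ceil _

theorem length_layersOf_le {n : ℕ} {F : List (Fin n → Fin 3)}
    (h : (F.length : ℝ) ≤ 3 / Real.log (27 / 21) * Real.log n) :
    ((layersOf F).length : ℝ) ≤ 24 / Real.log (27 / 21) * Real.log n := by
  rw [length_layersOf]
  push_cast
  calc (F.length : ℝ) * 8 ≤ 3 / Real.log (27 / 21) * Real.log n * 8 := by gcongr
    _ = _ := by ring

/-- The probability of exceeding the budget. -/
theorem exp_budget_le {T A δ B : ℝ} (hT : 0 < T) (hδ : 0 < δ) (hδ1 : δ ≤ 1 / 2)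
    (hB : T * (2 * A + 4 * Real.log δ⁻¹) ≤ B) :
    Real.exp (A - 1 / (2 * T) * B) ≤ δ / 2 := by
  have h1 : 1 / (2 * T) * (T * (2 * A + 4 * Real.log δ⁻¹)) ≤ 1 / (2 * T) * B :=
    mul_le_mul_of_nonneg_left hB (by positivity)
  -- The budget covers the exponent $A$ and leaves $2\ln(1/\delta)$, so the bound is
  -- $\delta^2\le\delta/2$.
  have h2 : 1 / (2 * T) * (T * (2 * A + 4 * Real.log δ⁻¹)) = A + 2 * Real.log δ⁻¹ := by
    field_simp; ring
  rw [h2, Real.log_inv] at h1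
  calc Real.exp (A - 1 / (2 * T) * B) ≤ Real.exp (Real.log δ + Real.log δ) :=
        Real.exp_le_exp.2 (by linarith)
    _ = δ * δ := by rw [Real.exp_add, Real.exp_log hδ]
    _ ≤ δ / 2 := by nlinarith

theorem log_inv_ge {δ : ℝ} (hδ : 0 < δ) (hδ1 : δ ≤ 1 / 2) : 69 / 100 ≤ Real.log δ⁻¹ := by
  have h : (2 : ℝ) ≤ δ⁻¹ := by rw [le_inv_comm₀ (by norm_num) hδ]; linarith
  exact log_two_gt.le.trans (Real.log_le_log (by norm_num) h)

theorem log_div_ge {n : ℕ} (hn : 2 ≤ n) {δ : ℝ} (hδ : 0 < δ) (hδ1 : δ ≤ 1 / 2) :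
    2 * Real.log 2 ≤ Real.log (n / δ) := by
  have hn' : (2 : ℝ) ≤ n := by exact_mod_cast hn
  have h : (2 : ℝ) ^ 2 ≤ n / δ := by rw [le_div_iff₀ hδ]; nlinarith
  have := Real.log_le_log (by norm_num) h
  rwa [Real.log_pow, Nat.cast_ofNat] at this

/-- The upper bound keeps the loss of bias small for the majority vote, and the lower bound limits
the number of cycles. -/
theorem eps_const_bounds :
    1 / 100 ≤ (1 - 1 / √2) ^ 2 / 8 ∧ (1 - 1 / √2) ^ 2 / 8 ≤ 1 / 80 := by
  set z := 1 / √2 with hz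
  have hz0 : 0 < z := by positivity
  have hz2 : z ^ 2 = 1 / 2 := by rw [hz, div_pow, Real.sq_sqrt (by norm_num)]; norm_num
  have h1 : z ≤ 71 / 100 := by nlinarith
  have h2 : 7 / 10 ≤ z := by nlinarith
  constructor <;> nlinarith

/-- The readout error for a unique solution. -/
theorem unique_readout_le {n R : ℕ} (hn : 2 ≤ n) {θ δ ε : ℝ} (hsin : 0 < Real.sin θ)
    (hδ : 0 < δ) (hδ1 : δ ≤ 1 / 2) (hε0 : 0 < ε) (hε : ε ≤ Real.sin θ ^ 2 / 80)
    (hR : 2 * Real.log (n / δ) / Real.log (2 / (1 + Real.cos θ ^ 2)) ≤ R) :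
    n * √(1 - (Real.sin θ - 4 * ε) ^ 2) ^ R ≤ δ / 2 := by
  set σ := Real.sin θ with hσ
  have hσ1 : σ ≤ 1 := Real.sin_le_one θ
  have hX := log_div_ge hn hδ hδ1
  set X := Real.log (n / δ) with hXdef
  have hn0 : (0 : ℝ) < n := by positivity
  have ht : 9 / 10 * σ ≤ σ - 4 * ε := by nlinarith
  have ht1 : σ - 4 * ε < 1 := by linarith
  have h1t : 0 < 1 - (σ - 4 * ε) ^ 2 := by nlinarith
  set y := 1 - σ ^ 2 / 2 with hy
  have hy0 : 0 < y := by nlinarith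
  have hy1 : y < 1 := by nlinarith
  have hlogy : Real.log (2 / (1 + Real.cos θ ^ 2)) = -Real.log y := by
    rw [← Real.log_inv, hy, hσ, Real.sin_sq]
    congr 1
    rw [← one_div, div_eq_div_iff (by positivity) (by nlinarith)]
    ring
  have hly : Real.log y < 0 := Real.log_neg hy0 hy1
  rw [hlogy, div_le_iff₀ (by linarith)] at hR
  -- Bernoulli gives $y^{3/2}\ge1-\frac34\sigma^2$, while the bias of at least $\frac9{10}\sigma$
  -- gives $1-\frac{81}{100}\sigma^2$ at most. The exponent above one leaves the surplus
  -- $e^{-X/2}\le\frac12$, which halves the error.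
  have h2 : Real.log (1 - (σ - 4 * ε) ^ 2) ≤ 3 / 2 * Real.log y := by
    rw [← Real.log_rpow hy0]
    refine Real.log_le_log h1t ?_
    have h3 := one_add_mul_self_le_rpow_one_add (s := -(σ ^ 2 / 2)) (by nlinarith)
      (p := 3 / 2) (by norm_num)
    rw [show 1 + -(σ ^ 2 / 2) = y by rw [hy]; ring] at h3
    nlinarith
  have h4 : √(1 - (σ - 4 * ε) ^ 2) ^ R ≤ Real.exp (-(X + X / 2)) := by
    rw [← Real.log_le_iff_le_exp (pow_pos (Real.sqrt_pos.2 h1t) R), Real.log_pow,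
      Real.log_sqrt h1t.le]
    have hR0 : (0 : ℝ) ≤ R := Nat.cast_nonneg R
    nlinarith
  have h5 : Real.exp (-X) = δ / n := by
    rw [Real.exp_neg, hXdef, Real.exp_log (by positivity), inv_div]
  have h6 : Real.exp (-(X / 2)) ≤ 1 / 2 := by
    rw [← Real.le_log_iff_exp_le (by norm_num), one_div, Real.log_inv]
    linarith
  calc n * √(1 - (σ - 4 * ε) ^ 2) ^ R ≤ n * (Real.exp (-X) * Real.exp (-(X / 2))) := by
        rw [← Real.exp_add, ← neg_add]; gcongr
    _ ≤ n * (δ / n * (1 / 2)) := by rw [h5]; gcongr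
    _ = δ / 2 := by field_simp

/-- The readout error for possibly multiple solutions. -/
theorem multiple_readout_le {n r : ℕ} (hn : 2 ≤ n) {θ δ : ℝ} (hsin : 0 < Real.sin θ)
    (hδ : 0 < δ) (hr : 8 * Real.log (2 * n / δ) / Real.sin θ ^ 2 ≤ r) :
    n * √(1 - (Real.sin θ - 4 * (Real.sin θ ^ 2 / 8)) ^ 2) ^ r ≤ δ / 2 := by
  set σ := Real.sin θ with hσ
  have hσ1 : σ ≤ 1 := Real.sin_le_one θ
  have hn0 : (0 : ℝ) < n := by positivity
  have h1t : 0 < 1 - (σ - 4 * (σ ^ 2 / 8)) ^ 2 := by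
    have h1 : σ - 4 * (σ ^ 2 / 8) ≤ 1 / 2 := by nlinarith [sq_nonneg (σ - 1)]
    have h2 : 0 ≤ σ - 4 * (σ ^ 2 / 8) := by nlinarith
    nlinarith
  rw [div_le_iff₀ (by positivity)] at hr
  -- The bias $\sigma-\sigma^2/2$ is at least $\sigma/2$. The square root halves the exponent to
  -- $\sigma^2/8$, which matches the factor $8$ in the number of copies.
  have h2 : Real.log (1 - (σ - 4 * (σ ^ 2 / 8)) ^ 2) ≤ -(σ ^ 2 / 4) := by
    refine (Real.log_le_sub_one_of_pos h1t).trans ?_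
    have : σ / 2 ≤ σ - 4 * (σ ^ 2 / 8) := by nlinarith
    nlinarith
  have h4 : √(1 - (σ - 4 * (σ ^ 2 / 8)) ^ 2) ^ r ≤ δ / (2 * n) := by
    rw [← Real.log_le_log_iff (pow_pos (Real.sqrt_pos.2 h1t) r) (by positivity), Real.log_pow,
      Real.log_sqrt h1t.le]
    have hR0 : (0 : ℝ) ≤ r := Nat.cast_nonneg r
    have h5 : Real.log (δ / (2 * n)) = -Real.log (2 * n / δ) := by
      rw [← Real.log_inv, inv_div]
    rw [h5]
    nlinarith
  calc n * √(1 - (σ - 4 * (σ ^ 2 / 8)) ^ 2) ^ r ≤ n * (δ / (2 * n)) := by gcongr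
    _ = δ / 2 := by field_simp

/-- The sum over the shrinking registers of the expected numbers of attempts or rounds. -/
theorem sum_growth_le {θ : ℝ} (h0 : 0 < θ) (h1 : θ ≤ Real.pi / 2) (v : Version) (n : ℕ) :
    ∑ j ∈ Finset.range n, growth v θ ^ (j + 1) ≤
      4 * min (n : ℝ) (1 / (1 - Real.cos θ)) * growth v θ ^ n := by
  have hc := cos_half_pos h0 h1
  set x := growth v θ with hx
  have hx1 : 1 ≤ x := one_le_growth hc v
  have hxi : x⁻¹ ≤ Real.cos (θ / 2) := inv_growth_le hc v
  have hcos : Real.cos θ < 1 := by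
    have : Real.cos θ < Real.cos 0 :=
      Real.cos_lt_cos_of_nonneg_of_le_pi_div_two le_rfl h1 h0
    rwa [Real.cos_zero] at this
  have hxn : 1 ≤ x ^ n := one_le_pow₀ hx1
  have h2 : ∑ j ∈ Finset.range n, x ^ (j + 1) ≤ n * x ^ n := by
    calc ∑ j ∈ Finset.range n, x ^ (j + 1) ≤ ∑ _j ∈ Finset.range n, x ^ n :=
          Finset.sum_le_sum fun j hj => pow_le_pow_right₀ hx1 (Finset.mem_range.1 hj)
      _ = n * x ^ n := by simp
  have h3 : ∑ j ∈ Finset.range n, x ^ (j + 1) ≤ 4 * (1 / (1 - Real.cos θ)) * x ^ n := by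
    have h4 : (∑ j ∈ Finset.range n, x ^ (j + 1)) * (1 - x⁻¹) = x ^ n - 1 := by
      have h5 : ∑ j ∈ Finset.range n, x ^ (j + 1) = x * ∑ j ∈ Finset.range n, x ^ j := by
        rw [Finset.mul_sum]; exact Finset.sum_congr rfl fun j _ => pow_succ' x j
      have h6 := mul_geom_sum x n
      rw [h5]
      have : x ≠ 0 := by positivity
      field_simp
      linarith
    -- With $c=\cos(\theta/2)$: $1-\cos\theta=2(1-c)(1+c)\le4(1-c)$, and $x^{-1}\le c$ in both
    -- versions.
    have h5 : (1 - Real.cos θ) / 4 ≤ 1 - x⁻¹ := by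
      have := cos_half_sq θ
      have := Real.cos_le_one (θ / 2)
      nlinarith
    have h6 : 0 ≤ ∑ j ∈ Finset.range n, x ^ (j + 1) :=
      Finset.sum_nonneg fun j _ => by positivity
    rw [mul_one_div, div_mul_eq_mul_div, le_div_iff₀ (by linarith)]
    nlinarith
  have hn0 : (0 : ℝ) ≤ n := Nat.cast_nonneg n
  rcases min_choice (n : ℝ) (1 / (1 - Real.cos θ)) with h | h <;> rw [h]
  · nlinarith [mul_nonneg hn0 (by linarith : (0 : ℝ) ≤ x ^ n)]
  · exact h3

/-! ### Overall time complexity -/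

theorem exists_rate {n : ℕ} {θ : ℝ} {L : List (Fin n → Bool)} {φ : CNF n} (hL : Covers L φ) :
    ∃ μ : ℝ, 0 < μ ∧ μ < 1 ∧ IsRate θ μ L φ ∧ IsUniformRate θ μ n L φ := by
  obtain ⟨μ₀, h₀, H₀⟩ := exists_isRate (θ := θ) hL
  obtain ⟨μ₁, h₁, H₁⟩ := exists_isUniformRate θ n L φ hL
  refine ⟨max (1 / 2) (max μ₀ μ₁), lt_max_of_lt_left (by norm_num), ?_, H₀ _ ?_, H₁ _ ?_⟩
  · simp only [max_lt_iff]
    exact ⟨by norm_num, h₀, h₁⟩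
  · exact (le_max_left _ _).trans (le_max_right _ _)
  · exact (le_max_right _ _).trans (le_max_right _ _)

/-- The expected cost of a state preparation, up to constants. -/
theorem prepareCost_le (v : Version) {n : ℕ} (hn : 2 ≤ n) {F : List (Fin n → Fin 3)}
    (hF : (F.length : ℝ) ≤ 3 / Real.log (27 / 21) * Real.log n) {θ μ ε : ℝ} (h0 : 0 < θ)
    (h1 : θ ≤ Real.pi / 2) (hμ : 0 < μ) (hμ1 : μ < 1) (hε : Real.sin θ ^ 2 / 100 ≤ ε) :
    40 * (numCycles n θ μ ε * (layersOf F).length) * growth v θ ^ n ≤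
      40 * 14 * (24 / Real.log (27 / 21)) * (Real.log n *
        ⌈(Real.log (1 / (1 - Real.cos θ ^ 2)) + n * Real.log (1 / Real.cos (θ / 2))) /
          Real.log μ⁻¹⌉₊ * growth v θ ^ n) := by
  have hg : 0 ≤ growth v θ ^ n :=
    pow_nonneg (zero_le_one.trans (one_le_growth (cos_half_pos h0 h1) v)) n
  have hN := numCycles_le hn le_rfl h0 h1 hμ hμ1 hε
  set N := ⌈(Real.log (1 / (1 - Real.cos θ ^ 2)) + n * Real.log (1 / Real.cos (θ / 2))) /
    Real.log μ⁻¹⌉₊ with hNdef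
  have hN' : (numCycles n θ μ ε : ℝ) ≤ 14 * N := by exact_mod_cast hN
  have hL := length_layersOf_le hF
  calc 40 * ((numCycles n θ μ ε : ℝ) * (layersOf F).length) * growth v θ ^ n
      ≤ 40 * ((14 * N) * (24 / Real.log (27 / 21) * Real.log n)) * growth v θ ^ n := by gcongr
    _ = _ := by ring

theorem mul_le_scaled_product {T x K c l N g Λ t W : ℝ} (hT : 0 ≤ T) (hx : 0 ≤ x)
    (h1 : T ≤ K * (l * N * g)) (h2 : x ≤ c * (Λ * t * W)) :
    T * x ≤ c * K * W * (l * N * Λ * g * t) :=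
  (mul_le_mul h1 h2 hx (hT.trans h1)).trans_eq (by ring)

theorem unique_budget_le {R t Λ : ℝ} (hΛ : 69 / 100 ≤ Λ) (ht : 2 ≤ t) (hR : R ≤ 3 * t) :
    2 * (R * (3 / 2)) + 4 * Λ ≤ 27 * (Λ * t * 1) := by
  have h1 := mul_le_mul_of_nonneg_right hΛ (by linarith : 0 ≤ t)
  have h2 := mul_le_mul_of_nonneg_left ht (by linarith : 0 ≤ Λ)
  linarith

theorem multiple_budget_le {r t W Λ : ℝ} (hΛ : 69 / 100 ≤ Λ) (ht : 1 ≤ t) (hW : 1 ≤ W)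
    (hr : r ≤ 17 * t) : 2 * (6 * (r * W)) + 4 * Λ ≤ 374 * (Λ * t * W) := by
  have e1 : r * W ≤ 17 * t * W := mul_le_mul_of_nonneg_right hr (by linarith)
  have e2 : 1 ≤ t * W := one_le_mul_of_one_le_of_one_le ht hW
  have e3 : 69 / 100 * (t * W) ≤ Λ * (t * W) := mul_le_mul_of_nonneg_right hΛ (by linarith)
  have e4 : Λ ≤ Λ * (t * W) := le_mul_of_one_le_right (by linarith) e2
  linarith

theorem one_le_prepareCost (v : Version) {j k n : ℕ} {F : List (Fin n → Fin 3)}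
    (hF : IsPerfectHashFamily F) {θ μ ε : ℝ} (hc : 0 < Real.cos (θ / 2)) (hμ : 0 < μ)
    (hμ1 : μ < 1) (hε0 : 0 < ε) (hε1 : ε < 1) :
    1 ≤ 40 * ((numCycles k θ μ ε : ℝ) * (layersOf F).length) * growth v θ ^ j := by
  have h1 : (1 : ℝ) ≤ numCycles k θ μ ε := by
    exact_mod_cast one_le_numCycles (k := k) hc hμ hμ1 hε0 hε1
  have h2 : (1 : ℝ) ≤ (layersOf F).length := by
    have := hF.length_pos
    rw [length_layersOf]
    exact_mod_cast (by omega : 1 ≤ F.length * 8)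
  have h3 : 1 ≤ growth v θ ^ j := one_le_pow₀ (one_le_growth hc v)
  have h4 : 1 ≤ (numCycles k θ μ ε : ℝ) * (layersOf F).length := one_le_mul_of_one_le_of_one_le h1 h2
  exact one_le_mul_of_one_le_of_one_le (by linarith) h3

theorem ofReal_add_le_of_halves {n R : ℕ} {γ δ a : ℝ} (hγ : 0 ≤ γ)
    (h1 : n * γ ^ R ≤ δ / 2) (h2 : Real.exp a ≤ δ / 2) :
    (n : ℝ≥0∞) * ENNReal.ofReal γ ^ R + eexp a ≤ ENNReal.ofReal δ := by
  rw [eexp, ← ENNReal.ofReal_pow hγ, ← ENNReal.ofReal_natCast, ← ENNReal.ofReal_mul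
    (Nat.cast_nonneg n), ← ENNReal.ofReal_add (by positivity) (Real.exp_pos _).le]
  exact ENNReal.ofReal_le_ofReal (by linarith)

set_option maxHeartbeats 400000 in
theorem unique_solution : ∃ C : ℝ, 0 < C ∧
    ∀ (v : Version) (n : ℕ) (F : List (Fin n → Fin 3)) (φ : CNF n) (θ μ δ : ℝ),
      2 ≤ n → IsPerfectHashFamily F →
      (F.length : ℝ) ≤ 3 / Real.log (27 / 21) * Real.log n →
      φ.IsThreeSAT → (∃! x, φ.Sat x) → 0 < θ → θ ≤ Real.pi / 2 → 0 < δ → δ ≤ 1 / 2 →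
      0 < μ → μ < 1 → IsRate θ μ (layersOf F) φ →
      ∀ B : ℕ, C * timeBound v n θ μ δ (tUnique n θ δ) ≤ B →
        ENNReal.ofReal (1 - δ) ≤ (solveUnique v θ μ δ (layersOf F) φ).successProb B φ.Sat := by
  have hlog : 0 < Real.log (27 / 21) := Real.log_pos (by norm_num)
  refine ⟨27 * (40 * 14 * (24 / Real.log (27 / 21))), by positivity, ?_⟩
  rintro v n F φ θ μ δ hn hF hlen _ ⟨y, hy, hu⟩ h0 h1 hδ hδ1 hμ hμ1 hrate B hB
  have hc := cos_half_pos h0 h1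
  have hsin : 0 < Real.sin θ := Real.sin_pos_of_pos_of_lt_pi h0 (by linarith [Real.pi_pos])
  have hsin1 := Real.sin_le_one θ
  obtain ⟨hε1, hε2⟩ := eps_const_bounds
  set ε := (1 - 1 / √2) ^ 2 / 8 * Real.sin θ ^ 2 with hε
  have hεl : Real.sin θ ^ 2 / 100 ≤ ε := by nlinarith [sq_nonneg (Real.sin θ)]
  have hεu : ε ≤ Real.sin θ ^ 2 / 80 := by nlinarith [sq_nonneg (Real.sin θ)]
  have hsq : Real.sin θ ^ 2 ≤ 1 := by nlinarith
  have hε0 : 0 < ε := lt_of_lt_of_le (by positivity) hεl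
  set T := 40 * ((numCycles n θ μ ε : ℝ) * (layersOf F).length) * growth v θ ^ n with hT
  have hT1 : 1 ≤ T := one_le_prepareCost v hF hc hμ hμ1 hε0 (by linarith)
  have hTle := prepareCost_le v hn hlen h0 h1 hμ hμ1 hεl
  rw [← hT] at hTle
  set R := ⌈2 * Real.log (n / δ) / Real.log (2 / (1 + Real.cos θ ^ 2))⌉₊ with hR
  have hL0 : layersOf F ≠ [] := by
    rw [← List.length_pos_iff, length_layersOf]
    have := hF.length_pos
    omega
  have hTpos : 0 < T := by linarith
  have hsT : 1 / (2 * T) * T = 1 / 2 := by field_simp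
  refine Run.ofReal_one_sub_le_successProb _ _ _ hδ.le ?_
  refine (loss_solveUnique_le v hL0 hy hu hsin hc hμ hμ1 hrate hε hε0 (by linarith)
    (by nlinarith) (by linarith) (T := T) le_rfl (s := 1 / (2 * T)) (by positivity) hTpos.le hsT.le
    hR B).trans ?_
  refine ofReal_add_le_of_halves (Real.sqrt_nonneg _)
    (unique_readout_le hn hsin hδ hδ1 hε0 hεu (Nat.le_ceil _)) ?_
  -- With $s=1/(2T)$ a copy has exponent $2sT+s=1+s\le\frac32$, which is the source of $A=\frac32R$.
  have hs12 : 1 / (2 * T) ≤ 1 / 2 := by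
    rw [div_le_div_iff₀ (by positivity) (by norm_num)]; linarith
  have hR0 : (0 : ℝ) ≤ R := Nat.cast_nonneg R
  refine le_trans (Real.exp_le_exp.2 (sub_le_sub_right ?_ _))
    (exp_budget_le (A := R * (3 / 2)) hTpos hδ hδ1 ?_)
  · exact mul_le_mul_of_nonneg_left (by linarith) hR0
  · refine le_trans ?_ hB
    have hΛ := log_inv_ge hδ hδ1
    set t := tUnique n θ δ with ht
    have hden : 0 < Real.log (2 / (1 + Real.cos θ ^ 2)) := by
      refine Real.log_pos ?_
      rw [one_lt_div (by positivity)]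
      nlinarith [Real.sin_sq_add_cos_sq θ, pow_pos hsin 2]
    have hden2 : Real.log (2 / (1 + Real.cos θ ^ 2)) ≤ Real.log 2 := by
      refine Real.log_le_log (by positivity) (div_le_self (by norm_num) ?_)
      nlinarith [sq_nonneg (Real.cos θ)]
    -- The denominator is at most $\ln2$, whereas $n/\delta\ge4$. This lower bound absorbs the
    -- rounding of $R$ and the additive $\ln(1/\delta)$ of the budget.
    have ht2 : 2 ≤ t := by
      rw [ht, tUnique, le_div_iff₀ hden]
      linarith [log_div_ge hn hδ hδ1]
    have hRt : (R : ℝ) ≤ 3 * t := by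
      have h2 : 2 * Real.log (n / δ) / Real.log (2 / (1 + Real.cos θ ^ 2)) = 2 * t := by
        rw [ht, tUnique]; ring
      have := (Nat.ceil_lt_add_one (by rw [h2]; linarith :
        0 ≤ 2 * Real.log (n / δ) / Real.log (2 / (1 + Real.cos θ ^ 2)))).le
      rw [← hR, h2] at this
      linarith
    have h3 := unique_budget_le hΛ ht2 hRt
    rw [timeBound, rpow_eq_growth_pow hc]
    refine (mul_le_scaled_product hTpos.le (by linarith) hTle h3).trans_eq ?_
    rw [mul_one]

set_option maxHeartbeats 400000 in
theorem multiple_solutions : ∃ C : ℝ, 0 < C ∧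
    ∀ (v : Version) (n : ℕ) (F : List (Fin n → Fin 3)) (φ : CNF n) (θ μ δ : ℝ),
      2 ≤ n → IsPerfectHashFamily F →
      (F.length : ℝ) ≤ 3 / Real.log (27 / 21) * Real.log n →
      φ.IsThreeSAT → (∃ x, φ.Sat x) → 0 < θ → θ ≤ Real.pi / 2 → 0 < δ → δ ≤ 1 / 2 →
      0 < μ → μ < 1 → IsUniformRate θ μ n (layersOf F) φ →
      ∀ B : ℕ,
        C * min (n : ℝ) (1 / (1 - Real.cos θ)) * timeBound v n θ μ δ (tMultiple n θ δ) ≤ B →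
        ENNReal.ofReal (1 - δ) ≤ (solveMultiple v θ μ δ (layersOf F) φ).successProb B φ.Sat := by
  have hlog : 0 < Real.log (27 / 21) := Real.log_pos (by norm_num)
  refine ⟨374 * (40 * 14 * (24 / Real.log (27 / 21))), by positivity, ?_⟩
  intro v n F φ θ μ δ hn hF hlen _ hφ h0 h1 hδ hδ1 hμ hμ1 hrate B hB
  have hc := cos_half_pos h0 h1
  have hsin : 0 < Real.sin θ := Real.sin_pos_of_pos_of_lt_pi h0 (by linarith [Real.pi_pos])
  have hsin1 := Real.sin_le_one θ
  have hsq : Real.sin θ ^ 2 ≤ 1 := by nlinarith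
  have hsq0 : 0 < Real.sin θ ^ 2 := by positivity
  set ε := Real.sin θ ^ 2 / 8 with hε
  have hε0 : 0 < ε := by positivity
  have hεl : Real.sin θ ^ 2 / 100 ≤ ε := by linarith
  set N := numCycles n θ μ ε with hN
  -- The number of cycles for the full register is used at every stage, so the cost depends on the
  -- stage only through the growth factor. The rate $s$ is fixed by the largest stage.
  set U : ℕ → ℝ := fun k => 40 * ((N : ℝ) * (layersOf F).length) * growth v θ ^ k with hU
  have hU1 : ∀ k, 1 ≤ U k := fun k => one_le_prepareCost v hF hc hμ hμ1 hε0 (by linarith)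
  have hTle := prepareCost_le v hn hlen h0 h1 hμ hμ1 hεl
  have hUmono : ∀ k ≤ n, U k ≤ U n := fun k hk =>
    mul_le_mul_of_nonneg_left (pow_le_pow_right₀ (one_le_growth hc v) hk) (by positivity)
  set r := ⌈8 * Real.log (2 * n / δ) / Real.sin θ ^ 2⌉₊ with hr
  have hUn : 0 < U n := lt_of_lt_of_le one_pos (hU1 n)
  set s := 1 / (2 * U n) with hs
  have hs0 : 0 ≤ s := by positivity
  have hsU : s * U n = 1 / 2 := by rw [hs]; field_simp
  have hn0 : (0 : ℝ) < n := by positivity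
  have hX := log_div_ge hn hδ hδ1
  have hlog2 := log_two_gt
  have hlog2n : Real.log (2 * n / δ) = Real.log 2 + Real.log (n / δ) := by
    rw [mul_div_assoc, Real.log_mul (by norm_num) (by positivity)]
  have hrpos : 0 < r := Nat.ceil_pos.2 (div_pos (by linarith) hsq0)
  have hcount : ∀ k ≤ n, 40 * ((numCycles k θ μ ε : ℝ) * (layersOf F).length) * growth v θ ^ k ≤
      U k := by
    intro k hk
    have h2 : numCycles k θ μ ε ≤ N := by
      refine Nat.ceil_le_ceil (div_le_div_of_nonneg_right (Real.log_le_log ?_ ?_)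
        (Real.log_pos ((one_lt_inv₀ hμ).2 hμ1)).le)
      · have := pow_pos hc k; positivity
      · have := pow_pos hc n
        refine inv_anti₀ (by positivity) ?_
        exact mul_le_mul_of_nonneg_left
          (pow_le_pow_of_le_one hc.le (Real.cos_le_one _) hk) hε0.le
    have h3 : (numCycles k θ μ ε : ℝ) ≤ N := by exact_mod_cast h2
    have h4 : 0 ≤ growth v θ ^ k := pow_nonneg (zero_le_one.trans (one_le_growth hc v)) k
    simp only [hU]
    gcongr
  refine Run.ofReal_one_sub_le_successProb _ _ _ hδ.le ?_
  refine (loss_multipleLoop_le v hsin hc hμ hμ1 hε0 (by linarith) (by nlinarith) (by linarith)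
    hs0 hrpos (T := U) (fun k => zero_le_one.trans (hU1 k)) (n := n)
    (by rw [length_layersOf]; have := hF.length_pos; omega) hcount
    (fun k hk => (mul_le_mul_of_nonneg_left (hUmono k hk) hs0).trans hsU.le) n le_rfl _ φ rfl hφ
    hrate B).trans ?_
  refine ofReal_add_le_of_halves (Real.sqrt_nonneg _)
    (multiple_readout_le hn hsin hδ (Nat.le_ceil _)) ?_
  set W := min (n : ℝ) (1 / (1 - Real.cos θ)) with hW
  have hcos : 0 ≤ Real.cos θ := Real.cos_nonneg_of_mem_Icc ⟨by linarith, h1⟩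
  have hcos1 : Real.cos θ < 1 := by nlinarith [Real.sin_sq_add_cos_sq θ, Real.cos_le_one θ]
  have hW1 : 1 ≤ W := by
    refine le_min (by exact_mod_cast (by omega : 1 ≤ n)) ?_
    rw [le_div_iff₀ (by linarith)]
    linarith
  have hr1 : (1 : ℝ) ≤ r := by exact_mod_cast hrpos
  refine le_trans (Real.exp_le_exp.2 (sub_le_sub_right ?_ _))
    (exp_budget_le (A := 6 * (r * W)) hUn hδ hδ1 ?_)
  -- Since each $U$ is at least one, the readout term $s$ is absorbed into $sU$. The geometric sum
  -- then gives $12W\cdot sU_n=6W$ per copy.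
  · calc ∑ j ∈ Finset.range n, (r : ℝ) * (2 * (s * U (j + 1)) + s)
        ≤ ∑ j ∈ Finset.range n, (r : ℝ) * (3 * (s * U (j + 1))) := by
          refine Finset.sum_le_sum fun j _ => mul_le_mul_of_nonneg_left ?_ (by positivity)
          nlinarith [hU1 (j + 1)]
      _ = r * (3 * (s * (40 * ((N : ℝ) * (layersOf F).length) *
            ∑ j ∈ Finset.range n, growth v θ ^ (j + 1)))) := by
          simp only [Finset.mul_sum, hU]
      _ ≤ r * (3 * (s * (40 * ((N : ℝ) * (layersOf F).length) * (4 * W * growth v θ ^ n)))) := by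
          have := sum_growth_le h0 h1 v n
          gcongr
      _ = r * (12 * W * (s * U n)) := by simp only [hU]; ring
      _ = 6 * (r * W) := by rw [hsU]; ring
  · refine le_trans ?_ hB
    have hΛ := log_inv_ge hδ hδ1
    set t := tMultiple n θ δ with ht
    have ht1 : 1 ≤ t := by
      rw [ht, tMultiple, le_div_iff₀ hsq0]
      linarith
    have hrt : (r : ℝ) ≤ 17 * t := by
      have h2 : 8 * Real.log (2 * n / δ) / Real.sin θ ^ 2 ≤ 16 * t := by
        rw [ht, tMultiple, ← mul_div_assoc]
        exact div_le_div_of_nonneg_right (by linarith) hsq0.le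
      have := (Nat.ceil_lt_add_one (div_nonneg (by linarith) hsq0.le :
        0 ≤ 8 * Real.log (2 * n / δ) / Real.sin θ ^ 2)).le
      rw [← hr] at this
      linarith
    have h3 := multiple_budget_le hΛ ht1 hW1 hrt
    rw [timeBound, rpow_eq_growth_pow hc]
    have hrW : 0 ≤ (r : ℝ) * W := mul_nonneg (by linarith) (by linarith)
    exact mul_le_scaled_product hUn.le (by linarith) hTle h3

theorem multiple_solutions_of_angle_ge (θ₀ : ℝ) (hθ₀ : 0 < θ₀) : ∃ C : ℝ, 0 < C ∧
    ∀ (v : Version) (n : ℕ) (F : List (Fin n → Fin 3)) (φ : CNF n) (θ μ δ : ℝ),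
      2 ≤ n → IsPerfectHashFamily F →
      (F.length : ℝ) ≤ 3 / Real.log (27 / 21) * Real.log n →
      φ.IsThreeSAT → (∃ x, φ.Sat x) → θ₀ ≤ θ → θ ≤ Real.pi / 2 → 0 < δ → δ ≤ 1 / 2 →
      0 < μ → μ < 1 → IsUniformRate θ μ n (layersOf F) φ →
      ∀ B : ℕ, C * timeBound v n θ μ δ (tMultiple n θ δ) ≤ B →
        ENNReal.ofReal (1 - δ) ≤ (solveMultiple v θ μ δ (layersOf F) φ).successProb B φ.Sat := by
  obtain ⟨C, hC, H⟩ := multiple_solutions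
  have hpi := Real.pi_pos
  -- The truncation keeps $\cos\theta_1<1$ and places $\theta_1$ where the cosine decreases, so
  -- $1/(1-\cos\theta)\le1/(1-\cos\theta_1)$ can be moved into the constant.
  set θ₁ := min θ₀ (Real.pi / 2) with hθ₁
  have h1pos : 0 < θ₁ := lt_min hθ₀ (by linarith)
  have hcos : Real.cos θ₁ < 1 := by
    have : Real.cos θ₁ < Real.cos 0 :=
      Real.cos_lt_cos_of_nonneg_of_le_pi_div_two le_rfl (min_le_right _ _) h1pos
    rwa [Real.cos_zero] at this
  refine ⟨C * (1 / (1 - Real.cos θ₁)), mul_pos hC (one_div_pos.2 (by linarith)), ?_⟩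
  intro v n F φ θ μ δ hn hF hlen h3 hφ hθ hθ1 hδ hδ1 hμ hμ1 hrate B hB
  have hθpos : 0 < θ := hθ₀.trans_le hθ
  refine H v n F φ θ μ δ hn hF hlen h3 hφ hθpos hθ1 hδ hδ1 hμ hμ1 hrate B (le_trans ?_ hB)
  have hc := cos_half_pos hθpos hθ1
  have hcosle : Real.cos θ ≤ Real.cos θ₁ :=
    Real.cos_le_cos_of_nonneg_of_le_pi h1pos.le (by linarith) ((min_le_left _ _).trans hθ)
  have htb : 0 ≤ timeBound v n θ μ δ (tMultiple n θ δ) := by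
    have h4 := log_inv_ge hδ hδ1
    have h5 := log_div_ge hn hδ hδ1
    have h6 := log_two_gt
    have h7 : 0 ≤ Real.log n := Real.log_natCast_nonneg n
    have h8 := one_le_growth hc v
    rw [timeBound, rpow_eq_growth_pow hc, tMultiple]
    have h9 : 0 ≤ Real.log (n / δ) := by linarith
    positivity
  refine mul_le_mul_of_nonneg_right (mul_le_mul_of_nonneg_left ?_ hC.le) htb
  refine (min_le_right _ _).trans ?_
  exact one_div_le_one_div_of_le (by linarith) (by linarith)

end QSat

theorem mainTheorem1 :
    -- hash families of logarithmic size exist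
    (∀ n : ℕ, 2 ≤ n → ∃ F : List (Fin n → Fin 3),
      QSat.IsPerfectHashFamily F ∧ (F.length : ℝ) ≤ 3 / Real.log (27 / 21) * Real.log n) ∧
    -- rates of convergence less than one exist
    (∀ (n : ℕ) (F : List (Fin n → Fin 3)) (φ : QSat.CNF n) (θ : ℝ),
      QSat.IsPerfectHashFamily F → φ.IsThreeSAT → 0 < θ → θ ≤ Real.pi / 2 →
      ∃ μ : ℝ, 0 < μ ∧ μ < 1 ∧ QSat.IsRate θ μ (QSat.layersOf F) φ ∧
        QSat.IsUniformRate θ μ n (QSat.layersOf F) φ) ∧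
    -- promised unique solution, with an absolute constant
    (∃ C : ℝ, 0 < C ∧
      ∀ (v : QSat.Version) (n : ℕ) (F : List (Fin n → Fin 3)) (φ : QSat.CNF n) (θ μ δ : ℝ),
        2 ≤ n → QSat.IsPerfectHashFamily F →
        (F.length : ℝ) ≤ 3 / Real.log (27 / 21) * Real.log n →
        φ.IsThreeSAT → (∃! x, φ.Sat x) → 0 < θ → θ ≤ Real.pi / 2 → 0 < δ → δ ≤ 1 / 2 →
        0 < μ → μ < 1 → QSat.IsRate θ μ (QSat.layersOf F) φ →
        ∀ B : ℕ, C * QSat.timeBound v n θ μ δ (QSat.tUnique n θ δ) ≤ B →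
          ENNReal.ofReal (1 - δ) ≤
            (QSat.solveUnique v θ μ δ (QSat.layersOf F) φ).successProb B φ.Sat) ∧
    -- possibly multiple solutions, with a constant that depends on a lower bound for the angle
    (∀ θ₀ : ℝ, 0 < θ₀ → ∃ C : ℝ, 0 < C ∧
      ∀ (v : QSat.Version) (n : ℕ) (F : List (Fin n → Fin 3)) (φ : QSat.CNF n) (θ μ δ : ℝ),
        2 ≤ n → QSat.IsPerfectHashFamily F →
        (F.length : ℝ) ≤ 3 / Real.log (27 / 21) * Real.log n →
        φ.IsThreeSAT → (∃ x, φ.Sat x) → θ₀ ≤ θ → θ ≤ Real.pi / 2 → 0 < δ → δ ≤ 1 / 2 →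
        0 < μ → μ < 1 → QSat.IsUniformRate θ μ n (QSat.layersOf F) φ →
        ∀ B : ℕ, C * QSat.timeBound v n θ μ δ (QSat.tMultiple n θ δ) ≤ B →
          ENNReal.ofReal (1 - δ) ≤
            (QSat.solveMultiple v θ μ δ (QSat.layersOf F) φ).successProb B φ.Sat) ∧
    -- possibly multiple solutions, with an absolute constant and the dependence on the angle explicit
    (∃ C : ℝ, 0 < C ∧
      ∀ (v : QSat.Version) (n : ℕ) (F : List (Fin n → Fin 3)) (φ : QSat.CNF n) (θ μ δ : ℝ),
        2 ≤ n → QSat.IsPerfectHashFamily F →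
        (F.length : ℝ) ≤ 3 / Real.log (27 / 21) * Real.log n →
        φ.IsThreeSAT → (∃ x, φ.Sat x) → 0 < θ → θ ≤ Real.pi / 2 → 0 < δ → δ ≤ 1 / 2 →
        0 < μ → μ < 1 → QSat.IsUniformRate θ μ n (QSat.layersOf F) φ →
        ∀ B : ℕ,
          C * min (n : ℝ) (1 / (1 - Real.cos θ)) *
            QSat.timeBound v n θ μ δ (QSat.tMultiple n θ δ) ≤ B →
          ENNReal.ofReal (1 - δ) ≤
            (QSat.solveMultiple v θ μ δ (QSat.layersOf F) φ).successProb B φ.Sat) := by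
  refine ⟨QSat.exists_hashFamily, ?_, ?_, ?_, QSat.multiple_solutions⟩
  · intro n F φ θ hF hφ _ _
    exact QSat.exists_rate (QSat.covers_layersOf hF hφ)
  · exact QSat.unique_solution
  · exact QSat.multiple_solutions_of_angle_ge
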